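/- **Setting.** Let $\mathfrak g$ be a simply-laced simple Lie algebra with Cartan matrix $C$, of type $A_{2r-1}$, $D_{r+1}$ ($r\ge 2$), $E_6$ or $D_4$, and let $\overline\sigma$ be a nontrivial automorphism of its Dynkin diagram, of order $\kappa=2,2,2,3$ respectively. Let $I_r=\{1,\dots,r\}$ label the $\overline\sigma$-orbits of nodes ($r=4$ for $E_6$, $r=2$ for $D_4$), and let $\overline C=(\overline C_{ab})_{a,b\in I_r}$ be the Cartan matrix of $\mathfrak g^\sigma$ (of type $C_r$, $B_r$, $F_4$, $G_2$ respectively): for orbit representatives $a,b$, $\overline C_{ab}=C_{ab}$ if $\overline\sigma(a)=a$, and $\overline C_{ab}=\sum_{k=0}^{\kappa-1}C_{\overline\sigma^k(a),b}$ otherwise. Put $t_a^\vee=\kappa$ if $\overline\sigma(a)=a$, $t_a^\vee=1$ otherwise, and $k_{ab}=\max(t_a^\vee,t_b^\vee)$. Let $\xi\in\mathbb C$ be a primitive $\kappa$-th root of unity and $\overline{\mathbf m}=(m^{(1)},\dots,m^{(r)})\in\mathbb Z_{\ge0}^r$. **The space $\mathcal U[\overline{\mathbf m}]$** (the space of functions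 dual to the component of weight $\overline{\mathbf m}$ of $U(\mathfrak n_-[t^{\pm1}]^\sigma)$) is the space of rational functions in the variables $x_i^{(a)}$ ($a\in I_r$, $1\le i\le m^{(a)}$) of the form $$g=\frac{g_1}{\prod_{a<b,\ \overline C_{ab}<0}\ \prod_{i,j}\bigl((x_i^{(a)})^{k_{ab}}-(x_j^{(b)})^{k_{ab}}\bigr)},$$ where $g_1$ is a complex Laurent polynomial in the $(x_i^{(a)})^{t_a^\vee}$, symmetric in $\{x_i^{(a)}\mid 1\le i\le m^{(a)}\}$ for each $a$, such that, whenever $\overline C_{ab}<0$, $i\ne j$ and $1\le k\le m^{(b)}$, $g_1$ vanishes on $x_i^{(a)}=x_j^{(a)}=x_k^{(b)}$ and, if moreover $\max(t_a^\vee,t_b^\vee)=\kappa$, also on $x_i^{(a)}=x_j^{(a)}=\xi^l x_k^{(b)}$ for $1\le l\le\kappa-1$. **Evaluation maps.** A multipartition $\boldsymbol\mu=(\mu^{(1)},\dots,\mu^{(r)})\vdash\overline{\mathbf m}$ consists of a partition $\mu^{(a)}$ of $m^{(a)}$ for each $a$; let $m_{a,i}$ be the number of parts of $\mu^{(a)}$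 equal to $i$. Take variables $y_{i,s}^{(a)}$, one for each part $(i,s)$, $1\le s\le m_{a,i}$, of $\mu^{(a)}$. Choose a collection of tableaux: for each $a$, a bijective filling of the Young diagram of $\mu^{(a)}$ by $1,\dots,m^{(a)}$. The evaluation map $\varphi_{\boldsymbol\mu}$ substitutes $x_n^{(a)}=y_{i,s}^{(a)}$ if $n$ lies in the row $(i,s)$, and maps $\mathcal U[\overline{\mathbf m}]$ to functions of the $y$'s. Order multipartitions lexicographically: $\boldsymbol\mu>\boldsymbol\nu$ if for some $a$ one has $\mu^{(b)}=\nu^{(b)}$ for all $b<a$ and $\mu^{(a)}>\nu^{(a)}$ lexicographically. Put $$\Gamma_{\boldsymbol\mu}=\bigcap_{\boldsymbol\nu>\boldsymbol\mu}\ker\varphi_{\boldsymbol\nu},\qquad \Gamma'_{\boldsymbol\mu}=\bigcap_{\boldsymbol\nu\ge\boldsymbol\mu}\ker\varphi_{\boldsymbol\nu}$$ as subspaces of $\mathcal U[\overline{\mathbf m}]$, and let $\operatorname{gr}\mathcal U[\overline{\mathbf m}]=\bigoplus_{\boldsymbol\mu}\Gamma_{\boldsymbol\mu}/\Gamma_{<\boldsymbol\mu}$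 be the associated graded space of the filtration $(\Gamma_{\boldsymbol\mu})_{\boldsymbol\mu}$, where $\Gamma_{<\boldsymbol\mu}=\sum_{\boldsymbol\nu<\boldsymbol\mu}\Gamma_{\boldsymbol\nu}$ is the step that precedes $\Gamma_{\boldsymbol\mu}$. **The space $\tilde{\mathcal H}[\boldsymbol\mu]$** is the space of rational functions $$h=\frac{\prod_{a}\prod_{(i,s)>(j,s')}\bigl((y_{i,s}^{(a)})^{t_a^\vee}-(y_{j,s'}^{(a)})^{t_a^\vee}\bigr)^{2\min(i,j)}}{\prod_{a<b,\ \overline C_{ab}<0}\ \prod_{(i,s),(j,s')}\bigl((y_{i,s}^{(a)})^{k_{ab}}-(y_{j,s'}^{(b)})^{k_{ab}}\bigr)^{\min(i,j)}}\;h_1,$$ where $(i,s)>(j,s')$ means $i>j$, or $i=j$ and $s<s'$, and $h_1$ is an arbitrary complex Laurent polynomial in the $(y_{i,s}^{(a)})^{t_a^\vee}$ that is symmetric in $\{y_{i,s}^{(a)}\mid 1\le s\le m_{a,i}\}$ for every pair $(a,i)$. All these spaces are graded by total degree, each variable $x_i^{(a)}$, $y_{i,s}^{(a)}$ having degree $1$.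 **Theorem 3.4.** For every $\overline{\mathbf m}$ and every choice of tableaux, and for every multipartition $\boldsymbol\mu$ of $\overline{\mathbf m}$, the evaluation map $\varphi_{\boldsymbol\mu}$ induces an isomorphism of $\mathbb Z$-graded vector spaces $$\overline\varphi_{\boldsymbol\mu}\colon\Gamma_{\boldsymbol\mu}/\Gamma'_{\boldsymbol\mu}\;\xrightarrow{\ \cong\ }\;\tilde{\mathcal H}[\boldsymbol\mu].$$ Consequently the maps $\varphi_{\boldsymbol\mu}$ induce an isomorphism of graded vector spaces $\operatorname{gr}\mathcal U[\overline{\mathbf m}]\cong\bigoplus_{\boldsymbol\mu\vdash\overline{\mathbf m}}\tilde{\mathcal H}[\boldsymbol\mu]$. -/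

import Mathlib

namespace TwistedLoop

open scoped DirectSum

/-! ## Diagram automorphisms and folded Cartan matrices -/

/-- A simply-laced Cartan matrix `cartan` together with a diagram automorphism `aut` of order
`κ` having `r` orbits, and a list `rep` of representatives of the orbits.  All indices are
counted from `0`. -/
structure Folding where
  /-- number of nodes of the unfolded Dynkin diagram -/
  nodes : ℕ
  /-- Cartan matrix of the simply-laced Lie algebra `𝔤` -/
  cartan : Matrix (Fin nodes) (Fin nodes) ℤ
  /-- the diagram automorphism -/
  aut : Equiv.Perm (Fin nodes)
  /-- the order of the diagram automorphism -/
  κ : ℕ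
  /-- the number of orbits, that is, the rank of the fixed point algebra `𝔤^σ` -/
  r : ℕ
  /-- representatives of the orbits; `Fin r` is the set `I_r` of labels of the simple roots of
  `𝔤^σ` -/
  rep : Fin r → Fin nodes

/-- The types `A_{2r-1}^{(2)}` (`r ≥ 2`), `D_{r+1}^{(2)}` (`r ≥ 2`), `E_6^{(2)}`, `D_4^{(3)}`:
all nontrivial diagram automorphisms of connected simply-laced diagrams not of type `A_{2r}`. -/
inductive TwistedType where
  | A2 (r : ℕ) (hr : 2 ≤ r)
  | D2 (r : ℕ) (hr : 2 ≤ r)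
  | E62
  | D43

/-- The diagram, the automorphism and the orbit representatives of each type.
* `A_{2r-1}`: the flip of the chain, with representatives the first `r` nodes.
* `D_{r+1}`: the exchange of the last two nodes, with representatives the first `r` nodes.
* `E_6`: the flip of the diagram.  In Mathlib's (Bourbaki's) labels, counted from `0`, the long
  chain is `0 - 2 - 3 - 4 - 5` and node `1` is attached to node `3`.
* `D_4`: a rotation of the three outer nodes `0, 2, 3` about the central node `1`. -/
def TwistedType.folding : TwistedType → Folding
  | .A2 r _ =>
    { nodes := 2 * r - 1
      cartan := CartanMatrix.A (2 * r - 1)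
      aut := Fin.revPerm
      κ := 2
      r := r
      rep := Fin.castLE (by omega) }
  | .D2 r hr =>
    { nodes := r + 1
      cartan := CartanMatrix.D (r + 1)
      aut := Equiv.swap ⟨r - 1, by omega⟩ ⟨r, by omega⟩
      κ := 2
      r := r
      rep := Fin.castSucc }
  | .E62 =>
    { nodes := 6
      cartan := CartanMatrix.E₆
      aut := Equiv.swap 0 5 * Equiv.swap 2 4
      κ := 2
      r := 4
      rep := ![0, 2, 3, 1] }
  | .D43 =>
    { nodes := 4
      cartan := CartanMatrix.D 4
      aut := Equiv.swap 0 2 * Equiv.swap 2 3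
      κ := 3
      r := 2
      rep := ![0, 1] }

namespace Folding

variable (F : Folding)

/-- The Cartan matrix `C̄_{ab} = ᾱ_b(ᾱ_a^∨)` of `𝔤^σ`: the simple root `ᾱ_b` is the restriction
of `α_{rep b}`, and the simple coroot `ᾱ_a^∨` is `α_{rep a}^∨` if `rep a` is fixed by the
automorphism, and the sum of the simple coroots over the orbit of `rep a` otherwise. -/
def fold (a b : Fin F.r) : ℤ :=
  if F.aut (F.rep a) = F.rep a then F.cartan (F.rep a) (F.rep b)
  else ∑ k ∈ Finset.range F.κ, F.cartan ((F.aut ^ k) (F.rep a)) (F.rep b)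

/-- The integers `t_a^∨`: `κ` if the simple root `ᾱ_a` is long (`rep a` is fixed), `1` if it is
short. -/
def t (a : Fin F.r) : ℕ := if F.aut (F.rep a) = F.rep a then F.κ else 1

/-- `k_{ab} = max (t_a^∨, t_b^∨)`. -/
def k (a b : Fin F.r) : ℕ := max (F.t a) (F.t b)

/-! ## Functions in a family of labelled variables

`V` is a finite set of variables and `ℓ : V → I_r` their labels.  Rational functions that are
regular at all points with nonzero coordinates off the hypersurfaces `x_v ^ k_{ab} = x_w ^ k_{ab}`
(`a = ℓ v`, `b = ℓ w`, `C̄_{ab} < 0`) are represented by the functions that they define on the set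
of these points, which is open and dense in affine space. -/

section Labelled

variable {V : Type} (ℓ : V → Fin F.r)

/-- The points with nonzero coordinates where `x_v ^ k_{ab} ≠ x_w ^ k_{ab}` whenever
`C̄_{ab} < 0`. -/
def Reg : Set (V → ℂˣ) :=
  {x | ∀ v w, F.fold (ℓ v) (ℓ w) < 0 →
    (x v : ℂ) ^ F.k (ℓ v) (ℓ w) ≠ (x w : ℂ) ^ F.k (ℓ v) (ℓ w)}

/-- Simultaneous rescaling of all the variables. -/
def scale (c : ℂˣ) (x : F.Reg ℓ) : F.Reg ℓ :=
  ⟨fun v => c * x.1 v, fun v w h => by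
    have hx := x.2 v w h
    simpa [mul_pow] using hx⟩

/-- Functions that are homogeneous of total degree `d` in the variables (each of degree `1`). -/
def homog (d : ℤ) : Submodule ℂ (F.Reg ℓ → ℂ) where
  carrier := {f | ∀ (c : ℂˣ) (x : F.Reg ℓ), f (F.scale ℓ c x) = (c : ℂ) ^ d * f x}
  add_mem' := fun hf hg c x => by simp [hf c x, hg c x, mul_add]
  zero_mem' := fun c x => by simp
  smul_mem' := fun z f hf c x => by simp [hf c x, mul_left_comm]

/-- Restriction to the regular points followed by multiplication by the function `p`. -/
def mulRestrict (p : F.Reg ℓ → ℂ) : ((V → ℂˣ) → ℂ) →ₗ[ℂ] (F.Reg ℓ → ℂ) where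
  toFun f := fun x => p x * f x.1
  map_add' f g := by ext x; simp [mul_add]
  map_smul' c f := by ext x; simp [mul_left_comm]

variable [Fintype V]

/-- Laurent polynomials in the variables `x_v ^ {t_a^∨}`, `a = ℓ v`, as functions on the torus. -/
def laurent : Submodule ℂ ((V → ℂˣ) → ℂ) :=
  Submodule.span ℂ (Set.range fun (n : V → ℤ) (x : V → ℂˣ) =>
    ∏ v, (x v : ℂ) ^ ((F.t (ℓ v) : ℤ) * n v))

/-- Those Laurent polynomials that are symmetric in each set of variables on which the map `s`
is constant. -/
def symmLaurent {S : Type} (s : V → S) : Submodule ℂ ((V → ℂˣ) → ℂ) where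
  carrier := {f | f ∈ F.laurent ℓ ∧
    ∀ π : Equiv.Perm V, (∀ v, s (π v) = s v) → ∀ x : V → ℂˣ, f (x ∘ π) = f x}
  add_mem' := fun hf hg => ⟨add_mem hf.1 hg.1, fun π hπ x => by
    simp [hf.2 π hπ x, hg.2 π hπ x]⟩
  zero_mem' := ⟨zero_mem _, fun _ _ _ => rfl⟩
  smul_mem' := fun c f hf => ⟨Submodule.smul_mem _ c hf.1, fun π hπ x => by
    simp [hf.2 π hπ x]⟩

end Labelled

/-! ## The function space `𝒰[m̄]` -/

section Spaces

variable (m : Fin F.r → ℕ)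

/-- The variables `x_i^{(a)}`, `a ∈ I_r`, `1 ≤ i ≤ m^{(a)}`. -/
abbrev XVar : Type := Σ a : Fin F.r, Fin (m a)

/-- The labels of the variables `x_i^{(a)}`. -/
abbrev xlab : F.XVar m → Fin F.r := Sigma.fst

/-- The space of numerators `g_1`: Laurent polynomials in the `(x_i^{(a)}) ^ {t_a^∨}` that are
symmetric in the variables with the same label `a`, and that vanish at
`x_i^{(a)} = x_j^{(a)} = x_k^{(b)}` whenever `C̄_{ab} < 0` and `i ≠ j`, and also at
`x_i^{(a)} = x_j^{(a)} = ξ ^ l x_k^{(b)}`, `1 ≤ l ≤ κ - 1`, if moreover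
`max (t_a^∨, t_b^∨) = κ`. -/
def numerators (ξ : ℂ) : Submodule ℂ ((F.XVar m → ℂˣ) → ℂ) where
  carrier := {f | f ∈ F.symmLaurent (F.xlab m) (F.xlab m) ∧
    (∀ a b, F.fold a b < 0 → ∀ i j : Fin (m a), i ≠ j → ∀ k : Fin (m b), ∀ x : F.XVar m → ℂˣ,
      (x ⟨a, i⟩ : ℂ) = x ⟨a, j⟩ → (x ⟨a, j⟩ : ℂ) = x ⟨b, k⟩ → f x = 0) ∧
    (∀ a b, F.fold a b < 0 → max (F.t a) (F.t b) = F.κ →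
      ∀ i j : Fin (m a), i ≠ j → ∀ k : Fin (m b), ∀ l : ℕ, 1 ≤ l → l ≤ F.κ - 1 →
      ∀ x : F.XVar m → ℂˣ,
      (x ⟨a, i⟩ : ℂ) = x ⟨a, j⟩ → (x ⟨a, j⟩ : ℂ) = ξ ^ l * x ⟨b, k⟩ → f x = 0)}
  add_mem' := fun {f g} hf hg => ⟨add_mem hf.1 hg.1,
    fun a b h i j hij k x h1 h2 => by
      simp [hf.2.1 a b h i j hij k x h1 h2, hg.2.1 a b h i j hij k x h1 h2],
    fun a b h hm i j hij k l hl hl' x h1 h2 => by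
      simp [hf.2.2 a b h hm i j hij k l hl hl' x h1 h2,
        hg.2.2 a b h hm i j hij k l hl hl' x h1 h2]⟩
  zero_mem' := ⟨zero_mem _, fun _ _ _ _ _ _ _ _ _ _ => rfl,
    fun _ _ _ _ _ _ _ _ _ _ _ _ _ _ => rfl⟩
  smul_mem' := fun c f hf => ⟨Submodule.smul_mem _ c hf.1,
    fun a b h i j hij k x h1 h2 => by simp [hf.2.1 a b h i j hij k x h1 h2],
    fun a b h hm i j hij k l hl hl' x h1 h2 => by
      simp [hf.2.2 a b h hm i j hij k l hl hl' x h1 h2]⟩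

/-- The denominator `∏_{a < b, C̄_{ab} < 0} ∏_{i, j} ((x_i^{(a)}) ^ k_{ab} - (x_j^{(b)}) ^ k_{ab})`. -/
noncomputable def xDenom (x : F.XVar m → ℂˣ) : ℂ :=
  ∏ a : Fin F.r, ∏ b ∈ Finset.univ.filter (fun b => a < b ∧ F.fold a b < 0),
    ∏ i : Fin (m a), ∏ j : Fin (m b),
      ((x ⟨a, i⟩ : ℂ) ^ F.k a b - (x ⟨b, j⟩ : ℂ) ^ F.k a b)

/-- The function space `𝒰[m̄]`: all rational functions `g_1 / xDenom`, with `g_1` a numerator as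
above. -/
noncomputable def U (ξ : ℂ) : Submodule ℂ (F.Reg (F.xlab m) → ℂ) :=
  (F.numerators m ξ).map (F.mulRestrict (F.xlab m) fun x => (F.xDenom m x.1)⁻¹)

/-! ## Multipartitions, tableaux and evaluation maps -/

/-- Multipartitions `μ = (μ^{(1)}, …, μ^{(r)})` of `m̄`. -/
abbrev MultiPartition : Type := ∀ a : Fin F.r, Nat.Partition (m a)

/-- The lexicographic order on partitions of `n`: the lists of parts, in decreasing order, are
compared lexicographically. -/
def partitionLT {n : ℕ} (p q : Nat.Partition n) : Prop :=
  List.Lex (· < ·) (p.parts.sort (· ≥ ·)) (q.parts.sort (· ≥ ·))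

variable {m}

/-- The lexicographic order on multipartitions. -/
def multiLT (μ ν : F.MultiPartition m) : Prop :=
  ∃ a, (∀ b < a, μ b = ν b) ∧ partitionLT (μ a) (ν a)

/-- The variables `y_{i,s}^{(a)}`.  An element of the type attached to the multiset of the parts
of `μ^{(a)}` is a pair `⟨i, s⟩` of a part `i` and an index `s < m_{a,i}`. -/
abbrev YVar (μ : F.MultiPartition m) : Type := Σ a : Fin F.r, (μ a).parts.ToType

/-- The labels of the variables `y_{i,s}^{(a)}`. -/
abbrev ylab (μ : F.MultiPartition m) : F.YVar μ → Fin F.r := Sigma.fst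

/-- A collection of tableaux `T_a` of shape `μ^{(a)}` on the letters `1, …, m^{(a)}`: bijections
from the letters onto the boxes, a box being a row `⟨i, s⟩` together with a position in it. -/
abbrev Tableaux (μ : F.MultiPartition m) : Type :=
  ∀ a : Fin F.r, Fin (m a) ≃ Σ p : (μ a).parts.ToType, Fin p.1

theorem nonempty_tableaux (μ : F.MultiPartition m) : Nonempty (F.Tableaux μ) := by
  refine ⟨fun a => Fintype.equivOfCardEq ?_⟩
  rw [Fintype.card_fin, Fintype.card_sigma]
  simp only [Fintype.card_fin]
  calc m a = (μ a).parts.sum := (μ a).parts_sum.symm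
    _ = _ := Multiset.sum_eq_sum_coe _

/-- The row of the tableau in which a letter lies, so that `x_n^{(a)}` is sent to
`y_{i,s}^{(a)}` if `n` is in the row `⟨i, s⟩` of `T_a`. -/
def row {μ : F.MultiPartition m} (T : F.Tableaux μ) (v : F.XVar m) : F.YVar μ :=
  ⟨v.1, (T v.1 v.2).1⟩

/-- The substitution `x_n^{(a)} = y_{i,s}^{(a)}` on points. -/
def substitute {μ : F.MultiPartition m} (T : F.Tableaux μ) (y : F.Reg (F.ylab μ)) :
    F.Reg (F.xlab m) :=
  ⟨fun v => y.1 (F.row T v), fun v w h => y.2 (F.row T v) (F.row T w) h⟩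

/-- The space `ℋ[μ]` of functions in the variables `y_{i,s}^{(a)}`. -/
abbrev H (μ : F.MultiPartition m) : Type := F.Reg (F.ylab μ) → ℂ

/-- The evaluation map `φ_{μ,T}`.  It is defined on all functions of the `x_i^{(a)}`, and is used
on `𝒰[m̄]` only. -/
noncomputable def φ {μ : F.MultiPartition m} (T : F.Tableaux μ) :
    (F.Reg (F.xlab m) → ℂ) →ₗ[ℂ] F.H μ :=
  LinearMap.funLeft ℂ ℂ (F.substitute T)

/-! ## The filtration -/

variable (ξ : ℂ) (T : ∀ μ : F.MultiPartition m, F.Tableaux μ)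

/-- `Γ_μ`, the intersection of the kernels of the `φ_ν : 𝒰[m̄] → ℋ[ν]` with `ν > μ`. -/
noncomputable def Γ (μ : F.MultiPartition m) : Submodule ℂ (F.Reg (F.xlab m) → ℂ) :=
  F.U m ξ ⊓ ⨅ ν, ⨅ _ : F.multiLT μ ν, LinearMap.ker (F.φ (T ν))

/-- `Γ'_μ`, the intersection of the kernels of the `φ_ν : 𝒰[m̄] → ℋ[ν]` with `ν ≥ μ`. -/
noncomputable def Γ' (μ : F.MultiPartition m) : Submodule ℂ (F.Reg (F.xlab m) → ℂ) :=
  F.U m ξ ⊓ ⨅ ν, ⨅ _ : F.multiLT μ ν ∨ μ = ν, LinearMap.ker (F.φ (T ν))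

/-- The step of the filtration `(Γ_μ)` of `𝒰[m̄]` that precedes `Γ_μ` (it is `0` if `μ` is the
smallest multipartition). -/
noncomputable def Γpred (μ : F.MultiPartition m) : Submodule ℂ (F.Reg (F.xlab m) → ℂ) :=
  ⨆ ν, ⨆ _ : F.multiLT ν μ, F.Γ ξ T ν

/-- The component of degree `d` of the quotient of `Γ_μ` by `Γ_μ ∩ W`, for the grading by the
total degree in the variables: the classes of the functions of degree `d` in `Γ_μ`. -/
noncomputable def quotDeg (W : Submodule ℂ (F.Reg (F.xlab m) → ℂ)) (μ : F.MultiPartition m)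
    (d : ℤ) : Submodule ℂ (F.Γ ξ T μ ⧸ W.submoduleOf (F.Γ ξ T μ)) :=
  ((F.homog (F.xlab m) d).submoduleOf (F.Γ ξ T μ)).map (W.submoduleOf (F.Γ ξ T μ)).mkQ

/-- The associated graded space of the filtration `(Γ_μ)` of `𝒰[m̄]`. -/
abbrev gr : Type :=
  ⨁ μ : F.MultiPartition m, F.Γ ξ T μ ⧸ (F.Γpred ξ T μ).submoduleOf (F.Γ ξ T μ)

/-- The component of degree `d` of the associated graded space, for the grading by the total
degree in the variables. -/
noncomputable def grDeg (d : ℤ) : Submodule ℂ (F.gr ξ T) :=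
  ⨆ μ, (F.quotDeg ξ T (F.Γpred ξ T μ) μ d).map (DirectSum.lof ℂ _ _ μ)

/-! ## The spaces `ℋ̃[μ]` -/

/-- The order on the parts of a partition: `(i, s) > (j, s')` if `i > j`, or `i = j` and
`s < s'`. -/
def partGT {M : Multiset ℕ} (p q : M.ToType) : Prop :=
  q.1 < p.1 ∨ (p.1 = q.1 ∧ p.2.1 < q.2.1)

open Classical in
/-- The prescribed zeros
`∏_a ∏_{(i,s) > (j,s')} ((y_{i,s}^{(a)}) ^ {t_a^∨} - (y_{j,s'}^{(a)}) ^ {t_a^∨}) ^ {2 min (i, j)}`. -/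
noncomputable def yNum (μ : F.MultiPartition m) (y : F.YVar μ → ℂˣ) : ℂ :=
  ∏ a : Fin F.r, ∏ p : (μ a).parts.ToType, ∏ q ∈ Finset.univ.filter (fun q => partGT p q),
    ((y ⟨a, p⟩ : ℂ) ^ F.t a - (y ⟨a, q⟩ : ℂ) ^ F.t a) ^ (2 * min p.1 q.1)

/-- The prescribed poles `∏_{a < b, C̄_{ab} < 0} ∏_{(i,s), (j,s')}
((y_{i,s}^{(a)}) ^ k_{ab} - (y_{j,s'}^{(b)}) ^ k_{ab}) ^ {min (i, j)}`. -/
noncomputable def yDenom (μ : F.MultiPartition m) (y : F.YVar μ → ℂˣ) : ℂ :=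
  ∏ a : Fin F.r, ∏ b ∈ Finset.univ.filter (fun b => a < b ∧ F.fold a b < 0),
    ∏ p : (μ a).parts.ToType, ∏ q : (μ b).parts.ToType,
      ((y ⟨a, p⟩ : ℂ) ^ F.k a b - (y ⟨b, q⟩ : ℂ) ^ F.k a b) ^ (min p.1 q.1)

/-- The space `ℋ̃[μ]` of the functions `h = (yNum / yDenom) h_1`, with `h_1` any Laurent polynomial
in the `(y_{i,s}^{(a)}) ^ {t_a^∨}` that is symmetric in the variables with the same pair
`(a, i)`. -/
noncomputable def Htilde (μ : F.MultiPartition m) : Submodule ℂ (F.H μ) :=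
  (F.symmLaurent (F.ylab μ) (fun v => (v.1, v.2.1))).map
    (F.mulRestrict (F.ylab μ) fun y => F.yNum μ y.1 / F.yDenom μ y.1)

/-- The component of degree `d` of `ℋ̃[μ]`. -/
noncomputable def HtildeDeg (μ : F.MultiPartition m) (d : ℤ) : Submodule ℂ (F.Htilde μ) :=
  (F.homog (F.ylab μ) d).submoduleOf (F.Htilde μ)

/-- The component of degree `d` of the direct sum of the `ℋ̃[μ]`. -/
noncomputable def sumHtildeDeg (m : Fin F.r → ℕ) (d : ℤ) :
    Submodule ℂ (⨁ μ : F.MultiPartition m, F.Htilde μ) :=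
  ⨆ μ, (F.HtildeDeg μ d).map
    (DirectSum.lof ℂ (F.MultiPartition m) (fun μ => F.Htilde μ) μ)

end Spaces

end Folding

end TwistedLoop

/-!
The theorem amounts to two facts about an evaluation map `φ_μ`: it sends `Γ_μ` into `ℋ̃[μ]`, and
it sends `Γ_μ` onto `ℋ̃[μ]`.  Its kernel on `Γ_μ` is `Γ'_μ` by definition, and everything else is
formal.  Only three properties of the folded Cartan matrix are used: `κ > 0`, the symmetry of the
relation `C̄_{ab} < 0`, and its irreflexivity.

*Image.*  Let `g_1` be the numerator of an element of `Γ_μ`, made into a polynomial by a power of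
the product of all variables.  For rows `v` and `w` with the same label, `w` not longer than `v`,
evaluate all variables except those of the row `w`.  If one letter of `w` is now set equal to
`y_v`, the row `v` gets longer and the multipartition greater (`multiLT_split`), so that the
polynomial vanishes.  As it is symmetric in this letter and those of `v`, all its partial
derivatives in these letters agree, so the zero is double (`lin_sq_dvd_rename`).  The letters of
`w` together give a zero of order `2 min (i, j)` (`lin_one_dvd`).  For rows of lengths `i ≥ j` with
linked labels, the vanishing at two equal letters of the longer row gives a zero of order `i - 1`
for each letter of the shorter row (`lin_pow_dvd_rename`), hence one of order
`i j - min (i, j)` in total (`lin_pow_dvd_of_linked`).  The evaluated denominator has zeros of order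
`i j`, and what is left is the pole of order `min (i, j)` of `ℋ̃[μ]`.  The zeros at the other roots
of unity come from the invariance of a Laurent polynomial in the powers `x ^ t` under the `t`-th
roots of unity, or from the conditions on `g_1` that involve `ξ`.  As the factors are coprime, their
product divides the evaluated numerator (`yFactor_dvd`), and the quotient is again a symmetric
Laurent polynomial (`exists_eq_yFactor_mul`).

*Surjectivity.*  Given `h`, place the letters in the boxes of `μ`.  The contribution of a placement
is `h` at the letters of the first column, times factors that separate each box of a row from the
boxes in the same column and in the cyclically next column of the preceding rows of the same label,
times factors that separate boxes with linked labels in different columns.  The sum `symNum` over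
all placements is a numerator: of three boxes as in the vanishing conditions, either two with
linked labels are in different columns or all are in one column, and some factor vanishes in both
cases (`term_vanish`).  If a contribution survives the evaluation at `ν`, no two boxes of a column
go to one row of `ν`, so that `ν` is dominated by `μ` (`excess_le_of_filling`) and not greater than
`μ`.  For `ν = μ` the factors for cyclically next columns force the boxes of each row to go to one
row (`filling_rigid`), so that the value is a positive multiple of the numerator prescribed by `h`
(`term_eval`).

*Gradings.*  The spaces are stable under rescaling of the variables, whose eigenvalues `c ^ d`
separate the degrees: `graded_of_scale_stable` shows that `Γ_μ` is graded, and
`iSupIndep_of_injective_of_eigen` that the components of `ℋ̃[μ]` are independent.  An isomorphism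
that maps spanning components into independent ones identifies two gradings (`gradings_of_map_le`).
The step of the filtration that precedes `Γ_μ` is `Γ'_μ` (`Γpred_eq`), and this gives the statement
on the associated graded space.
-/

namespace TwistedLoop

/-! ### Eigenspaces and transport of gradings -/

/-- A subspace that is stable under `S` contains the components of each of its elements with
respect to eigenvectors of `S` for distinct eigenvalues. -/
theorem mem_of_sum_eigenvectors {E ι : Type*} [AddCommGroup E] [Module ℂ E] (S : E →ₗ[ℂ] E)
    (W : Submodule ℂ E) (hW : ∀ f ∈ W, S f ∈ W) (ev : ι → ℂ) (hev : Function.Injective ev)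
    (s : Finset ι) : ∀ f : ι → E, (∀ d ∈ s, S (f d) = ev d • f d) → ∑ d ∈ s, f d ∈ W →
      ∀ d ∈ s, f d ∈ W := by
  classical
  induction s using Finset.induction_on with
  | empty => simp
  | insert e s he ih =>
    intro f hf hsum
    have key : ∀ d ∈ s, (ev d - ev e) • f d ∈ W := by
      refine ih (fun d => (ev d - ev e) • f d) (fun d hd => ?_) ?_
      · rw [map_smul, hf d (Finset.mem_insert_of_mem hd), smul_comm]
      · have h2 := W.sub_mem (hW _ hsum) (W.smul_mem (ev e) hsum)
        rw [Finset.sum_insert he, map_add, hf e (Finset.mem_insert_self _ _), smul_add, map_sum,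
          add_sub_add_left_eq_sub, Finset.smul_sum, ← Finset.sum_sub_distrib] at h2
        convert h2 using 1
        refine Finset.sum_congr rfl fun d hd => ?_
        rw [hf d (Finset.mem_insert_of_mem hd), sub_smul]
    have hs : ∀ d ∈ s, f d ∈ W := fun d hd => by
      have hne : ev d - ev e ≠ 0 := sub_ne_zero.2 fun h => he (hev h ▸ hd)
      exact (W.smul_mem_iff hne).1 (key d hd)
    intro d hd
    rcases Finset.mem_insert.1 hd with rfl | hd
    · rw [Finset.sum_insert he] at hsum
      exact (W.add_mem_iff_left (W.sum_mem hs)).1 hsum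
    · exact hs d hd

/-- If `e` maps a family that spans into an independent one, then both are gradings, and
`e` identifies them. -/
theorem gradings_of_map_le {M N : Type*} [AddCommMonoid M] [Module ℂ M] [AddCommMonoid N]
    [Module ℂ N] (e : M ≃ₗ[ℂ] N) (A : ℤ → Submodule ℂ M) (B : ℤ → Submodule ℂ N)
    (hA : ⨆ d, A d = ⊤) (hAB : ∀ d, (A d).map e.toLinearMap ≤ B d) (hB : iSupIndep B) :
    DirectSum.IsInternal A ∧ DirectSum.IsInternal B ∧
      ∀ d, (A d).map e.toLinearMap = B d := by
  let := Module.addCommMonoidToAddCommGroup ℂ (M := M)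
  let := Module.addCommMonoidToAddCommGroup ℂ (M := N)
  have htop : ⨆ d, (A d).map e.toLinearMap = ⊤ := by
    rw [← Submodule.map_iSup, hA, Submodule.map_top, LinearEquiv.range]
  have heq : ∀ d, (A d).map e.toLinearMap = B d := by
    intro d
    refine le_antisymm (hAB d) fun y hy => ?_
    have hy' : y ∈ ⨆ d, (A d).map e.toLinearMap := htop ▸ Submodule.mem_top
    rw [iSup_split_single _ d] at hy'
    obtain ⟨u, hu, v, hv, rfl⟩ := Submodule.mem_sup.1 hy'
    have hv' : v ∈ ⨆ j, ⨆ _ : j ≠ d, B j :=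
      (iSup_mono fun j => iSup_mono fun _ => hAB j) hv
    have hvd : v ∈ B d := ((B d).add_mem_iff_right (hAB d hu)).1 hy
    have hv0 : v = 0 := Submodule.disjoint_def.1 (hB d) v hvd hv'
    simpa [hv0] using hu
  have hAi : iSupIndep A := by
    intro d
    rw [Submodule.disjoint_def]
    intro x hx hx'
    have h1 : e x ∈ B d := hAB d (Submodule.mem_map_of_mem hx)
    have h2 : e x ∈ ⨆ j, ⨆ _ : j ≠ d, B j := by
      have := Submodule.mem_map_of_mem (f := e.toLinearMap) hx'
      simp only [Submodule.map_iSup] at this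
      exact (iSup_mono fun j => iSup_mono fun _ => hAB j) this
    simpa using Submodule.disjoint_def.1 (hB d) _ h1 h2
  refine ⟨?_, ?_, heq⟩
  · rw [DirectSum.isInternal_submodule_iff_iSupIndep_and_iSup_eq_top]
    exact ⟨hAi, hA⟩
  · rw [DirectSum.isInternal_submodule_iff_iSupIndep_and_iSup_eq_top]
    exact ⟨hB, by simpa only [heq] using htop⟩

theorem two_zpow_injective : Function.Injective fun d : ℤ => (2 : ℂ) ^ d := by
  intro a b h
  have h' : (2 : ℝ) ^ a = (2 : ℝ) ^ b := by
    have := congrArg (fun z : ℂ => ‖z‖) h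
    simpa using this
  exact zpow_right_injective₀ (by norm_num) (by norm_num) h'

/-- Eigenspaces of a single operator for the distinct eigenvalues `2 ^ d` are independent. -/
theorem iSupIndep_of_eigen {E : Type*} [AddCommGroup E] [Module ℂ E] (S : E →ₗ[ℂ] E)
    (A : ℤ → Submodule ℂ E) (hA : ∀ d, ∀ f ∈ A d, S f = (2 : ℂ) ^ d • f) : iSupIndep A := by
  have h := (Module.End.eigenspaces_iSupIndep S).comp two_zpow_injective
  exact h.mono fun d f hf => Module.End.mem_eigenspace_iff.2 (hA d f hf)

/-- Subspaces that an injective map sends into the eigenspaces of an operator for the eigenvalues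
`2 ^ d` are independent. -/
theorem iSupIndep_of_injective_of_eigen {M E : Type*} [AddCommMonoid M] [Module ℂ M]
    [AddCommGroup E] [Module ℂ E] (i : M →ₗ[ℂ] E) (hi : Function.Injective i) (S : E →ₗ[ℂ] E)
    (A : ℤ → Submodule ℂ M) (hA : ∀ d, ∀ f ∈ A d, S (i f) = (2 : ℂ) ^ d • i f) :
    iSupIndep A := by
  have h : iSupIndep fun d => (A d).map i := by
    refine iSupIndep_of_eigen S _ fun d f hf => ?_
    obtain ⟨g, hg, rfl⟩ := hf
    exact hA d g hg
  intro d
  rw [Submodule.disjoint_def]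
  intro x hx hx'
  have h2 := Submodule.mem_map_of_mem (f := i) hx'
  simp only [Submodule.map_iSup] at h2
  exact hi ((Submodule.disjoint_def.1 (h d) _ (Submodule.mem_map_of_mem hx) h2).trans
    (map_zero i).symm)

namespace Folding

variable (F : Folding)

/-! ### The grading by the total degree -/

section Grading

variable {V : Type} (ℓ : V → Fin F.r)

/-- Rescaling of the variables by `c` as an operator on functions. -/
noncomputable def scaleOp (c : ℂˣ) : (F.Reg ℓ → ℂ) →ₗ[ℂ] (F.Reg ℓ → ℂ) :=
  LinearMap.funLeft ℂ ℂ (F.scale ℓ c)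

theorem scaleOp_homog {d : ℤ} {f : F.Reg ℓ → ℂ} (hf : f ∈ F.homog ℓ d) (c : ℂˣ) :
    F.scaleOp ℓ c f = (c : ℂ) ^ d • f := by
  ext x
  exact hf c x

/-- A subspace that is spanned inside the sum of the homogeneous components and is stable under
rescaling by `2` is graded. -/
theorem graded_of_scale_stable (W : Submodule ℂ (F.Reg ℓ → ℂ))
    (hW : ∀ f ∈ W, F.scaleOp ℓ (Units.mk0 2 two_ne_zero) f ∈ W)
    (hspan : W ≤ ⨆ d, F.homog ℓ d) :
    ⨆ d, (F.homog ℓ d).submoduleOf W = ⊤ := by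
  classical
  rw [eq_top_iff]
  rintro ⟨f, hf⟩ -
  obtain ⟨g, hg⟩ := (Submodule.mem_iSup_iff_exists_dfinsupp' _ _).1 (hspan hf)
  have hmem := mem_of_sum_eigenvectors (F.scaleOp ℓ (Units.mk0 2 two_ne_zero)) W hW
    (fun d : ℤ => (2 : ℂ) ^ d) two_zpow_injective g.support (fun d => (g d : F.Reg ℓ → ℂ))
    (fun d _ => F.scaleOp_homog ℓ (g d).2 _) (by rw [← hg] at hf; exact hf)
  have : (⟨f, hf⟩ : W) = ∑ d ∈ g.support.attach, ⟨(g d.1 : F.Reg ℓ → ℂ), hmem d.1 d.2⟩ := by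
    apply Subtype.ext
    rw [AddSubmonoidClass.coe_finsetSum]
    simp only
    rw [Finset.sum_attach g.support fun d => (g d : F.Reg ℓ → ℂ)]
    exact hg.symm
  rw [this]
  refine Submodule.sum_mem _ fun d _ => Submodule.mem_iSup_of_mem d.1 ?_
  exact (g d.1).2

end Grading

/-! ### The order on multipartitions -/

section Order

variable {m : Fin F.r → ℕ}

/-- The decreasing lists of parts, as an element of a lexicographic product. -/
def lexKey (μ : F.MultiPartition m) : Lex (∀ _ : Fin F.r, List ℕ) :=
  toLex fun a => (μ a).parts.sort (· ≥ ·)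

theorem sort_parts_injective {n : ℕ} :
    Function.Injective fun p : Nat.Partition n => p.parts.sort (· ≥ ·) := by
  intro p q h
  have := congrArg (fun l : List ℕ => (l : Multiset ℕ)) h
  simp only [Multiset.sort_eq] at this
  exact Nat.Partition.ext this

theorem multiLT_iff {μ ν : F.MultiPartition m} : F.multiLT μ ν ↔ F.lexKey μ < F.lexKey ν := by
  refine exists_congr fun a => and_congr ?_ Iff.rfl
  exact forall₂_congr fun b _ => (sort_parts_injective.eq_iff (a := μ b) (b := ν b)).symm

theorem lexKey_injective : Function.Injective (F.lexKey (m := m)) := by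
  intro μ ν h
  funext a
  exact sort_parts_injective (congrFun (toLex.injective h) a)

theorem multiLT_trans {μ ν ρ : F.MultiPartition m} (h : F.multiLT μ ν) (h' : F.multiLT ν ρ) :
    F.multiLT μ ρ := by
  rw [multiLT_iff] at *; exact h.trans h'

theorem multiLT_trichotomy (μ ν : F.MultiPartition m) :
    F.multiLT μ ν ∨ μ = ν ∨ F.multiLT ν μ := by
  rw [multiLT_iff, multiLT_iff, ← F.lexKey_injective.eq_iff]; exact lt_trichotomy _ _

/-- A multipartition that is not the smallest one has an immediate predecessor. -/
theorem exists_pred {μ ν : F.MultiPartition m} (h : F.multiLT ν μ) :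
    ∃ ρ : F.MultiPartition m, F.multiLT ρ μ ∧
      ∀ τ, F.multiLT ρ τ → F.multiLT μ τ ∨ μ = τ := by
  classical
  obtain ⟨ρ, hρ, hmax⟩ := Finset.exists_max_image
    (Finset.univ.filter fun ν : F.MultiPartition m => F.multiLT ν μ) F.lexKey ⟨ν, by simpa using h⟩
  simp only [Finset.mem_filter, Finset.mem_univ, true_and] at hρ hmax
  refine ⟨ρ, hρ, fun τ hτ => ?_⟩
  rcases F.multiLT_trichotomy μ τ with h1 | h1 | h1
  · exact Or.inl h1
  · exact Or.inr h1
  · exact absurd (F.multiLT_iff.1 hτ) (not_lt.2 (hmax τ h1))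

end Order

/-! ### Laurent polynomials as functions on the torus -/

section Laurent

theorem t_eq (a : Fin F.r) : F.t a = F.κ ∨ F.t a = 1 := by
  unfold t; split_ifs <;> simp

theorem t_pos (hκ : 0 < F.κ) (a : Fin F.r) : 0 < F.t a := by
  rcases F.t_eq a with h | h <;> omega

theorem t_dvd_κ (a : Fin F.r) : F.t a ∣ F.κ := by
  rcases F.t_eq a with h | h <;> simp [h]

theorem k_comm (a b : Fin F.r) : F.k a b = F.k b a := max_comm _ _

theorem k_self (a : Fin F.r) : F.k a a = F.t a := max_self _

theorem k_pos (hκ : 0 < F.κ) (a b : Fin F.r) : 0 < F.k a b :=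
  lt_max_of_lt_left (F.t_pos hκ a)

theorem t_dvd_k (hκ : 0 < F.κ) (a b : Fin F.r) : F.t a ∣ F.k a b := by
  unfold k
  rcases F.t_eq b with h' | h'
  · rcases max_choice (F.t a) (F.t b) with h | h <;> rw [h]
    rw [h']; exact F.t_dvd_κ a
  · rw [h', max_eq_left (F.t_pos hκ a)]

variable {V : Type} [Fintype V] (ℓ : V → Fin F.r)

theorem monomial_mem_laurent (n : V → ℤ) :
    (fun x : V → ℂˣ => ∏ v, (x v : ℂ) ^ ((F.t (ℓ v) : ℤ) * n v)) ∈ F.laurent ℓ :=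
  Submodule.subset_span ⟨n, rfl⟩

theorem one_mem_laurent : (1 : (V → ℂˣ) → ℂ) ∈ F.laurent ℓ := by
  convert F.monomial_mem_laurent ℓ 0 using 1
  ext x; simp

theorem mul_mem_laurent {f g : (V → ℂˣ) → ℂ} (hf : f ∈ F.laurent ℓ) (hg : g ∈ F.laurent ℓ) :
    f * g ∈ F.laurent ℓ := by
  refine Submodule.span_induction₂ (p := fun f g _ _ => f * g ∈ F.laurent ℓ) ?_ ?_ ?_ ?_ ?_ ?_ ?_
    hf hg
  · rintro _ _ ⟨n, rfl⟩ ⟨n', rfl⟩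
    convert F.monomial_mem_laurent ℓ (n + n') using 1
    ext x
    simp only [Pi.mul_apply, ← Finset.prod_mul_distrib]
    refine Finset.prod_congr rfl fun v _ => ?_
    rw [Pi.add_apply, mul_add, zpow_add₀ (x v).ne_zero]
  · intro y _; simp
  · intro y _; simp
  · intro x y z _ _ _ h h'; rw [add_mul]; exact add_mem h h'
  · intro x y z _ _ _ h h'; rw [mul_add]; exact add_mem h h'
  · intro c x y _ _ h; rw [smul_mul_assoc]; exact Submodule.smul_mem _ _ h
  · intro c x y _ _ h; rw [mul_smul_comm]; exact Submodule.smul_mem _ _ h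

/-- The Laurent polynomials as an algebra of functions on the torus. -/
def laurentAlg : Subalgebra ℂ ((V → ℂˣ) → ℂ) :=
  (F.laurent ℓ).toSubalgebra (F.one_mem_laurent ℓ) fun _ _ hf hg => F.mul_mem_laurent ℓ hf hg

theorem mem_laurentAlg {f : (V → ℂˣ) → ℂ} : f ∈ F.laurentAlg ℓ ↔ f ∈ F.laurent ℓ := Iff.rfl

theorem pow_mem_laurentAlg (v : V) {n : ℕ} (hn : F.t (ℓ v) ∣ n) :
    (fun x : V → ℂˣ => (x v : ℂ) ^ n) ∈ F.laurentAlg ℓ := by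
  classical
  obtain ⟨k, rfl⟩ := hn
  rw [mem_laurentAlg]
  convert F.monomial_mem_laurent ℓ (Pi.single v (k : ℤ)) using 1
  ext x
  rw [Finset.prod_eq_single v]
  · rw [Pi.single_eq_same, ← Nat.cast_mul, zpow_natCast]
  · intro w _ hw; simp [hw]
  · simp

theorem zpow_finset_sum {ι : Type*} {z : ℂ} (hz : z ≠ 0) (s : Finset ι) (e : ι → ℤ) :
    z ^ (∑ i ∈ s, e i) = ∏ i ∈ s, z ^ e i := by
  classical
  induction s using Finset.induction_on with
  | empty => simp
  | insert a s ha ih => rw [Finset.sum_insert ha, Finset.prod_insert ha, zpow_add₀ hz, ih]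

/-- Laurent polynomials pull back along maps of the variables that respect the labels. -/
theorem comp_mem_laurentAlg {W : Type} [Fintype W] (ℓ' : W → Fin F.r) (ρ : V → W)
    (hρ : ∀ v, ℓ' (ρ v) = ℓ v) {f : (V → ℂˣ) → ℂ} (hf : f ∈ F.laurentAlg ℓ) :
    (fun y : W → ℂˣ => f (y ∘ ρ)) ∈ F.laurentAlg ℓ' := by
  classical
  have h : F.laurent ℓ ≤ (F.laurent ℓ').comap
      (LinearMap.funLeft ℂ ℂ fun y : W → ℂˣ => y ∘ ρ) := by
    refine Submodule.span_le.2 ?_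
    rintro _ ⟨n, rfl⟩
    have : (fun y : W → ℂˣ => ∏ v, ((y (ρ v) : ℂˣ) : ℂ) ^ ((F.t (ℓ v) : ℤ) * n v)) ∈
        F.laurent ℓ' := by
      convert F.monomial_mem_laurent ℓ' (fun w => ∑ v ∈ Finset.univ.filter (fun v => ρ v = w), n v)
        using 1
      ext y
      rw [← Finset.prod_fiberwise (s := Finset.univ) (g := ρ)]
      refine Finset.prod_congr rfl fun w _ => ?_
      rw [Finset.mul_sum]
      rw [zpow_finset_sum (y w).ne_zero]
      refine Finset.prod_congr rfl fun v hv => ?_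
      rw [Finset.mem_filter] at hv
      rw [← hv.2, hρ]
    exact this
  exact h hf

/-! ### Laurent polynomials and polynomials -/

/-- A polynomial that vanishes at all points with nonzero coordinates is zero. -/
theorem poly_eq_zero_of_torus {V : Type} {P : MvPolynomial V ℂ}
    (h : ∀ x : V → ℂˣ, MvPolynomial.eval (fun v => (x v : ℂ)) P = 0) : P = 0 := by
  refine MvPolynomial.funext_set (fun _ => {0}ᶜ) (fun _ => (Set.finite_singleton 0).infinite_compl)
    fun x hx => ?_
  have hx' : ∀ v, x v ≠ 0 := fun v => hx v trivial
  simpa using h fun v => Units.mk0 (x v) (hx' v)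

theorem prod_coe_ne_zero (x : V → ℂˣ) : ∏ v, (x v : ℂ) ≠ 0 :=
  Finset.prod_ne_zero_iff.2 fun v _ => (x v).ne_zero

theorem exists_poly_monomial (κ : ℕ) (hκ : 0 < κ) (n : V → ℤ) :
    ∃ (P : MvPolynomial V ℂ) (N : ℕ), ∀ x : V → ℂˣ,
      (∏ v, (x v : ℂ) ^ n v) * (∏ v, (x v : ℂ)) ^ (κ * N) =
        MvPolynomial.eval (fun v => (x v : ℂ)) P := by
  obtain ⟨N, hN⟩ : ∃ N : ℕ, ∀ v, 0 ≤ n v + N := by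
    refine ⟨∑ v, (n v).natAbs, fun v => ?_⟩
    have : (n v).natAbs ≤ ∑ v, (n v).natAbs :=
      Finset.single_le_sum (f := fun v => (n v).natAbs) (fun _ _ => Nat.zero_le _)
        (Finset.mem_univ v)
    omega
  have hN' : ∀ v, 0 ≤ n v + (κ * N : ℕ) := fun v => by
    have := hN v
    have h2 : N ≤ κ * N := Nat.le_mul_of_pos_left _ hκ
    omega
  refine ⟨∏ v, MvPolynomial.X v ^ (n v + (κ * N : ℕ)).toNat, N, fun x => ?_⟩
  rw [map_prod, ← Finset.prod_pow, ← Finset.prod_mul_distrib]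
  refine Finset.prod_congr rfl fun v _ => ?_
  rw [map_pow, MvPolynomial.eval_X, ← zpow_natCast, ← zpow_natCast, Int.toNat_of_nonneg (hN' v),
    zpow_add₀ (x v).ne_zero]

/-- Clearing denominators in a Laurent polynomial, by a power of the product of the variables
whose exponent is a multiple of `κ`. -/
theorem exists_poly (hκ : 0 < F.κ) {f : (V → ℂˣ) → ℂ} (hf : f ∈ F.laurent ℓ) :
    ∃ (P : MvPolynomial V ℂ) (N : ℕ), ∀ x : V → ℂˣ,
      f x * (∏ v, (x v : ℂ)) ^ (F.κ * N) = MvPolynomial.eval (fun v => (x v : ℂ)) P := by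
  induction hf using Submodule.span_induction with
  | mem f hf =>
    obtain ⟨n, rfl⟩ := hf
    exact exists_poly_monomial F.κ hκ fun v => (F.t (ℓ v) : ℤ) * n v
  | zero => exact ⟨0, 0, fun x => by simp⟩
  | add f g _ _ hf hg =>
    obtain ⟨P, N, hP⟩ := hf
    obtain ⟨Q, M, hQ⟩ := hg
    refine ⟨P * (∏ v, MvPolynomial.X v) ^ (F.κ * M) + Q * (∏ v, MvPolynomial.X v) ^ (F.κ * N),
      N + M, fun x => ?_⟩
    simp only [map_add, map_mul, map_pow, map_prod, MvPolynomial.eval_X, ← hP, ← hQ, Pi.add_apply]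
    ring
  | smul c f _ hf =>
    obtain ⟨P, N, hP⟩ := hf
    refine ⟨MvPolynomial.C c * P, N, fun x => ?_⟩
    simp only [map_mul, MvPolynomial.eval_C, ← hP, Pi.smul_apply, smul_eq_mul]
    ring

/-- A Laurent polynomial that vanishes off the zero set of a nonzero polynomial is zero. -/
theorem laurent_eq_zero_of_dense (hκ : 0 < F.κ) {f : (V → ℂˣ) → ℂ} (hf : f ∈ F.laurent ℓ)
    {D : MvPolynomial V ℂ} (hD : D ≠ 0)
    (h : ∀ x : V → ℂˣ, MvPolynomial.eval (fun v => (x v : ℂ)) D ≠ 0 → f x = 0) : f = 0 := by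
  obtain ⟨P, N, hP⟩ := F.exists_poly ℓ hκ hf
  have h0 : P * D = 0 := poly_eq_zero_of_torus fun x => by
    rw [map_mul, ← hP]
    by_cases hx : MvPolynomial.eval (fun v => (x v : ℂ)) D = 0
    · simp [hx]
    · simp [h x hx]
  have hP0 : P = 0 := (mul_eq_zero.1 h0).resolve_right hD
  ext x
  have := hP x
  rw [hP0, map_zero] at this
  exact (mul_eq_zero.1 this).resolve_right (pow_ne_zero _ (prod_coe_ne_zero x))

theorem sum_root_zpow {t : ℕ} {ζ : ℂˣ} (hζ : IsPrimitiveRoot ζ t) (e : ℤ) :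
    ∑ l ∈ Finset.range t, ((ζ ^ l : ℂˣ) : ℂ) ^ e = if (t : ℤ) ∣ e then (t : ℂ) else 0 := by
  have hrw : ∀ l, ((ζ ^ l : ℂˣ) : ℂ) ^ e = ((ζ ^ e : ℂˣ) : ℂ) ^ l := by
    intro l
    rw [← Units.val_zpow_eq_zpow_val, ← Units.val_pow_eq_pow_val, ← zpow_natCast, ← zpow_natCast,
      ← zpow_mul, ← zpow_mul, mul_comm]
  simp only [hrw]
  split_ifs with h
  · rw [(hζ.zpow_eq_one_iff_dvd e).2 h]; simp
  · have h1 : ((ζ ^ e : ℂˣ) : ℂ) ≠ 1 := fun h2 =>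
      h ((hζ.zpow_eq_one_iff_dvd e).1 (Units.ext h2))
    have h3 : ((ζ ^ e : ℂˣ) : ℂ) ^ t = 1 := by
      rw [← Units.val_pow_eq_pow_val, ← zpow_natCast, ← zpow_mul, mul_comm, zpow_mul,
        zpow_natCast, hζ.pow_eq_one]; simp
    have h4 := mul_geom_sum ((ζ ^ e : ℂˣ) : ℂ) t
    rw [h3, sub_self] at h4
    exact (mul_eq_zero.1 h4).resolve_left (sub_ne_zero.2 h1)

theorem exists_root (hκ : 0 < F.κ) {ξ : ℂ} (hξ : IsPrimitiveRoot ξ F.κ) (a : Fin F.r) :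
    ∃ ζ : ℂˣ, IsPrimitiveRoot ζ (F.t a) := by
  rcases F.t_eq a with h | h
  · refine ⟨(hξ.isUnit hκ.ne').unit, ?_⟩
    rw [h, ← IsPrimitiveRoot.coe_units_iff]
    exact hξ
  · exact ⟨1, by rw [h]; exact IsPrimitiveRoot.one⟩

/-- A polynomial divided by a monomial is a Laurent polynomial in the `x_v ^ t_v` if it is
invariant under multiplication of the `x_v` by `t_v`-th roots of unity: averaging over these
kills all other monomials. -/
theorem mem_laurent_of_invariant (hκ : 0 < F.κ) {ξ : ℂ} (hξ : IsPrimitiveRoot ξ F.κ)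
    {f : (V → ℂˣ) → ℂ} {P : MvPolynomial V ℂ} {N : V → ℕ}
    (hP : ∀ x : V → ℂˣ, f x * ∏ v, (x v : ℂ) ^ N v = MvPolynomial.eval (fun v => (x v : ℂ)) P)
    (hf : ∀ u : V → ℂˣ, (∀ v, u v ^ F.t (ℓ v) = 1) → ∀ x, f (u * x) = f x) :
    f ∈ F.laurent ℓ := by
  classical
  choose ζ hζ using fun v => F.exists_root hκ hξ (ℓ v)
  set I := Fintype.piFinset fun v => Finset.range (F.t (ℓ v)) with hI
  have hcard : (I.card : ℂ) ≠ 0 := by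
    rw [hI, Fintype.card_piFinset]
    simp only [Finset.card_range, Nat.cast_prod]
    exact Finset.prod_ne_zero_iff.2 fun v _ => Nat.cast_ne_zero.2 (F.t_pos hκ _).ne'
  have hfx : ∀ x, f x = ∑ s ∈ P.support, P.coeff s * ∏ v, (x v : ℂ) ^ ((s v : ℤ) - N v) := by
    intro x
    have h1 := hP x
    rw [MvPolynomial.eval_eq', ← eq_div_iff
      (Finset.prod_ne_zero_iff.2 fun v _ => pow_ne_zero _ (x v).ne_zero)] at h1
    rw [h1, Finset.sum_div]
    refine Finset.sum_congr rfl fun s _ => ?_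
    rw [mul_div_assoc, ← Finset.prod_div_distrib]
    congr 1
    refine Finset.prod_congr rfl fun v _ => ?_
    rw [zpow_sub₀ (x v).ne_zero, zpow_natCast, zpow_natCast]
  have havg : f = (I.card : ℂ)⁻¹ • ∑ l ∈ I, fun x => f ((fun v => ζ v ^ l v) * x) := by
    ext x
    rw [Pi.smul_apply, Finset.sum_apply, smul_eq_mul, eq_inv_mul_iff_mul_eq₀ hcard]
    have hl : ∀ l : V → ℕ, f ((fun v => ζ v ^ l v) * x) = f x := fun l =>
      hf (fun v => ζ v ^ l v)
        (fun v => by rw [← pow_mul, mul_comm, pow_mul, (hζ v).pow_eq_one, one_pow]) x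
    simp [hl]
  rw [havg]
  refine Submodule.smul_mem _ _ ?_
  have : (∑ l ∈ I, fun x => f ((fun v => ζ v ^ l v) * x)) =
      ∑ s ∈ P.support, P.coeff s • fun x : V → ℂˣ =>
        ∏ v, ((if (F.t (ℓ v) : ℤ) ∣ (s v : ℤ) - N v then (F.t (ℓ v) : ℂ) else 0) *
          (x v : ℂ) ^ ((s v : ℤ) - N v)) := by
    ext x
    simp only [Finset.sum_apply, hfx, Pi.smul_apply, smul_eq_mul]
    rw [Finset.sum_comm]
    refine Finset.sum_congr rfl fun s _ => ?_
    rw [← Finset.mul_sum]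
    congr 1
    simp only [← sum_root_zpow (hζ _), Finset.sum_mul]
    rw [Finset.prod_univ_sum]
    refine Finset.sum_congr rfl fun l _ => Finset.prod_congr rfl fun v _ => ?_
    rw [Pi.mul_apply, Units.val_mul, mul_zpow]
  rw [this]
  refine Submodule.sum_mem _ fun s _ => Submodule.smul_mem _ _ ?_
  by_cases hs : ∀ v, (F.t (ℓ v) : ℤ) ∣ (s v : ℤ) - N v
  · choose n hn using hs
    have h2 := Submodule.smul_mem _ (∏ v, (F.t (ℓ v) : ℂ)) (F.monomial_mem_laurent ℓ n)
    convert h2 using 1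
    ext x
    rw [Finset.prod_mul_distrib, Pi.smul_apply, smul_eq_mul]
    congr 1
    · exact Finset.prod_congr rfl fun v _ => if_pos ⟨n v, hn v⟩
    · exact Finset.prod_congr rfl fun v _ => by rw [hn v]
  · push Not at hs
    obtain ⟨v, hv⟩ := hs
    convert Submodule.zero_mem _ using 1
    ext x
    exact Finset.prod_eq_zero (Finset.mem_univ v) (by simp [hv])

/-- Laurent polynomials in the `x_v ^ t_v` are invariant under multiplication of the `x_v` by
`t_v`-th roots of unity. -/
theorem laurent_invariant {f : (V → ℂˣ) → ℂ} (hf : f ∈ F.laurent ℓ) (u : V → ℂˣ)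
    (hu : ∀ v, u v ^ F.t (ℓ v) = 1) (x : V → ℂˣ) : f (u * x) = f x := by
  induction hf using Submodule.span_induction with
  | mem f hf =>
    obtain ⟨n, rfl⟩ := hf
    refine Finset.prod_congr rfl fun v _ => ?_
    have : ((u v : ℂ)) ^ ((F.t (ℓ v) : ℤ) * n v) = 1 := by
      rw [zpow_mul, zpow_natCast, ← Units.val_pow_eq_pow_val, hu]; simp
    rw [Pi.mul_apply, Units.val_mul, mul_zpow, this, one_mul]
  | zero => rfl
  | add f g _ _ hf hg => rw [Pi.add_apply, Pi.add_apply, hf, hg]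
  | smul c f _ hf => rw [Pi.smul_apply, Pi.smul_apply, hf]

end Laurent
end Folding

/-! ### Divisibility by products of linear forms -/

section Divisibility

open MvPolynomial

variable {V W : Type}

/-- The linear form `x_v - c x_w`. -/
noncomputable def lin (c : ℂ) (v w : V) : MvPolynomial V ℂ := X v - C c * X w

open Classical in
/-- The substitution `x_v = c x_w`. -/
noncomputable def subst (c : ℂ) (v w : V) : MvPolynomial V ℂ →ₐ[ℂ] MvPolynomial V ℂ :=
  aeval (Function.update X v (C c * X w))

open Classical in
theorem eval_subst (c : ℂ) (v w : V) (x : V → ℂ) (Q : MvPolynomial V ℂ) :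
    eval x (subst c v w Q) = eval (Function.update x v (c * x w)) Q := by
  have : (eval x).comp (subst c v w : MvPolynomial V ℂ →+* MvPolynomial V ℂ) =
      eval (Function.update x v (c * x w)) := by
    apply MvPolynomial.ringHom_ext
    · intro r; simp [subst]
    · intro u
      by_cases hu : u = v
      · subst hu; simp [subst]
      · simp [subst, hu]
  exact congrArg (fun f : MvPolynomial V ℂ →+* ℂ => f Q) this

theorem eval_subst_of_eq {c : ℂ} {v w : V} {x : V → ℂ} (hx : x v = c * x w)
    (Q : MvPolynomial V ℂ) : eval x (subst c v w Q) = eval x Q := by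
  classical
  rw [eval_subst, ← hx, Function.update_eq_self]

theorem lin_dvd_sub_subst (c : ℂ) (v w : V) (Q : MvPolynomial V ℂ) :
    lin c v w ∣ Q - subst c v w Q := by
  classical
  rw [← Ideal.mem_span_singleton, ← Ideal.Quotient.mk_eq_mk_iff_sub_mem]
  set I := Ideal.span {lin c v w}
  have : (Ideal.Quotient.mkₐ ℂ I) = (Ideal.Quotient.mkₐ ℂ I).comp (subst c v w) := by
    apply MvPolynomial.algHom_ext
    intro u
    by_cases hu : u = v
    · subst hu
      simp only [AlgHom.comp_apply, subst, aeval_X, Function.update_self]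
      exact (Ideal.Quotient.mk_eq_mk_iff_sub_mem _ _).2 (Ideal.mem_span_singleton_self _)
    · simp [subst, hu]
  exact congrArg (fun f : MvPolynomial V ℂ →ₐ[ℂ] _ => f Q) this

theorem subst_lin (c : ℂ) {v w : V} (hvw : v ≠ w) : subst c v w (lin c v w) = 0 := by
  simp [subst, lin, hvw.symm]

theorem lin_dvd_iff (c : ℂ) {v w : V} (hvw : v ≠ w) (Q : MvPolynomial V ℂ) :
    lin c v w ∣ Q ↔ subst c v w Q = 0 := by
  constructor
  · rintro ⟨R, rfl⟩
    rw [map_mul, subst_lin c hvw, zero_mul]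
  · intro h
    simpa [h] using lin_dvd_sub_subst c v w Q

theorem lin_ne_zero (c : ℂ) {v w : V} (hvw : v ≠ w) : lin c v w ≠ 0 := by
  classical
  intro h
  have := congrArg (eval (Pi.single v (1 : ℂ))) h
  simp [lin, hvw.symm] at this

theorem prime_lin (c : ℂ) {v w : V} (hvw : v ≠ w) : Prime (lin c v w) := by
  refine ⟨lin_ne_zero c hvw, fun h => ?_, fun a b h => ?_⟩
  · have := (lin_dvd_iff c hvw 1).1 h.dvd
    simp at this
  · rw [lin_dvd_iff c hvw] at h ⊢
    rw [lin_dvd_iff c hvw]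
    rw [map_mul] at h
    exact mul_eq_zero.1 h

theorem isRelPrime_lin {c c' : ℂ} {v w v' w' : V} (hvw : v ≠ w) (x : V → ℂ)
    (hx : x v = c * x w) (hx' : x v' ≠ c' * x w') : IsRelPrime (lin c v w) (lin c' v' w') := by
  rw [(prime_lin c hvw).irreducible.isRelPrime_iff_not_dvd, lin_dvd_iff c hvw]
  intro h
  have := congrArg (eval x) h
  rw [eval_subst_of_eq hx] at this
  simp only [lin, map_sub, map_mul, eval_X, eval_C, map_zero] at this
  exact hx' (sub_eq_zero.1 this)

/-- Linear forms in different pairs of variables are coprime. -/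
theorem isRelPrime_lin_of_ne {c c' : ℂ} (hc' : c' ≠ 0) {v w v' w' : V} (hvw : v ≠ w)
    (hvw' : v' ≠ w') (h : (v' ≠ v ∧ v' ≠ w) ∨ (w' ≠ v ∧ w' ≠ w)) :
    IsRelPrime (lin c v w) (lin c' v' w') := by
  classical
  set y : V → ℂ := Function.update (fun _ => 1) v c with hy
  rcases h with ⟨h1, h2⟩ | ⟨h1, h2⟩
  · refine isRelPrime_lin hvw (Function.update y v' (c' * y w' + 1)) ?_ ?_
    · simp [h1.symm, h2.symm, hy, hvw.symm]
    · simp [hvw'.symm]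
  · refine isRelPrime_lin hvw (Function.update y w' (c'⁻¹ * (y v' + 1))) ?_ ?_
    · simp [h1.symm, h2.symm, hy, hvw.symm]
    · simp [hvw', mul_inv_cancel_left₀ hc']

theorem isRelPrime_lin_of_const_ne {c c' : ℂ} (hc : c ≠ c') {v w : V} (hvw : v ≠ w) :
    IsRelPrime (lin c v w) (lin c' v w) := by
  classical
  exact isRelPrime_lin hvw (Function.update (fun _ => 1) v c) (by simp [hvw.symm])
    (by simpa [hvw.symm] using hc)

/-- `x_v ^ n - x_w ^ n` splits into linear forms. -/
theorem pow_sub_pow_eq_prod_lin {n : ℕ} (hn : 0 < n) {ζ : ℂ} (hζ : IsPrimitiveRoot ζ n) (v w : V) :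
    (X v ^ n - X w ^ n : MvPolynomial V ℂ) = ∏ l ∈ Finset.range n, lin (ζ ^ l) v w := by
  classical
  have h := IsPrimitiveRoot.pow_sub_pow_eq_prod_sub_mul (X v : MvPolynomial V ℂ) (X w) hn
    (hζ.map_of_injective (C_injective V ℂ))
  rw [h]
  have hC := hζ.map_of_injective (C_injective V ℂ)
  refine (Finset.prod_nbij (fun l => C ζ ^ l) ?_ ?_ ?_ ?_).symm
  · intro l _
    rw [Polynomial.mem_nthRootsFinset hn, ← pow_mul, mul_comm, pow_mul, hC.pow_eq_one, one_pow]
  · intro a ha b hb hab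
    exact hC.pow_inj (Finset.mem_range.1 ha) (Finset.mem_range.1 hb) hab
  · intro z hz
    have hz' := (Polynomial.mem_nthRootsFinset hn _).1 hz
    have : NeZero n := ⟨hn.ne'⟩
    obtain ⟨i, hi, rfl⟩ := hC.eq_pow_of_pow_eq_one hz'
    exact ⟨i, by simpa using hi, rfl⟩
  · intro l _
    simp [lin]

theorem isRelPrime_pow_sub_pow {n n' : ℕ} (hn : 0 < n) (hn' : 0 < n') {v w v' w' : V}
    (hvw : v ≠ w) (hvw' : v' ≠ w') (h : (v' ≠ v ∧ v' ≠ w) ∨ (w' ≠ v ∧ w' ≠ w)) :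
    IsRelPrime (X v ^ n - X w ^ n : MvPolynomial V ℂ) (X v' ^ n' - X w' ^ n') := by
  have hζ := Complex.isPrimitiveRoot_exp n hn.ne'
  have hζ' := Complex.isPrimitiveRoot_exp n' hn'.ne'
  rw [pow_sub_pow_eq_prod_lin hn hζ, pow_sub_pow_eq_prod_lin hn' hζ']
  exact IsRelPrime.prod_left fun l _ => IsRelPrime.prod_right fun l' _ =>
    isRelPrime_lin_of_ne (pow_ne_zero _ (hζ'.ne_zero hn'.ne')) hvw hvw' h

theorem pow_sub_pow_pow_dvd {n e : ℕ} (hn : 0 < n) {ζ : ℂ} (hζ : IsPrimitiveRoot ζ n) {v w : V}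
    (hvw : v ≠ w) {Q : MvPolynomial V ℂ} (h : ∀ l < n, lin (ζ ^ l) v w ^ e ∣ Q) :
    (X v ^ n - X w ^ n) ^ e ∣ Q := by
  rw [pow_sub_pow_eq_prod_lin hn hζ, ← Finset.prod_pow]
  refine Finset.prod_dvd_of_isRelPrime (fun i hi j hj hij => ?_) fun l hl =>
    h l (Finset.mem_range.1 hl)
  refine (isRelPrime_lin_of_const_ne (fun h => hij ?_) hvw).pow
  exact hζ.pow_inj (Finset.mem_range.1 hi) (Finset.mem_range.1 hj) h

theorem rename_lin (c : ℂ) (v w : V) (ρ : V → W) : rename ρ (lin c v w) = lin c (ρ v) (ρ w) := by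
  simp [lin]

/-- The chain rule for an identification of variables. -/
theorem pderiv_rename_eq_sum [Fintype V] [DecidableEq W] (r : V → W) (w : W)
    (P : MvPolynomial V ℂ) :
    pderiv w (rename r P) = ∑ v with r v = w, rename r (pderiv v P) := by
  classical
  induction P using MvPolynomial.induction_on with
  | C a => simp
  | add p q hp hq => simp [hp, hq, Finset.sum_add_distrib]
  | mul_X p u hp =>
    simp only [map_mul, rename_X, Derivation.leibniz, smul_eq_mul, pderiv_X, map_add, hp,
      Finset.sum_add_distrib, Finset.mul_sum]
    congr 1
    by_cases hu : r u = w
    · rw [Finset.sum_eq_single u]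
      · simp [hu]
      · intro v _ hv; simp [Pi.single_eq_of_ne' hv]
      · intro h; simp [hu] at h
    · rw [Pi.single_eq_of_ne' (Ne.symm hu), mul_zero]
      refine (Finset.sum_eq_zero fun v hv => ?_).symm
      have : v ≠ u := by rintro rfl; exact hu (Finset.mem_filter.1 hv).2
      simp [Pi.single_eq_of_ne' this]

/-- If a polynomial is symmetric in a set of variables and vanishes where these all coincide, it
vanishes there to second order: the partial derivatives are equal to each other there, and their
sum is the derivative of zero. -/
theorem lin_sq_dvd_rename [Fintype V] {P : MvPolynomial V ℂ} {r : V → W} {l : V} {w : W}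
    (hl : ∀ v, r v = r l → v = l) (hw : r l ≠ w) (r₂ : V → W) (hr₂l : r₂ l = w)
    (hr₂ : ∀ v, v ≠ l → r₂ v = r v) (h0 : rename r₂ P = 0)
    (hsymm : ∀ v, r v = w → ∀ [DecidableEq V], rename (Equiv.swap v l) P = P) :
    lin 1 (r l) w ^ 2 ∣ rename r P := by
  classical
  have hcomp : ∀ Q, subst 1 (r l) w (rename r Q) = rename r₂ Q := by
    intro Q
    have : (subst 1 (r l) w).comp (rename r) = rename r₂ := by
      apply MvPolynomial.algHom_ext
      intro v
      by_cases hv : v = l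
      · subst hv; simp [subst, hr₂l]
      · have : r v ≠ r l := fun h => hv (hl v h)
        simp [subst, hr₂ v hv, this]
    exact congrArg (fun f : MvPolynomial V ℂ →ₐ[ℂ] _ => f Q) this
  have hder : rename r₂ (pderiv l P) = 0 := by
    have h1 := pderiv_rename_eq_sum r₂ w P
    rw [h0, map_zero] at h1
    have h2 : ∀ v ∈ Finset.univ.filter (fun v => r₂ v = w),
        rename r₂ (pderiv v P) = rename r₂ (pderiv l P) := by
      intro v hv
      have hv := (Finset.mem_filter.1 hv).2
      by_cases hvl : v = l
      · rw [hvl]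
      have hs := hsymm v (by rw [← hr₂ v hvl, hv])
      have h3 := pderiv_rename (Equiv.swap v l).injective l P
      rw [hs, Equiv.swap_apply_right] at h3
      rw [h3, rename_rename]
      congr 2
      funext u
      rw [Function.comp_apply]
      rcases eq_or_ne u v with rfl | huv
      · rw [Equiv.swap_apply_left, hr₂l, hv]
      rcases eq_or_ne u l with rfl | hul
      · rw [Equiv.swap_apply_right, hr₂l, hv]
      · rw [Equiv.swap_apply_of_ne_of_ne huv hul]
    rw [Finset.sum_congr rfl h2, Finset.sum_const, eq_comm, smul_eq_zero] at h1
    refine h1.resolve_left fun h => ?_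
    rw [Finset.card_eq_zero] at h
    exact absurd (Finset.mem_filter.2 ⟨Finset.mem_univ l, hr₂l⟩) (by rw [h]; simp)
  obtain ⟨Q, hQ⟩ := (lin_dvd_iff 1 hw (rename r P)).2 (by rw [hcomp, h0])
  have h1 := pderiv_rename_eq_sum r (r l) P
  have h2 : (Finset.univ.filter fun v => r v = r l) = {l} := by
    ext v
    simp only [Finset.mem_filter, Finset.mem_univ, true_and, Finset.mem_singleton]
    exact ⟨hl v, fun h => by rw [h]⟩
  rw [h2, Finset.sum_singleton, hQ, Derivation.leibniz] at h1
  have h3 := congrArg (subst 1 (r l) w) h1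
  rw [hcomp, hder] at h3
  have h4 : pderiv (r l) (lin 1 (r l) w) = 1 := by
    simp [lin, pderiv_X_of_ne hw.symm]
  rw [smul_eq_mul, smul_eq_mul, h4, mul_one, map_add, map_mul, subst_lin 1 hw, zero_mul, zero_add]
    at h3
  obtain ⟨Q', hQ'⟩ := (lin_dvd_iff 1 hw Q).2 h3
  exact ⟨Q', by rw [hQ, hQ', pow_two, mul_assoc]⟩

/-- If a polynomial vanishes wherever two of the variables `x_k`, `k ∈ S`, are equal to `c x_m`,
then it vanishes to order `|S| - 1` on `x_w = c x_m` once the variables in `S` are identified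
with `x_w`. -/
theorem lin_pow_dvd_rename {c : ℂ} (hc : c ≠ 0) {m : V} (ρ : V → W) (w : W) (S : Finset V)
    (hm : m ∉ S) (hρ : ∀ v ∈ S, ρ v = w) : ∀ P : MvPolynomial V ℂ,
    (∀ k ∈ S, ∀ l ∈ S, k ≠ l → ∀ x : V → ℂ, x k = c * x m → x l = c * x m → eval x P = 0) →
      lin c w (ρ m) ^ (S.card - 1) ∣ rename ρ P := by
  classical
  induction S using Finset.induction_on with
  | empty => simp
  | insert k S hk ih =>
    intro P hP
    have hmS : m ∉ S := fun h => hm (Finset.mem_insert_of_mem h)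
    have hmk : m ≠ k := fun h => hm (h ▸ Finset.mem_insert_self _ _)
    have hne : ∀ l ∈ S, l ≠ m := fun l hl h => hmS (h ▸ hl)
    have hnk : ∀ l ∈ S, l ≠ k := fun l hl h => hk (h ▸ hl)
    have hρS : ∀ v ∈ S, ρ v = w := fun v hv => hρ v (Finset.mem_insert_of_mem hv)
    set P₀ := subst c k m P with hP₀
    have hP₀l : ∀ l ∈ S, ∀ x : V → ℂ, x l = c * x m → eval x P₀ = 0 := by
      intro l hl x hx
      rw [hP₀, eval_subst]
      refine hP k (Finset.mem_insert_self _ _) l (Finset.mem_insert_of_mem hl) (hnk l hl).symm _ ?_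
        ?_
      · simp [hmk]
      · simp [hmk, hnk l hl, hx]
    obtain ⟨Q, hQ⟩ := lin_dvd_sub_subst c k m P
    have hP₀dvd : lin c w (ρ m) ^ S.card ∣ rename ρ P₀ := by
      have h1 : ∏ l ∈ S, lin c l m ∣ P₀ := by
        refine Finset.prod_dvd_of_isRelPrime (fun i hi j hj hij => ?_) fun l hl => ?_
        · exact isRelPrime_lin_of_ne hc (hne i hi) (hne j hj) (Or.inl ⟨hij.symm, hne j hj⟩)
        · rw [lin_dvd_iff c (hne l hl)]
          refine MvPolynomial.funext fun x => ?_
          rw [eval_subst, map_zero]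
          exact hP₀l l hl _ (by simp [(hne l hl).symm])
      have h2 := map_dvd (rename ρ) h1
      rwa [map_prod, Finset.prod_congr rfl fun l hl => by rw [rename_lin, hρS l hl],
        Finset.prod_const] at h2
    have hQdvd := ih hmS hρS Q (by
      intro l hl l' hl' hll' x hx hx'
      have h1 : lin c k m * Q = P - P₀ := hQ.symm
      have h2 : subst c l m (subst c l' m (P - P₀)) = 0 := by
        refine MvPolynomial.funext fun y => ?_
        have hy : ∀ R, eval y (subst c l m (subst c l' m R)) =
            eval (Function.update (Function.update y l (c * y m)) l' (c * y m)) R := by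
          intro R
          rw [eval_subst, eval_subst]
          simp [(hne l hl).symm]
        rw [hy, map_sub, map_zero, hP₀l l' hl' _ (by simp [(hne l hl).symm, (hne l' hl').symm]),
          hP l (Finset.mem_insert_of_mem hl) l' (Finset.mem_insert_of_mem hl') hll' _
            (by simp [(hne l hl).symm, (hne l' hl').symm, hll'])
            (by simp [(hne l hl).symm, (hne l' hl').symm]), sub_zero]
      rw [← h1, map_mul, map_mul, mul_eq_zero] at h2
      have h3 : subst c l m (subst c l' m (lin c k m)) = lin c k m := by
        simp [subst, lin, (hne l hl).symm, (hne l' hl').symm, (hnk l hl).symm, (hnk l' hl').symm]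
      rw [h3] at h2
      have h4 := congrArg (eval x) (h2.resolve_left (lin_ne_zero c hmk.symm))
      rw [eval_subst_of_eq hx, eval_subst_of_eq hx', map_zero] at h4
      exact h4)
    rw [Finset.card_insert_of_notMem hk, Nat.add_sub_cancel]
    have hsplit : rename ρ P = rename ρ P₀ + lin c w (ρ m) * rename ρ Q := by
      have : P = P₀ + lin c k m * Q := by rw [← hQ]; ring
      conv_lhs => rw [this]
      rw [map_add, map_mul, rename_lin, hρ k (Finset.mem_insert_self _ _)]
    rw [hsplit]
    refine dvd_add hP₀dvd ?_
    refine (pow_dvd_pow _ (by omega : S.card ≤ 1 + (S.card - 1))).trans ?_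
    rw [pow_add, pow_one]
    exact mul_dvd_mul_left _ hQdvd

end Divisibility

/-! ### Fillings of Young diagrams -/

section Combinatorics

open scoped Classical

/-- The number of boxes of a Young diagram with rows `M` outside of the first `i` columns. -/
def excess (M : Multiset ℕ) (i : ℕ) : ℕ := (M.map fun a => a - i).sum

theorem excess_eq_sum (M : Multiset ℕ) (i : ℕ) : excess M i = ∑ p : M.ToType, (p.1 - i) := by
  rw [excess, Finset.sum]
  congr 1
  conv_lhs => rw [← Multiset.map_univ_coe M]
  rw [Multiset.map_map]
  rfl

/-- The boxes of the Young diagram with rows `M`. -/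
abbrev Boxes (M : Multiset ℕ) : Type := Σ p : M.ToType, Fin p.1

theorem card_boxes_col (M : Multiset ℕ) (i : ℕ) :
    (Finset.univ.filter fun b : Boxes M => i ≤ b.2.1).card = ∑ p : M.ToType, (p.1 - i) := by
  rw [Finset.card_filter, Fintype.sum_sigma]
  refine Finset.sum_congr rfl fun p _ => ?_
  change ∑ c : Fin p.1, (if i ≤ c.1 then 1 else 0) = _
  rw [← Finset.card_filter]
  have h := Fin.card_filter_val_lt (n := p.1) (m := i)
  have h2 := Finset.card_filter_add_card_filter_not (s := (Finset.univ : Finset (Fin p.1)))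
    (fun c : Fin p.1 => c.1 < i)
  simp only [Finset.card_univ, Fintype.card_fin, not_lt] at h2
  omega

/-- A row `n` contains at most one box from each column, hence at least `n - i` boxes outside of
the first `i` columns. -/
theorem sub_le_card_row {M N : Multiset ℕ} {ψ : Boxes M → N.ToType}
    (hcard : ∀ n : N.ToType, (Finset.univ.filter fun b => ψ b = n).card = n.1)
    (hcol : ∀ b b' : Boxes M, b.2.1 = b'.2.1 → ψ b = ψ b' → b = b')
    (i : ℕ) (n : N.ToType) :
    n.1 - i ≤ (Finset.univ.filter fun b => ψ b = n ∧ i ≤ b.2.1).card := by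
  have h2 := Finset.card_filter_add_card_filter_not (s := Finset.univ.filter fun b => ψ b = n)
    (fun b : Boxes M => i ≤ b.2.1)
  rw [hcard, Finset.filter_filter, Finset.filter_filter] at h2
  have h3 : (Finset.univ.filter fun b => ψ b = n ∧ ¬ i ≤ b.2.1).card ≤ i := by
    rw [← Finset.card_range i]
    refine Finset.card_le_card_of_injOn (fun b => b.2.1) (fun b hb => ?_) fun b hb b' hb' h => ?_
    · simp at hb; simp [hb.2]
    · simp at hb hb'
      exact hcol b b' h (hb.1.trans hb'.1.symm)
  omega

theorem sum_card_row {M N : Multiset ℕ} (ψ : Boxes M → N.ToType) (i : ℕ) :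
    ∑ n, (Finset.univ.filter fun b => ψ b = n ∧ i ≤ b.2.1).card = ∑ p : M.ToType, (p.1 - i) := by
  rw [← card_boxes_col, Finset.card_eq_sum_card_fiberwise (f := ψ) (t := Finset.univ) (by simp)]
  refine Finset.sum_congr rfl fun n _ => ?_
  rw [Finset.filter_filter]
  simp only [and_comm]

/-- A diagram that can be filled from another one with no two boxes of a column in one row is
dominated by it. -/
theorem excess_le_of_filling {M N : Multiset ℕ} {ψ : Boxes M → N.ToType}
    (hcard : ∀ n : N.ToType, (Finset.univ.filter fun b => ψ b = n).card = n.1)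
    (hcol : ∀ b b' : Boxes M, b.2.1 = b'.2.1 → ψ b = ψ b' → b = b')
    (i : ℕ) : excess N i ≤ excess M i := by
  rw [excess_eq_sum, excess_eq_sum, ← sum_card_row ψ i]
  exact Finset.sum_le_sum fun n _ => sub_le_card_row hcard hcol i n

theorem partGT_trichotomy {M : Multiset ℕ} (p q : M.ToType) :
    Folding.partGT p q ∨ p = q ∨ Folding.partGT q p := by
  obtain ⟨i, s⟩ := p
  obtain ⟨j, s'⟩ := q
  simp only [Folding.partGT]
  rcases lt_trichotomy i j with h | rfl | h
  · exact Or.inr (Or.inr (Or.inl h))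
  · rcases lt_trichotomy s s' with h | rfl | h
    · exact Or.inl (Or.inr ⟨rfl, h⟩)
    · exact Or.inr (Or.inl rfl)
    · exact Or.inr (Or.inr (Or.inr ⟨rfl, h⟩))
  · exact Or.inl (Or.inl h)

theorem partGT_irrefl {M : Multiset ℕ} (p : M.ToType) : ¬ Folding.partGT p p := by
  rintro (h | ⟨_, h⟩) <;> exact lt_irrefl _ h

theorem partGT_trans {M : Multiset ℕ} {p q r : M.ToType} (h : Folding.partGT p q)
    (h' : Folding.partGT q r) : Folding.partGT p r := by
  rcases h with h | ⟨h1, h⟩ <;> rcases h' with h' | ⟨h1', h'⟩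
  · exact Or.inl (h'.trans h)
  · exact Or.inl (by omega)
  · exact Or.inl (by omega)
  · exact Or.inr ⟨by omega, by omega⟩

/-- A filling of a diagram by the boxes of the same diagram, with no two boxes of a column in one
row, and such that a box never shares its row with the cyclically next box of a preceding row,
permutes the rows. -/
theorem filling_rigid {M : Multiset ℕ} (hpos : ∀ p : M.ToType, 0 < p.1) {ψ : Boxes M → M.ToType}
    (hcard : ∀ n : M.ToType, (Finset.univ.filter fun b => ψ b = n).card = n.1)
    (hcol : ∀ b b' : Boxes M, b.2.1 = b'.2.1 → ψ b = ψ b' → b = b')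
    (hnext : ∀ b b' : Boxes M, Folding.partGT b.1 b'.1 → b.2.1 = (b'.2.1 + 1) % b.1.1 →
      ψ b ≠ ψ b') :
    ∃ ρ : Equiv.Perm M.ToType, (∀ p, (ρ p).1 = p.1) ∧ ∀ b, ψ b = ρ b.1 := by
  rcases isEmpty_or_nonempty M.ToType with hM | ⟨⟨p₀⟩⟩
  · exact ⟨Equiv.refl _, fun p => hM.elim p, fun b => hM.elim b.1⟩
  have : Nonempty (Boxes M) := ⟨⟨p₀, ⟨0, hpos p₀⟩⟩⟩
  have hcardeq : ∀ i (n : M.ToType),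
      (Finset.univ.filter fun b => ψ b = n ∧ i ≤ b.2.1).card = n.1 - i := by
    intro i n
    have h := (Finset.sum_eq_sum_iff_of_le fun n _ => sub_le_card_row hcard hcol i n).1
      (sum_card_row ψ i).symm n (Finset.mem_univ n)
    exact h.symm
  have hlt : ∀ b : Boxes M, b.2.1 < (ψ b).1 := by
    intro b
    by_contra! h
    have h1 := hcardeq (ψ b).1 (ψ b)
    rw [Nat.sub_self, Finset.card_eq_zero] at h1
    have : b ∈ Finset.univ.filter fun b' => ψ b' = ψ b ∧ (ψ b).1 ≤ b'.2.1 := by simp [h]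
    rw [h1] at this
    simp at this
  have hex : ∀ (n : M.ToType) (c : ℕ), c < n.1 → ∃ b : Boxes M, ψ b = n ∧ b.2.1 = c := by
    intro n c hc
    by_contra! h
    have h1 : (Finset.univ.filter fun b => ψ b = n ∧ c ≤ b.2.1) =
        Finset.univ.filter fun b => ψ b = n ∧ c + 1 ≤ b.2.1 := by
      refine Finset.filter_congr fun b _ => ?_
      refine and_congr_right fun hb => ?_
      have := h b hb
      omega
    have h2 := hcardeq c n
    rw [h1, hcardeq] at h2
    omega
  choose! B hB hBc using hex
  have hBeq : ∀ b : Boxes M, b = B (ψ b) b.2.1 := fun b =>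
    hcol _ _ (hBc _ _ (hlt b)).symm (hB _ _ (hlt b)).symm
  -- along a row the boxes come from weakly later rows
  have hstep : ∀ (n : M.ToType) (c : ℕ), c + 1 < n.1 →
      ¬ Folding.partGT (B n (c + 1)).1 (B n c).1 := by
    intro n c hc h
    have h1 := hBc n (c + 1) hc
    have h2 := hBc n c (by omega)
    refine hnext _ _ h ?_ ((hB n _ hc).trans (hB n c (by omega)).symm)
    rw [h2, h1, Nat.mod_eq_of_lt]
    have h3 := (B n (c + 1)).2.2
    omega
  have hchain : ∀ (n : M.ToType) (c d : ℕ), c ≤ d → d < n.1 →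
      ¬ Folding.partGT (B n d).1 (B n c).1 := by
    intro n c d hcd hd
    induction d, hcd using Nat.le_induction with
    | base => exact partGT_irrefl _
    | succ d hcd ih =>
      intro h
      rcases partGT_trichotomy (B n c).1 (B n d).1 with h1 | h1 | h1
      · exact hstep n d hd (partGT_trans h h1)
      · exact hstep n d hd (h1 ▸ h)
      · exact ih (by omega) h1
  have hlen : ∀ p q : M.ToType, ¬ Folding.partGT p q → p.1 ≤ q.1 := fun p q h => by
    by_contra! h'
    exact h (Or.inl h')
  have hlast : ∀ n : M.ToType, n.1 ≤ (B n (n.1 - 1)).1.1 := by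
    intro n
    have := hBc n (n.1 - 1) (by have := hpos n; omega)
    have h2 := (B n (n.1 - 1)).2.2
    have := hpos n
    omega
  have hge : ∀ n : M.ToType, n.1 ≤ (B n 0).1.1 := fun n =>
    (hlast n).trans (hlen _ _ (hchain n 0 (n.1 - 1) (by omega) (by have := hpos n; omega)))
  have hinj : Function.Injective fun n : M.ToType => (B n 0).1 := by
    intro n n' h
    have h1 : B n 0 = B n' 0 := by
      refine Sigma.ext h ?_
      have e1 := hBc n 0 (hpos n)
      have e2 := hBc n' 0 (hpos n')
      simp only at h
      refine (Fin.heq_ext_iff (by rw [h])).2 (e1.trans e2.symm)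
    rw [← hB n 0 (hpos n), h1, hB n' 0 (hpos n')]
  set π : Equiv.Perm M.ToType := Equiv.ofBijective _ (Finite.injective_iff_bijective.1 hinj) with hπ
  have hπ' : ∀ n, π n = (B n 0).1 := fun n => rfl
  -- the lengths agree since they do in total
  have hleneq : ∀ n, n.1 = (π n).1 := by
    intro n
    refine (Finset.sum_eq_sum_iff_of_le fun n _ => hge n).1 ?_ n (Finset.mem_univ n)
    exact (Equiv.sum_comp π fun n : M.ToType => n.1).symm
  have hlast' : ∀ n, (B n (n.1 - 1)).1 = π n := by
    intro n
    have hn := hpos n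
    rcases partGT_trichotomy (B n (n.1 - 1)).1 (B n 0).1 with h | h | h
    · exact absurd h (hchain n 0 _ (by omega) (by omega))
    · exact h
    · refine absurd ((hB n 0 hn).trans (hB n (n.1 - 1) (by omega)).symm) (hnext _ _ h ?_)
      rw [hBc n 0 hn, hBc n (n.1 - 1) (by omega), ← hπ', ← hleneq, Nat.sub_add_cancel hn,
        Nat.mod_self]
  have hall : ∀ n c, c < n.1 → (B n c).1 = π n := by
    intro n c hc
    rcases partGT_trichotomy (B n c).1 (π n) with h | h | h
    · exact absurd h (hchain n 0 c (by omega) hc)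
    · exact h
    · rw [← hlast'] at h
      exact absurd h (hchain n c _ (by omega) (by omega))
  refine ⟨π.symm, fun p => ?_, fun b => ?_⟩
  · rw [hleneq, π.apply_symm_apply]
  · rw [Equiv.eq_symm_apply]
    conv_rhs => rw [hBeq b]
    exact (hall _ _ (hlt b)).symm

/-! ### The lexicographic order and the excess -/

/-- If `l₁ < l₂` lexicographically at a position where `l₂` has the entry `e`, then the diagram
`l₂` has more boxes outside of the first `e - 1` columns than `l₁`, and equally many outside of
any greater number of columns. -/
theorem exists_excess_lt {l₁ l₂ : List ℕ} (h : List.Lex (· < ·) l₁ l₂)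
    (hs : l₁.Pairwise (· ≥ ·)) (hs₂ : l₂.Pairwise (· ≥ ·)) (hpos : ∀ a ∈ l₂, 0 < a) :
    ∃ i, excess l₁ i < excess l₂ i ∧ ∀ j, i < j → excess l₁ j = excess l₂ j := by
  have hzero : ∀ (l : List ℕ) (j : ℕ), (∀ a ∈ l, a ≤ j) → excess l j = 0 := by
    intro l j hl
    simp only [excess, Multiset.map_coe, Multiset.sum_coe, List.sum_eq_zero_iff]
    intro x hx
    obtain ⟨a, ha, rfl⟩ := List.mem_map.1 hx
    exact Nat.sub_eq_zero_of_le (hl a ha)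
  have hcons : ∀ (a : ℕ) (l : List ℕ) (j : ℕ), excess (a :: l : List ℕ) j = (a - j) + excess l j := by
    intro a l j; simp [excess]
  induction h with
  | nil =>
    rename_i b l
    have hb := hpos b (by simp)
    rw [List.pairwise_cons] at hs₂
    refine ⟨b - 1, ?_, fun j hj => ?_⟩
    · rw [hcons, hzero [] _ (by simp)]; omega
    · rw [hzero [] _ (by simp), hzero]
      intro a ha
      rcases List.mem_cons.1 ha with rfl | ha
      · omega
      · have := hs₂.1 a ha; omega
  | cons h ih =>
    rw [List.pairwise_cons] at hs hs₂
    obtain ⟨i, hi, hj⟩ := ih hs.2 hs₂.2 fun a ha => hpos a (List.mem_cons_of_mem _ ha)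
    exact ⟨i, by rw [hcons, hcons]; omega, fun j h => by rw [hcons, hcons, hj j h]⟩
  | rel h =>
    rename_i a l b l'
    have hb := hpos b (by simp)
    rw [List.pairwise_cons] at hs hs₂
    refine ⟨b - 1, ?_, fun j hj => ?_⟩
    · rw [hcons b, hzero (a :: l)]
      · omega
      · intro x hx
        rcases List.mem_cons.1 hx with rfl | hx
        · omega
        · have := hs.1 x hx; omega
    · rw [hzero (a :: l), hzero (b :: l')]
      · intro x hx
        rcases List.mem_cons.1 hx with rfl | hx
        · omega
        · have := hs₂.1 x hx; omega
      · intro x hx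
        rcases List.mem_cons.1 hx with rfl | hx
        · omega
        · have := hs.1 x hx; omega

theorem exists_excess_lt_of_partitionLT {n : ℕ} {p q : Nat.Partition n}
    (h : Folding.partitionLT p q) :
    ∃ i, excess p.parts i < excess q.parts i ∧
      ∀ j, i < j → excess p.parts j = excess q.parts j := by
  have h1 := exists_excess_lt h (Multiset.pairwise_sort _ _) (Multiset.pairwise_sort _ _)
    (fun a ha => q.parts_pos ((Multiset.mem_sort _).1 ha))
  simpa only [Multiset.sort_eq] using h1

theorem partitionLT_trichotomy {n : ℕ} (p q : Nat.Partition n) :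
    Folding.partitionLT p q ∨ p = q ∨ Folding.partitionLT q p := by
  rw [← Folding.sort_parts_injective.eq_iff]
  exact lt_trichotomy (p.parts.sort (· ≥ ·)) (q.parts.sort (· ≥ ·))

/-- A criterion for the lexicographic order in terms of the excess. -/
theorem partitionLT_of_excess {n : ℕ} {p q : Nat.Partition n} (i : ℕ)
    (hi : excess p.parts i < excess q.parts i)
    (hj : ∀ j, i < j → excess p.parts j = excess q.parts j) : Folding.partitionLT p q := by
  rcases partitionLT_trichotomy p q with h | rfl | h
  · exact h
  · exact absurd hi (lt_irrefl _)
  · obtain ⟨i', hi', hj'⟩ := exists_excess_lt_of_partitionLT h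
    rcases lt_trichotomy i i' with h1 | rfl | h1
    · have := hj i' h1; omega
    · omega
    · have := hj' i h1; omega

/-! ### The partition given by the blocks of a function -/

section Block

variable {n : ℕ} {B : Type}

/-- The sizes of the nonempty fibres of a function. -/
noncomputable def blockPartition (b : Fin n → B) : Nat.Partition n where
  parts := (Finset.univ.image b).val.map fun β => (Finset.univ.filter fun k => b k = β).card
  parts_pos := by
    intro i hi
    obtain ⟨β, hβ, rfl⟩ := Multiset.mem_map.1 hi
    obtain ⟨k, _, hk⟩ := Finset.mem_image.1 (Finset.mem_def.2 hβ)
    exact Finset.card_pos.2 ⟨k, by simp [hk]⟩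
  parts_sum := by
    have := Finset.card_eq_sum_card_image b (Finset.univ : Finset (Fin n))
    rw [Finset.card_univ, Fintype.card_fin] at this
    exact this.symm

theorem excess_blockPartition [Fintype B] (b : Fin n → B) (i : ℕ) :
    excess (blockPartition b).parts i =
      ∑ β, ((Finset.univ.filter fun k => b k = β).card - i) := by
  rw [excess, blockPartition, Multiset.map_map]
  change ∑ β ∈ Finset.univ.image b, ((Finset.univ.filter fun k => b k = β).card - i) = _
  refine Finset.sum_subset (Finset.subset_univ _) fun β _ hβ => ?_
  rw [Finset.filter_eq_empty_iff.2, Finset.card_empty, Nat.zero_sub]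
  intro k _ hk
  exact hβ (Finset.mem_image.2 ⟨k, Finset.mem_univ _, hk⟩)

theorem card_filter_row {μ : Nat.Partition n} (T : Fin n ≃ Boxes μ.parts) (p : μ.parts.ToType) :
    (Finset.univ.filter fun k => (T k).1 = p).card = p.1 := by
  have h1 : (Finset.univ.filter fun k => (T k).1 = p).card =
      (Finset.univ.filter fun b : Boxes μ.parts => b.1 = p).card := by
    refine Finset.card_equiv T fun k => by simp
  rw [h1, Finset.card_filter, Fintype.sum_sigma, Finset.sum_eq_single p]
  · simp
  · intro q _ hq; simp [hq]
  · simp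

theorem part_pos {μ : Nat.Partition n} (p : μ.parts.ToType) : 0 < p.1 :=
  μ.parts_pos (Multiset.coe_mem (x := p))

theorem blockPartition_row {μ : Nat.Partition n} (T : Fin n ≃ Boxes μ.parts)
    {ι : μ.parts.ToType → B} (hι : Function.Injective ι) :
    blockPartition (fun k => ι (T k).1) = μ := by
  apply Nat.Partition.ext
  rw [blockPartition]
  have h1 : (Finset.univ.image fun k => ι (T k).1) = Finset.univ.image ι := by
    ext β
    simp only [Finset.mem_image, Finset.mem_univ, true_and]
    constructor
    · rintro ⟨k, rfl⟩; exact ⟨_, rfl⟩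
    · rintro ⟨p, rfl⟩
      exact ⟨T.symm ⟨p, ⟨0, part_pos p⟩⟩, by simp⟩
  simp only [h1]
  rw [Finset.image_val_of_injOn hι.injOn, Multiset.map_map]
  conv_rhs => rw [← Multiset.map_univ_coe μ.parts]
  refine Multiset.map_congr rfl fun p _ => ?_
  simp only [Function.comp_apply, hι.eq_iff]
  exact card_filter_row T p

theorem exists_perm_of_card_fiber_eq {A : Type} [Fintype A] (g h : A → B)
    (hc : ∀ β, (Finset.univ.filter fun k => g k = β).card =
      (Finset.univ.filter fun k => h k = β).card) :
    ∃ σ : Equiv.Perm A, ∀ k, g (σ k) = h k := by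
  have e : ∀ β, {k // h k = β} ≃ {k // g k = β} := fun β =>
    Fintype.equivOfCardEq (by rw [Fintype.card_subtype, Fintype.card_subtype, hc])
  refine ⟨(Equiv.sigmaFiberEquiv h).symm.trans
    ((Equiv.sigmaCongrRight e).trans (Equiv.sigmaFiberEquiv g)), fun k => ?_⟩
  exact ((e (h k)) ⟨k, rfl⟩).2

/-- Up to a permutation of the letters, a function is constant on the rows of any tableau whose
shape is given by the fibres of the function. -/
theorem exists_perm_row (b : Fin n → B) (T : Fin n ≃ Boxes (blockPartition b).parts) :
    ∃ (σ : Equiv.Perm (Fin n)) (β : (blockPartition b).parts.ToType → B),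
      ∀ k, b (σ k) = β (T k).1 := by
  set s := (Finset.univ.image b).val with hs
  set f : B → ℕ := fun β => (Finset.univ.filter fun k => b k = β).card with hf
  set e : s.ToType ≃ (blockPartition b).parts.ToType := Multiset.mapEquiv s f with he
  have hev : ∀ x : s.ToType, (e x).1 = f x.1 := fun x => Multiset.mapEquiv_apply s f x
  have hsinj : ∀ x y : s.ToType, x.1 = y.1 → x = y := by
    rintro ⟨x, i⟩ ⟨y, j⟩ (rfl : x = y)
    have h1 : s.count x ≤ 1 := Multiset.nodup_iff_count_le_one.1 (Finset.univ.image b).nodup x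
    congr 1
    ext
    have := i.2; have := j.2; omega
  set β : (blockPartition b).parts.ToType → B := fun p => (e.symm p).1 with hβ
  have hβinj : Function.Injective β := fun p q h => e.symm.injective (hsinj _ _ h)
  have hfβ : ∀ p, f (β p) = p.1 := fun p => by rw [hβ, ← hev, e.apply_symm_apply]
  obtain ⟨σ, hσ⟩ := exists_perm_of_card_fiber_eq b (fun k => β (T k).1) (by
    intro β₀
    by_cases h : β₀ ∈ Finset.univ.image b
    · obtain ⟨p, rfl⟩ : ∃ p, β p = β₀ := by
        refine ⟨e ⟨β₀, ⟨0, Multiset.count_pos.2 h⟩⟩, ?_⟩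
        exact congrArg Sigma.fst (e.symm_apply_apply _)
      simp only [hβinj.eq_iff]
      rw [card_filter_row T p, ← hfβ]
    · rw [Finset.filter_eq_empty_iff.2, Finset.filter_eq_empty_iff.2]
      · intro k _ hk
        refine h ?_
        rw [← hk]
        have : β (T k).1 ∈ s := Multiset.coe_mem (x := e.symm (T k).1)
        exact this
      · intro k _ hk
        exact h (Finset.mem_image.2 ⟨k, Finset.mem_univ _, hk⟩))
  exact ⟨σ, β, hσ⟩

end Block

end Combinatorics

/-! ### Products over pairs of variables -/

section PairProd

variable {V : Type} [Fintype V] {R : Type*} [CommRing R]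

open Classical in
/-- The product of the `(y_v ^ n - y_w ^ n) ^ e` over the pairs `(v, w)` in the relation `C`,
where `n` and `e` may depend on the pair.  With values in a polynomial ring this is a polynomial,
with values in the complex numbers it is the value of this polynomial. -/
noncomputable def pairProd (C : V → V → Prop) (n e : V → V → ℕ) (y : V → R) : R :=
  ∏ v, ∏ w, if C v w then (y v ^ n v w - y w ^ n v w) ^ e v w else 1

variable (C : V → V → Prop) (n e : V → V → ℕ)

theorem map_pairProd {R' : Type*} [CommRing R'] (f : R →+* R') (y : V → R) :
    f (pairProd C n e y) = pairProd C n e fun v => f (y v) := by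
  simp only [pairProd, map_prod, apply_ite f, map_pow, map_sub, map_one]

variable {C n e}

theorem pairProd_ne_zero [IsDomain R] {y : V → R}
    (h : ∀ v w, C v w → y v ^ n v w ≠ y w ^ n v w) : pairProd C n e y ≠ 0 := by
  refine Finset.prod_ne_zero_iff.2 fun v _ => Finset.prod_ne_zero_iff.2 fun w _ => ?_
  split_ifs with hC
  · exact pow_ne_zero _ (sub_ne_zero.2 (h v w hC))
  · exact one_ne_zero

theorem pairProd_X_ne_zero (hC : ∀ v w, C v w → v ≠ w) (hn : ∀ v w, C v w → 0 < n v w) :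
    pairProd C n e (MvPolynomial.X : V → MvPolynomial V ℂ) ≠ 0 := by
  classical
  refine pairProd_ne_zero fun v w h heq => ?_
  have := congrArg (MvPolynomial.eval (Pi.single v (1 : ℂ))) heq
  simp [(hC v w h).symm, (hn v w h).ne'] at this

theorem pairProd_congr {n' e' : V → V → ℕ} {y : V → R} (hn : ∀ v w, C v w → n v w = n' v w)
    (he : ∀ v w, C v w → e v w = e' v w) : pairProd C n e y = pairProd C n' e' y := by
  refine Finset.prod_congr rfl fun v _ => Finset.prod_congr rfl fun w _ => ?_
  split_ifs with h
  · rw [hn v w h, he v w h]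
  · rfl

theorem pairProd_mul (e' : V → V → ℕ) (y : V → R) :
    pairProd C n e y * pairProd C n e' y = pairProd C n (e + e') y := by
  simp only [pairProd, ← Finset.prod_mul_distrib]
  refine Finset.prod_congr rfl fun v _ => Finset.prod_congr rfl fun w _ => ?_
  split_ifs
  · rw [Pi.add_apply, Pi.add_apply, pow_add]
  · rw [one_mul]

theorem pairProd_mul_disjoint {C' : V → V → Prop} (h : ∀ v w, C v w → ¬ C' v w) (y : V → R) :
    pairProd C n e y * pairProd C' n e y = pairProd (fun v w => C v w ∨ C' v w) n e y := by
  simp only [pairProd, ← Finset.prod_mul_distrib]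
  refine Finset.prod_congr rfl fun v _ => Finset.prod_congr rfl fun w _ => ?_
  by_cases h1 : C v w
  · simp [h1, h v w h1]
  · by_cases h2 : C' v w <;> simp [h1, h2]

theorem pairProd_perm (π : Equiv.Perm V) (hC : ∀ v w, C (π v) (π w) ↔ C v w)
    (hn : ∀ v w, n (π v) (π w) = n v w) (he : ∀ v w, e (π v) (π w) = e v w) (y : V → R) :
    pairProd C n e (y ∘ π) = pairProd C n e y := by
  symm
  rw [pairProd, pairProd, ← Equiv.prod_comp π]
  refine Finset.prod_congr rfl fun v _ => ?_
  rw [← Equiv.prod_comp π]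
  refine Finset.prod_congr rfl fun w _ => ?_
  by_cases h : C v w
  · rw [if_pos h, if_pos ((hC v w).2 h), hn, he]
    rfl
  · rw [if_neg h, if_neg fun h' => h ((hC v w).1 h')]

/-- A product over one pair out of each couple `(v, w)`, `(w, v)` is, up to a sign, a product over
all pairs when the exponents are even. -/
theorem pairProd_even (hasymm : ∀ v w, C v w → ¬ C w v) (hn : ∀ v w, n v w = n w v)
    (he : ∀ v w, e v w = e w v) :
    ∃ s : R, ∀ y : V → R, pairProd C n (2 * e) y =
      s * pairProd (fun v w => C v w ∨ C w v) n e y := by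
  classical
  refine ⟨∏ v, ∏ w, if C v w then (-1) ^ e v w else 1, fun y => ?_⟩
  rw [← pairProd_mul_disjoint hasymm]
  have h1 : pairProd (fun v w => C w v) n e y =
      ∏ v, ∏ w, if C v w then (y w ^ n v w - y v ^ n v w) ^ e v w else 1 := by
    rw [pairProd, Finset.prod_comm]
    refine Finset.prod_congr rfl fun v _ => Finset.prod_congr rfl fun w _ => ?_
    rw [hn v w, he v w]
  rw [h1]
  simp only [pairProd, ← Finset.prod_mul_distrib]
  refine Finset.prod_congr rfl fun v _ => Finset.prod_congr rfl fun w _ => ?_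
  split_ifs
  · rw [← mul_pow, ← mul_pow, Pi.mul_apply, Pi.mul_apply, Pi.ofNat_apply, Pi.ofNat_apply, pow_mul]
    congr 1
    ring
  · ring

theorem pairProd_scale (C : V → V → Prop) (n e : V → V → ℕ) :
    ∃ d : ℕ, ∀ (c : R) (y : V → R), pairProd C n e (fun v => c * y v) =
      c ^ d * pairProd C n e y := by
  classical
  refine ⟨∑ v, ∑ w, if C v w then n v w * e v w else 0, fun c y => ?_⟩
  simp only [pairProd, ← Finset.prod_pow_eq_pow_sum, ← Finset.prod_mul_distrib]
  refine Finset.prod_congr rfl fun v _ => Finset.prod_congr rfl fun w _ => ?_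
  split_ifs
  · rw [mul_pow, mul_pow, ← mul_sub, mul_pow, pow_mul]
  · simp

theorem pairProd_root {u y : V → R} (hu : ∀ v w, C v w → u v ^ n v w = 1 ∧ u w ^ n v w = 1) :
    pairProd C n e (fun v => u v * y v) = pairProd C n e y := by
  refine Finset.prod_congr rfl fun v _ => Finset.prod_congr rfl fun w _ => ?_
  split_ifs with h
  · rw [mul_pow, mul_pow, (hu v w h).1, (hu v w h).2, one_mul, one_mul]
  · rfl

open MvPolynomial in
/-- The factors of a product over pairs are coprime if the relation is antisymmetric, so that it
suffices to check divisibility factor by factor. -/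
theorem pairProd_dvd (hC : ∀ v w, C v w → ¬ C w v) (hn : ∀ v w, C v w → 0 < n v w)
    {Q : MvPolynomial V ℂ}
    (hQ : ∀ v w, C v w → (X v ^ n v w - X w ^ n v w) ^ e v w ∣ Q) :
    pairProd C n e (X : V → MvPolynomial V ℂ) ∣ Q := by
  classical
  have hne : ∀ v w, C v w → v ≠ w := by rintro v w h rfl; exact hC v v h h
  have h1 : pairProd C n e (X : V → MvPolynomial V ℂ) =
      ∏ p ∈ (Finset.univ : Finset (V × V)).filter (fun p => C p.1 p.2),
        (X p.1 ^ n p.1 p.2 - X p.2 ^ n p.1 p.2) ^ e p.1 p.2 := by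
    rw [Finset.prod_filter, Fintype.prod_prod_type]
    rfl
  rw [h1]
  refine Finset.prod_dvd_of_isRelPrime ?_ fun p hp => hQ _ _ (Finset.mem_filter.1 hp).2
  rintro ⟨v, w⟩ hp ⟨v', w'⟩ hp' hpp
  have hp := (Finset.mem_filter.1 (Finset.mem_coe.1 hp)).2
  have hp' := (Finset.mem_filter.1 (Finset.mem_coe.1 hp')).2
  refine (isRelPrime_pow_sub_pow (hn _ _ hp) (hn _ _ hp') (hne _ _ hp) (hne _ _ hp') ?_).pow
  have hvw := hne _ _ hp
  have hvw' := hne _ _ hp'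
  simp only at hp hp' hvw hvw' ⊢
  by_contra! hcon
  obtain ⟨h2, h3⟩ := hcon
  by_cases e1 : v' = v
  · subst e1
    have : w' = w := h3 (fun h => hvw' h.symm)
    exact hpp (by rw [this])
  · have e2 := h2 e1
    subst e2
    by_cases e3 : w' = v
    · subst e3; exact hC _ _ hp hp'
    · exact hvw' (h3 e3).symm

end PairProd

namespace Folding

variable (F : Folding)

/-! ### Numerators and denominators as products over pairs -/

section Prefactors

variable {m : Fin F.r → ℕ} {μ : F.MultiPartition m}

/-- The length of the row of a variable. -/
abbrev len (v : F.YVar μ) : ℕ := v.2.1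

/-- The order `(i, s) > (j, s')` on the variables with the same label. -/
def rowGT (v w : F.YVar μ) : Prop :=
  v.1 = w.1 ∧ (w.2.1 < v.2.1 ∨ (v.2.1 = w.2.1 ∧ v.2.2.1 < w.2.2.1))

theorem rowGT_mk {a : Fin F.r} {p q : (μ a).parts.ToType} :
    F.rowGT (⟨a, p⟩ : F.YVar μ) ⟨a, q⟩ ↔ partGT p q := by
  simp [rowGT, partGT]

theorem rowGT_asymm {v w : F.YVar μ} (h : F.rowGT v w) : ¬ F.rowGT w v := by
  rintro ⟨_, h' | ⟨h1, h'⟩⟩ <;> rcases h with ⟨_, h | ⟨h2, h⟩⟩ <;> omega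

theorem rowGT_or {v w : F.YVar μ} : (F.rowGT v w ∨ F.rowGT w v) ↔ v.1 = w.1 ∧ v ≠ w := by
  obtain ⟨a, p⟩ := v
  obtain ⟨b, q⟩ := w
  constructor
  · rintro (h | h)
    · exact ⟨h.1, by rintro ⟨⟩; exact F.rowGT_asymm h h⟩
    · exact ⟨h.1.symm, by rintro ⟨⟩; exact F.rowGT_asymm h h⟩
  · rintro ⟨h, hne⟩
    obtain rfl : a = b := h
    rw [rowGT_mk, rowGT_mk]
    rcases partGT_trichotomy p q with h | rfl | h
    · exact Or.inl h
    · exact absurd rfl hne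
    · exact Or.inr h

/-- The pairs of labels in the denominators. -/
def linked (a b : Fin F.r) : Prop := a < b ∧ F.fold a b < 0

/-- The exponent `k_{ab}` for the labels of two variables. -/
abbrev kexp {V : Type} (ℓ : V → Fin F.r) (v w : V) : ℕ := F.k (ℓ v) (ℓ w)

/-- The exponent `min (i, j)` for rows of lengths `i` and `j`. -/
abbrev minLen (v w : F.YVar μ) : ℕ := min (F.len v) (F.len w)

variable (μ) in
/-- The order `i j - min (i, j)` to which the numerators vanish at the poles of evaluated
functions. -/
abbrev mixExp (v w : F.YVar μ) : ℕ := F.len v * F.len w - F.minLen v w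

open Classical in
theorem prod_linked {A : Fin F.r → Type} [∀ a, Fintype (A a)] {R : Type*} [CommMonoid R]
    (f : (Σ a, A a) → (Σ a, A a) → R) :
    ∏ a, ∏ b ∈ Finset.univ.filter (fun b => a < b ∧ F.fold a b < 0), ∏ p : A a, ∏ q : A b,
      f ⟨a, p⟩ ⟨b, q⟩ = ∏ v, ∏ w, if F.linked v.1 w.1 then f v w else 1 := by
  rw [Fintype.prod_sigma]
  refine Finset.prod_congr rfl fun a _ => ?_
  rw [Finset.prod_filter]
  simp only [Fintype.prod_sigma]
  rw [Finset.prod_comm]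
  refine Finset.prod_congr rfl fun b _ => ?_
  by_cases h : a < b ∧ F.fold a b < 0
  · rw [if_pos h]
    refine Finset.prod_congr rfl fun p _ => Finset.prod_congr rfl fun q _ => ?_
    rw [if_pos]; exact h
  · rw [if_neg h]
    refine (Finset.prod_eq_one fun p _ => Finset.prod_eq_one fun q _ => ?_).symm
    rw [if_neg]; exact h

theorem xDenom_eq (x : F.XVar m → ℂˣ) :
    F.xDenom m x = pairProd (fun v w => F.linked v.1 w.1) (F.kexp (F.xlab m)) 1
      fun v => (x v : ℂ) := by
  rw [xDenom, F.prod_linked fun v w : F.XVar m =>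
    (x v : ℂ) ^ F.k v.1 w.1 - (x w : ℂ) ^ F.k v.1 w.1]
  refine Finset.prod_congr rfl fun v _ => Finset.prod_congr rfl fun w _ => ?_
  simp only [Pi.one_apply, pow_one]

theorem yDenom_eq (y : F.YVar μ → ℂˣ) :
    F.yDenom μ y = pairProd (fun v w => F.linked v.1 w.1) (F.kexp (F.ylab μ)) F.minLen
      fun v => (y v : ℂ) := by
  rw [yDenom, F.prod_linked fun v w : F.YVar μ =>
    ((y v : ℂ) ^ F.k v.1 w.1 - (y w : ℂ) ^ F.k v.1 w.1) ^ min v.2.1 w.2.1]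
  rfl

theorem yNum_eq (y : F.YVar μ → ℂˣ) :
    F.yNum μ y = pairProd F.rowGT (F.kexp (F.ylab μ)) (2 * F.minLen) fun v => (y v : ℂ) := by
  classical
  rw [yNum, pairProd, Fintype.prod_sigma]
  refine Finset.prod_congr rfl fun a _ => Finset.prod_congr rfl fun p _ => ?_
  rw [Fintype.prod_sigma, Finset.prod_eq_single a, Finset.prod_filter]
  · refine Finset.prod_congr rfl fun q _ => ?_
    by_cases h : partGT p q
    · rw [if_pos h, if_pos (F.rowGT_mk.2 h)]
      simp only [kexp, k_self]
      rfl
    · rw [if_neg h, if_neg fun h' => h (F.rowGT_mk.1 h')]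
  · intro b _ hb
    refine Finset.prod_eq_one fun q _ => ?_
    rw [if_neg]
    exact fun h => hb h.1.symm
  · simp

variable (μ) in
/-- The relation between variables that share a factor of the numerators of evaluated
functions. -/
def pairRel (v w : F.YVar μ) : Prop := F.rowGT v w ∨ F.linked v.1 w.1

variable (μ) in
/-- The order to which evaluated numerators vanish where two variables coincide. -/
def pairExp (v w : F.YVar μ) : ℕ := if v.1 = w.1 then 2 * F.minLen v w else F.mixExp μ v w

variable (μ) in
/-- The product `yNum · ∏ (y_v ^ k - y_w ^ k) ^ (i j - min (i, j))` that divides all evaluated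
numerators of `Γ_μ`. -/
noncomputable def yFactor {R : Type*} [CommRing R] (y : F.YVar μ → R) : R :=
  pairProd (F.pairRel μ) (F.kexp (F.ylab μ)) (F.pairExp μ) y

variable (μ) in
/-- The part of `yFactor` that comes from variables with different labels. -/
noncomputable def yMix {R : Type*} [CommRing R] (y : F.YVar μ → R) : R :=
  pairProd (fun v w => F.linked v.1 w.1) (F.kexp (F.ylab μ)) (F.mixExp μ) y

theorem yFactor_eq (y : F.YVar μ → ℂˣ) :
    F.yFactor μ (fun v => (y v : ℂ)) = F.yNum μ y * F.yMix μ (fun v => (y v : ℂ)) := by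
  rw [yFactor, yNum_eq, yMix]
  have h1 : pairProd F.rowGT (F.kexp (F.ylab μ)) (2 * F.minLen) (fun v => (y v : ℂ)) =
      pairProd F.rowGT (F.kexp (F.ylab μ)) (F.pairExp μ) (fun v => (y v : ℂ)) :=
    pairProd_congr (fun _ _ _ => rfl) fun v w h => by
      rw [pairExp, if_pos h.1]; rfl
  have h2 : pairProd (fun v w : F.YVar μ => F.linked v.1 w.1) (F.kexp (F.ylab μ)) (F.mixExp μ)
      (fun v => (y v : ℂ)) =
      pairProd (fun v w => F.linked v.1 w.1) (F.kexp (F.ylab μ)) (F.pairExp μ)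
        (fun v => (y v : ℂ)) :=
    pairProd_congr (fun _ _ _ => rfl) fun v w h => by
      rw [pairExp, if_neg h.1.ne]
  rw [h1, h2, pairProd_mul_disjoint]
  · rfl
  · exact fun v w h h' => h'.1.ne h.1

theorem pairRel_asymm {v w : F.YVar μ} (h : F.pairRel μ v w) : ¬ F.pairRel μ w v := by
  rintro (h' | h') <;> rcases h with h | h
  · exact F.rowGT_asymm h h'
  · exact h.1.ne h'.1.symm
  · exact h'.1.ne h.1.symm
  · exact lt_asymm h.1 h'.1

theorem pairRel_ne {v w : F.YVar μ} (h : F.pairRel μ v w) : v ≠ w := by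
  rintro rfl; exact F.pairRel_asymm h h

theorem yFactor_X_ne_zero (hκ : 0 < F.κ) :
    F.yFactor μ (MvPolynomial.X : F.YVar μ → MvPolynomial (F.YVar μ) ℂ) ≠ 0 :=
  pairProd_X_ne_zero (fun _ _ h => F.pairRel_ne h) fun _ _ _ => F.k_pos hκ _ _

theorem eval_yFactor (y : F.YVar μ → ℂ) :
    MvPolynomial.eval y (F.yFactor μ MvPolynomial.X) = F.yFactor μ y := by
  rw [yFactor, map_pairProd]
  simp [yFactor]

/-- Products over letters of functions of their rows. -/
theorem prod_row (T : F.Tableaux μ) {R : Type*} [CommMonoid R] (f : F.YVar μ → R) :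
    ∏ v : F.XVar m, f (F.row T v) = ∏ u, f u ^ F.len u := by
  rw [Fintype.prod_sigma, Fintype.prod_sigma]
  refine Finset.prod_congr rfl fun a _ => ?_
  rw [← Equiv.prod_comp (T a).symm, Fintype.prod_sigma]
  refine Finset.prod_congr rfl fun p _ => ?_
  simp [row]

theorem pairProd_row (T : F.Tableaux μ) (y : F.YVar μ → ℂ) :
    pairProd (fun v w => F.linked v.1 w.1) (F.kexp (F.xlab m)) 1 (fun v => y (F.row T v)) =
      pairProd (fun v w => F.linked v.1 w.1) (F.kexp (F.ylab μ)) (fun v w => F.len v * F.len w)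
        y := by
  classical
  set G : F.YVar μ → F.YVar μ → ℂ := fun v w =>
    if F.linked v.1 w.1 then y v ^ F.k v.1 w.1 - y w ^ F.k v.1 w.1 else 1 with hG
  have h1 : pairProd (fun v w => F.linked v.1 w.1) (F.kexp (F.xlab m)) 1
      (fun v => y (F.row T v)) = ∏ v, ∏ w, G (F.row T v) (F.row T w) := by
    refine Finset.prod_congr rfl fun v _ => Finset.prod_congr rfl fun w _ => ?_
    simp [hG, row]
  rw [h1]
  simp only [F.prod_row T (G _), F.prod_row T fun v => ∏ w, G v w ^ F.len w]
  refine Finset.prod_congr rfl fun v _ => ?_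
  rw [← Finset.prod_pow]
  refine Finset.prod_congr rfl fun w _ => ?_
  rw [← pow_mul, hG]
  simp only
  split_ifs
  · rw [mul_comm]
  · rw [one_pow]

theorem minLen_le (v w : F.YVar μ) : F.minLen v w ≤ F.len v * F.len w := by
  rcases Nat.eq_zero_or_pos (F.len w) with h | h
  · simp [minLen, h]
  · exact (min_le_left _ _).trans (Nat.le_mul_of_pos_right _ h)

/-- After evaluation the denominator splits into the poles that survive and those that are
cancelled by the numerator. -/
theorem xDenom_row (T : F.Tableaux μ) (y : F.YVar μ → ℂˣ) :
    F.xDenom m (fun v => y (F.row T v)) = F.yMix μ (fun v => (y v : ℂ)) * F.yDenom μ y := by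
  rw [xDenom_eq, F.pairProd_row T fun v => (y v : ℂ), yDenom_eq, yMix, pairProd_mul]
  refine pairProd_congr (fun _ _ _ => rfl) fun v w _ => ?_
  have := F.minLen_le v w
  simp only [Pi.add_apply, mixExp]
  omega

variable (μ) in
theorem yNum_perm (π : Equiv.Perm (F.YVar μ))
    (hπ : ∀ v, ((π v).1, (π v).2.1) = (v.1, v.2.1)) (y : F.YVar μ → ℂˣ) :
    F.yNum μ (y ∘ π) = F.yNum μ y := by
  have h1 : ∀ v, (π v).1 = v.1 := fun v => congrArg Prod.fst (hπ v)
  have h2 : ∀ v, (π v).2.1 = v.2.1 := fun v => congrArg Prod.snd (hπ v)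
  obtain ⟨s, hs⟩ := pairProd_even (R := ℂ) (C := F.rowGT (μ := μ)) (n := F.kexp (F.ylab μ))
    (e := F.minLen) (fun _ _ => F.rowGT_asymm) (fun _ _ => F.k_comm _ _)
    (fun _ _ => min_comm _ _)
  rw [yNum_eq, yNum_eq, hs, hs]
  congr 1
  refine pairProd_perm π (fun v w => ?_) (fun v w => ?_) (fun v w => ?_) fun v => (y v : ℂ)
  · rw [rowGT_or, rowGT_or, h1, h1, π.injective.ne_iff]
  · simp only [kexp, ylab, h1]
  · simp only [minLen, len, h2]

variable (μ) in
theorem yMix_perm (π : Equiv.Perm (F.YVar μ))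
    (hπ : ∀ v, ((π v).1, (π v).2.1) = (v.1, v.2.1)) (y : F.YVar μ → ℂ) :
    F.yMix μ (y ∘ π) = F.yMix μ y := by
  have h1 : ∀ v, (π v).1 = v.1 := fun v => congrArg Prod.fst (hπ v)
  have h2 : ∀ v, (π v).2.1 = v.2.1 := fun v => congrArg Prod.snd (hπ v)
  refine pairProd_perm π (fun v w => ?_) (fun v w => ?_) (fun v w => ?_) y
  · rw [h1, h1]
  · simp only [kexp, ylab, h1]
  · simp only [mixExp, minLen, len, h2]

theorem yFactor_root (hκ : 0 < F.κ) {u y : F.YVar μ → ℂ} (hu : ∀ v, u v ^ F.t v.1 = 1) :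
    F.yFactor μ (fun v => u v * y v) = F.yFactor μ y := by
  refine pairProd_root fun v w _ => ⟨?_, ?_⟩
  · obtain ⟨d, hd⟩ := F.t_dvd_k hκ v.1 w.1
    simp only [kexp, ylab]
    rw [hd, pow_mul, hu, one_pow]
  · obtain ⟨d, hd⟩ := F.t_dvd_k hκ w.1 v.1
    simp only [kexp, ylab]
    rw [k_comm, hd, pow_mul, hu, one_pow]

/-! ### Regular points -/

theorem xDenom_ne_zero (x : F.Reg (F.xlab m)) : F.xDenom m x.1 ≠ 0 := by
  rw [xDenom_eq]
  exact pairProd_ne_zero fun v w h => x.2 v w h.2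

theorem yDenom_ne_zero (y : F.Reg (F.ylab μ)) : F.yDenom μ y.1 ≠ 0 := by
  rw [yDenom_eq]
  exact pairProd_ne_zero fun v w h => y.2 v w h.2

theorem yMix_ne_zero (y : F.Reg (F.ylab μ)) : F.yMix μ (fun v => (y.1 v : ℂ)) ≠ 0 :=
  pairProd_ne_zero fun v w h => y.2 v w h.2

/-- The regular points are the points off the zero set of a nonzero polynomial. -/
theorem exists_poly_reg {V : Type} [Fintype V] (ℓ : V → Fin F.r) (hκ : 0 < F.κ)
    (hdiag : ∀ a, 0 ≤ F.fold a a) :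
    ∃ D : MvPolynomial V ℂ, D ≠ 0 ∧
      ∀ x : V → ℂˣ, MvPolynomial.eval (fun v => (x v : ℂ)) D ≠ 0 → x ∈ F.Reg ℓ := by
  refine ⟨pairProd (fun v w => F.fold (ℓ v) (ℓ w) < 0) (F.kexp ℓ) 1 MvPolynomial.X,
    pairProd_X_ne_zero ?_ fun _ _ _ => F.k_pos hκ _ _, fun x hx v w h heq => hx ?_⟩
  · rintro v w h rfl
    exact absurd h (not_lt.2 (hdiag _))
  · rw [map_pairProd, pairProd]
    refine Finset.prod_eq_zero (Finset.mem_univ v) (Finset.prod_eq_zero (Finset.mem_univ w) ?_)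
    rw [if_pos h]
    simp [heq]

/-- A Laurent polynomial that vanishes at the regular points is zero. -/
theorem laurent_eq_zero_of_reg {V : Type} [Fintype V] (ℓ : V → Fin F.r) (hκ : 0 < F.κ)
    (hdiag : ∀ a, 0 ≤ F.fold a a) {f : (V → ℂˣ) → ℂ} (hf : f ∈ F.laurent ℓ)
    (h : ∀ x ∈ F.Reg ℓ, f x = 0) : f = 0 := by
  obtain ⟨D, hD, hD'⟩ := F.exists_poly_reg ℓ hκ hdiag
  exact F.laurent_eq_zero_of_dense ℓ hκ hf hD fun x hx => h x (hD' x hx)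

end Prefactors

/-! ### Zeros of evaluated numerators -/

section Image

open MvPolynomial

theorem poly_ext_of_torus {V : Type} {P Q : MvPolynomial V ℂ}
    (h : ∀ x : V → ℂˣ, eval (fun v => (x v : ℂ)) P = eval (fun v => (x v : ℂ)) Q) : P = Q :=
  sub_eq_zero.1 (poly_eq_zero_of_torus fun x => by rw [map_sub, h, sub_self])

variable {m : Fin F.r → ℕ} {ξ : ℂ}

theorem numerator_vanish {f : (F.XVar m → ℂˣ) → ℂ} (hf : f ∈ F.numerators m ξ) {a b : Fin F.r}
    (hab : F.fold a b < 0) :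
    ∀ l < F.k a b, ∀ i j : Fin (m a), i ≠ j → ∀ k : Fin (m b), ∀ x : F.XVar m → ℂˣ,
      (x ⟨a, i⟩ : ℂ) = x ⟨a, j⟩ → (x ⟨a, j⟩ : ℂ) = ξ ^ l * x ⟨b, k⟩ → f x = 0 := by
  intro l hl i j hij k x h1 h2
  rcases Nat.eq_zero_or_pos l with rfl | hl0
  · rw [pow_zero, one_mul] at h2
    exact hf.2.1 a b hab i j hij k x h1 h2
  · have hk : F.k a b = F.κ := by
      unfold Folding.k at hl ⊢
      rcases F.t_eq a with h | h <;> rcases F.t_eq b with h' | h' <;> rw [h, h'] at hl ⊢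
      · exact max_self _
      · exact max_eq_left (by omega)
      · exact max_eq_right (by omega)
      · omega
    exact hf.2.2 a b hab hk i j hij k l hl0 (by omega) x h1 h2

variable {T : ∀ μ : F.MultiPartition m, F.Tableaux μ} {μ : F.MultiPartition m}

/-- A symmetric function that vanishes under all evaluations `φ_ν`, `ν > μ`, vanishes under every
identification of the letters by blocks that form a multipartition greater than `μ`. -/
theorem comp_eq_zero_of_multiLT {f : (F.XVar m → ℂˣ) → ℂ}
    (hf : f ∈ F.symmLaurent (F.xlab m) (F.xlab m))
    (h0 : ∀ ν, F.multiLT μ ν → ∀ y : F.YVar ν → ℂˣ, f (fun v => y (F.row (T ν) v)) = 0)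
    {B : Type} (b : F.XVar m → B)
    (hb : F.multiLT μ fun a => blockPartition fun k => b ⟨a, k⟩) (z : B → ℂˣ) :
    f (fun v => z (b v)) = 0 := by
  choose σ β hσ using fun a => exists_perm_row (fun k => b ⟨a, k⟩)
    (T (fun a => blockPartition fun k => b ⟨a, k⟩) a)
  have h1 := h0 _ hb fun u => z (β u.1 u.2)
  have h2 := hf.2 (Equiv.sigmaCongrRight σ) (fun v => rfl) fun v => z (b v)
  rw [← h2, ← h1]
  congr 1
  funext v
  exact congrArg z (hσ v.1 v.2)

theorem card_row (T : F.Tableaux μ) (u : F.YVar μ) [DecidablePred fun v => F.row T v = u] :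
    (Finset.univ.filter fun v => F.row T v = u).card = F.len u := by
  classical
  have h := F.prod_row T fun u' => if u' = u then Multiplicative.ofAdd 1 else 1
  have h2 := congrArg Multiplicative.toAdd h
  rw [toAdd_prod, toAdd_prod, Finset.sum_eq_single u] at h2
  · rw [Finset.card_filter]
    simp only [apply_ite Multiplicative.toAdd, toAdd_ofAdd, toAdd_one, if_true, toAdd_pow,
      smul_eq_mul, mul_one] at h2
    rw [← h2]
  · intro v _ hv; simp [hv]
  · simp

/-- The letters, with the row `w` broken up into single letters. -/
noncomputable def split (T : F.Tableaux μ) (w : F.YVar μ) (x : F.XVar m) :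
    F.YVar μ ⊕ F.XVar m :=
  open Classical in if F.row T x = w then Sum.inr x else Sum.inl (F.row T x)

theorem split_of_eq (T : F.Tableaux μ) {w : F.YVar μ} {x : F.XVar m} (h : F.row T x = w) :
    F.split T w x = Sum.inr x := if_pos h

theorem split_of_ne (T : F.Tableaux μ) {w : F.YVar μ} {x : F.XVar m} (h : F.row T x ≠ w) :
    F.split T w x = Sum.inl (F.row T x) := if_neg h

/-- If a letter of the row `w` is moved to a row `v` that is not shorter, and the other letters of
`w` are separated, then the multipartition becomes greater. -/
theorem multiLT_split (T : F.Tableaux μ) {v w : F.YVar μ} (hvw : F.rowGT v w) {l : F.XVar m}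
    (hl : F.row T l = w) (r₂ : F.XVar m → F.YVar μ ⊕ F.XVar m) (hr₂l : r₂ l = Sum.inl v)
    (hr₂ : ∀ x, x ≠ l → r₂ x = F.split T w x) :
    F.multiLT μ fun a => blockPartition fun k => r₂ ⟨a, k⟩ := by
  classical
  have hne : v ≠ w := (F.rowGT_or.1 (Or.inl hvw)).2
  obtain ⟨a, p⟩ := v
  obtain ⟨a', q⟩ := w
  obtain rfl : a = a' := hvw.1
  obtain ⟨c, l⟩ := l
  obtain rfl : c = a := congrArg Sigma.fst hl
  have hinl : ∀ b, Function.Injective fun p : (μ b).parts.ToType =>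
      (Sum.inl ⟨b, p⟩ : F.YVar μ ⊕ F.XVar m) := by
    intro b p p' h
    simpa using h
  have hrow : ∀ b, blockPartition (fun k => (Sum.inl (F.row T ⟨b, k⟩) : F.YVar μ ⊕ F.XVar m)) =
      μ b := fun b => blockPartition_row (T b) (hinl b)
  refine ⟨c, fun b hb => ?_, ?_⟩
  · rw [← hrow b]
    congr 1
    funext k
    have h1 : (⟨b, k⟩ : F.XVar m) ≠ ⟨c, l⟩ := fun h => hb.ne (congrArg Sigma.fst h)
    rw [hr₂ _ h1, split_of_ne]
    exact fun h => hb.ne (congrArg Sigma.fst h)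
  have hpq : q.1 ≤ p.1 := by
    rcases hvw.2 with h | h
    · exact h.le
    · exact h.1.ge
  have hp := part_pos p
  -- the sizes of the blocks before and after
  set c₀ : F.YVar μ ⊕ F.XVar m → ℕ := fun β =>
    (Finset.univ.filter fun k => Sum.inl (F.row T ⟨c, k⟩) = β).card with hc₀
  set c₂ : F.YVar μ ⊕ F.XVar m → ℕ := fun β =>
    (Finset.univ.filter fun k => r₂ ⟨c, k⟩ = β).card with hc₂
  have hex₀ : ∀ i, excess (μ c).parts i = ∑ β : F.YVar μ ⊕ F.XVar m, (c₀ β - i) := by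
    intro i
    conv_lhs => rw [← hrow c]
    convert excess_blockPartition (fun k => (Sum.inl (F.row T ⟨c, k⟩) : F.YVar μ ⊕ F.XVar m)) i
  have hex₂ : ∀ i, excess (blockPartition fun k => r₂ ⟨c, k⟩).parts i =
      ∑ β : F.YVar μ ⊕ F.XVar m, (c₂ β - i) := by
    intro i
    convert excess_blockPartition (fun k => r₂ ⟨c, k⟩) i
  have hrowT : ∀ k, F.row T ⟨c, k⟩ = ⟨c, (T c k).1⟩ := fun k => rfl
  have hT : ∀ k p', F.row T ⟨c, k⟩ = ⟨c, p'⟩ ↔ (T c k).1 = p' := fun k p' => by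
    rw [hrowT]; simp
  have hc₀p : ∀ p', c₀ (Sum.inl ⟨c, p'⟩) = p'.1 := by
    intro p'
    simp only [hc₀, Sum.inl.injEq, hT]
    exact card_filter_row (T c) p'
  have hlq : (T c l).1 = q := (hT l q).1 hl
  have hpq' : p ≠ q := fun h => hne (by rw [h])
  have hr₂' : ∀ k, k ≠ l → r₂ ⟨c, k⟩ = F.split T ⟨c, q⟩ ⟨c, k⟩ := fun k hk =>
    hr₂ _ fun h => hk (by simpa using h)
  have hc₂p : c₂ (Sum.inl ⟨c, p⟩) = p.1 + 1 := by
    rw [← card_filter_row (T c) p, hc₂]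
    simp only
    rw [← Finset.card_insert_of_notMem (a := l)]
    · congr 1
      ext k
      simp only [Finset.mem_filter, Finset.mem_univ, true_and, Finset.mem_insert]
      rcases eq_or_ne k l with rfl | hk
      · simp [hr₂l]
      · simp only [hk, false_or]
        rw [hr₂' k hk]
        by_cases h : (T c k).1 = q
        · rw [F.split_of_eq T ((hT k q).2 h)]
          simp [h, hpq'.symm]
        · rw [F.split_of_ne T fun h' => h ((hT k q).1 h'), Sum.inl.injEq, hT]
    · simp [hlq, hpq'.symm]
  have hc₂q : c₂ (Sum.inl ⟨c, q⟩) = 0 := by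
    rw [hc₂]
    simp only
    rw [Finset.card_eq_zero, Finset.filter_eq_empty_iff]
    intro k _
    rcases eq_or_ne k l with rfl | hk
    · rw [hr₂l]; simpa using hpq'
    · rw [hr₂' k hk]
      by_cases h : (T c k).1 = q
      · rw [F.split_of_eq T ((hT k q).2 h)]; simp
      · rw [F.split_of_ne T fun h' => h ((hT k q).1 h'), Sum.inl.injEq, hT]; exact h
  have hc₂u : ∀ u : F.YVar μ, u ≠ ⟨c, p⟩ → u ≠ ⟨c, q⟩ → c₂ (Sum.inl u) = c₀ (Sum.inl u) := by
    intro u hup huq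
    rw [hc₂, hc₀]
    simp only
    congr 1
    refine Finset.filter_congr fun k _ => ?_
    rcases eq_or_ne k l with rfl | hk
    · rw [hr₂l, Sum.inl.injEq, Sum.inl.injEq, hl]
      exact ⟨fun h => absurd h.symm hup, fun h => absurd h.symm huq⟩
    · rw [hr₂' k hk]
      by_cases h : (T c k).1 = q
      · have h' := (hT k q).2 h
        rw [F.split_of_eq T h', Sum.inl.injEq, h']
        exact ⟨fun h => by simp at h, fun h => absurd h.symm huq⟩
      · rw [F.split_of_ne T fun h' => h ((hT k q).1 h')]
  have hc₀r : ∀ x, c₀ (Sum.inr x) = 0 := by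
    intro x
    rw [hc₀]
    simp only
    rw [Finset.card_eq_zero, Finset.filter_eq_empty_iff]
    simp
  have hc₂r : ∀ x, c₂ (Sum.inr x) ≤ 1 := by
    intro x
    rw [hc₂]
    simp only
    rw [Finset.card_le_one]
    have key : ∀ k, r₂ ⟨c, k⟩ = Sum.inr x → (⟨c, k⟩ : F.XVar m) = x := by
      intro k hk
      rcases eq_or_ne k l with rfl | hkl
      · rw [hr₂l] at hk; simp at hk
      · rw [hr₂' k hkl] at hk
        by_cases h : (T c k).1 = q
        · rw [F.split_of_eq T ((hT k q).2 h)] at hk; simpa using hk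
        · rw [F.split_of_ne T fun h' => h ((hT k q).1 h')] at hk; simp at hk
    intro k hk k' hk'
    have e1 := key k (Finset.mem_filter.1 hk).2
    have e2 := key k' (Finset.mem_filter.1 hk').2
    simpa using e1.trans e2.symm
  refine partitionLT_of_excess p.1 ?_ fun j hj => ?_
  · rw [hex₀, hex₂]
    refine Finset.sum_lt_sum (fun β _ => ?_) ⟨Sum.inl ⟨c, p⟩, Finset.mem_univ _, ?_⟩
    · rcases β with u | x
      · rcases eq_or_ne u ⟨c, p⟩ with rfl | h1
        · rw [hc₀p, hc₂p]; omega
        rcases eq_or_ne u ⟨c, q⟩ with rfl | h2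
        · rw [hc₀p]; omega
        · rw [hc₂u u h1 h2]
      · rw [hc₀r]; omega
    · rw [hc₀p, hc₂p]; omega
  · rw [hex₀, hex₂]
    refine Finset.sum_congr rfl fun β _ => ?_
    rcases β with u | x
    · rcases eq_or_ne u ⟨c, p⟩ with rfl | h1
      · rw [hc₀p, hc₂p]; omega
      rcases eq_or_ne u ⟨c, q⟩ with rfl | h2
      · rw [hc₀p, hc₂q]; omega
      · rw [hc₂u u h1 h2]
    · have := hc₂r x
      rw [hc₀r]; omega

/-- The identification of variables that undoes `split`. -/
noncomputable def merge (w : F.YVar μ) : F.YVar μ ⊕ F.XVar m → F.YVar μ :=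
  Sum.elim id fun _ => w

theorem merge_split (T : F.Tableaux μ) (w : F.YVar μ) (x : F.XVar m) :
    F.merge w (F.split T w x) = F.row T x := by
  by_cases h : F.row T x = w
  · rw [split_of_eq _ _ h, h]; rfl
  · rw [split_of_ne _ _ h]; rfl

theorem rename_merge_split (T : F.Tableaux μ) (w : F.YVar μ) (P : MvPolynomial (F.XVar m) ℂ) :
    rename (F.merge w) (rename (F.split T w) P) = rename (F.row T) P := by
  rw [rename_rename]
  congr 2
  funext x
  exact F.merge_split T w x

/-- Divisibility that is checked letter by letter for the letters of a row `w`. -/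
theorem dvd_of_forall_letters (T : F.Tableaux μ) {v w : F.YVar μ} {c : ℂ}
    (hc : c ≠ 0) {P : MvPolynomial (F.XVar m) ℂ} {e : ℕ}
    (h : ∀ l, F.row T l = w → lin c (Sum.inl v) (Sum.inr l) ^ e ∣ rename (F.split T w) P) :
    lin c v w ^ (e * F.len w) ∣ rename (F.row T) P := by
  classical
  have h1 : ∏ l ∈ Finset.univ.filter (fun l => F.row T l = w),
      lin c (Sum.inl v : F.YVar μ ⊕ F.XVar m) (Sum.inr l) ^ e ∣ rename (F.split T w) P := by
    refine Finset.prod_dvd_of_isRelPrime (fun i _ j _ hij => ?_) fun l hl =>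
      h l (Finset.mem_filter.1 hl).2
    exact (isRelPrime_lin_of_ne hc (by simp) (by simp)
      (Or.inr ⟨by simp, by simpa using hij.symm⟩)).pow
  have h2 := map_dvd (rename (F.merge w)) h1
  rw [rename_merge_split, map_prod] at h2
  have h3 : ∀ l ∈ Finset.univ.filter (fun l => F.row T l = w), rename (F.merge w)
      (lin c (Sum.inl v : F.YVar μ ⊕ F.XVar m) (Sum.inr l) ^ e) = lin c v w ^ e := by
    intro l _
    rw [map_pow, rename_lin]; rfl
  rw [Finset.prod_congr rfl h3, Finset.prod_const, ← pow_mul] at h2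
  rwa [F.card_row T] at h2

end Image

/-! ### The image of an evaluation map -/

section ImageHtilde

open MvPolynomial

variable {m : Fin F.r → ℕ} {ξ : ℂ} {μ : F.MultiPartition m}
  {f : (F.XVar m → ℂˣ) → ℂ} {P : MvPolynomial (F.XVar m) ℂ} {N : ℕ}

theorem eval_rename_of_eval {W : Type}
    (hP : ∀ x : F.XVar m → ℂˣ,
      f x * (∏ v, (x v : ℂ)) ^ (F.κ * N) = eval (fun v => (x v : ℂ)) P)
    (r : F.XVar m → W) (z : W → ℂˣ) :
    eval (fun w => (z w : ℂ)) (rename r P) =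
      f (fun v => z (r v)) * (∏ v, (z (r v) : ℂ)) ^ (F.κ * N) := by
  rw [eval_rename, hP]
  rfl

theorem swap_label {v l : F.XVar m} [DecidableEq (F.XVar m)] (h : v.1 = l.1) (u : F.XVar m) :
    (Equiv.swap v l u).1 = u.1 := by
  rcases eq_or_ne u v with rfl | h1
  · rw [Equiv.swap_apply_left, h]
  rcases eq_or_ne u l with rfl | h2
  · rw [Equiv.swap_apply_right, h]
  · rw [Equiv.swap_apply_of_ne_of_ne h1 h2]

theorem rename_perm (hf : f ∈ F.symmLaurent (F.xlab m) (F.xlab m))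
    (hP : ∀ x : F.XVar m → ℂˣ,
      f x * (∏ v, (x v : ℂ)) ^ (F.κ * N) = eval (fun v => (x v : ℂ)) P)
    (π : Equiv.Perm (F.XVar m)) (hπ : ∀ u, (π u).1 = u.1) : rename π P = P := by
  refine poly_ext_of_torus fun x => ?_
  rw [F.eval_rename_of_eval hP, ← hP, Equiv.prod_comp π fun v => (x v : ℂ)]
  congr 1
  exact hf.2 π hπ x

/-- The zero of order `2 min (i, j)` where two rows with the same label coincide. -/
theorem lin_one_dvd (T : ∀ μ : F.MultiPartition m, F.Tableaux μ)
    (hf : f ∈ F.symmLaurent (F.xlab m) (F.xlab m))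
    (h0 : ∀ ν, F.multiLT μ ν → ∀ y : F.YVar ν → ℂˣ, f (fun v => y (F.row (T ν) v)) = 0)
    (hP : ∀ x : F.XVar m → ℂˣ,
      f x * (∏ v, (x v : ℂ)) ^ (F.κ * N) = eval (fun v => (x v : ℂ)) P)
    {v w : F.YVar μ} (hvw : F.rowGT v w) :
    lin 1 v w ^ (2 * F.minLen v w) ∣ rename (F.row (T μ)) P := by
  classical
  have hmin : F.minLen v w = F.len w := by
    refine min_eq_right ?_
    rcases hvw.2 with h | h
    · exact h.le
    · exact h.1.ge
  rw [hmin]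
  refine F.dvd_of_forall_letters (T μ) one_ne_zero fun l hl => ?_
  set r := F.split (T μ) w with hr
  have hrl : r l = Sum.inr l := F.split_of_eq _ hl
  have hneg : lin 1 (Sum.inl v : F.YVar μ ⊕ F.XVar m) (Sum.inr l) ^ 2 = lin 1 (r l) (Sum.inl v) ^ 2 := by
    rw [hrl, lin, lin]; simp only [map_one]; ring
  rw [hneg]
  refine lin_sq_dvd_rename (fun u hu => ?_) (by rw [hrl]; simp)
    (fun x => if x = l then Sum.inl v else r x) (if_pos rfl) (fun x hx => if_neg hx) ?_ ?_
  · rw [hrl] at hu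
    by_cases h : F.row (T μ) u = w
    · rw [hr, F.split_of_eq _ h] at hu; simpa using hu
    · rw [hr, F.split_of_ne _ h] at hu; simp at hu
  · refine poly_eq_zero_of_torus fun z => ?_
    rw [F.eval_rename_of_eval hP, F.comp_eq_zero_of_multiLT hf h0, zero_mul]
    exact F.multiLT_split (T μ) hvw hl _ (if_pos rfl) fun x hx => if_neg hx
  · intro u hu inst
    refine F.rename_perm hf hP _ fun x => F.swap_label ?_ x
    have hu' : F.row (T μ) u = v := by
      by_cases h : F.row (T μ) u = w
      · rw [hr, F.split_of_eq _ h] at hu; simp at hu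
      · rw [hr, F.split_of_ne _ h] at hu; simpa using hu
    have h1 : u.1 = v.1 := congrArg Sigma.fst hu'
    have h2 : l.1 = w.1 := congrArg Sigma.fst hl
    rw [h1, h2, hvw.1]

/-- The zero of order `i j - j` where two rows with linked labels coincide, for lengths
`j ≤ i`. -/
theorem lin_pow_dvd_of_linked (T : F.Tableaux μ)
    (hP : ∀ x : F.XVar m → ℂˣ,
      f x * (∏ v, (x v : ℂ)) ^ (F.κ * N) = eval (fun v => (x v : ℂ)) P)
    {v w : F.YVar μ} (hvw : v.1 ≠ w.1) (hlen : F.len w ≤ F.len v) {c : ℂ} (hc : c ≠ 0)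
    (h0 : ∀ i j : Fin (m v.1), i ≠ j → ∀ k : Fin (m w.1), ∀ x : F.XVar m → ℂˣ,
      (x ⟨v.1, i⟩ : ℂ) = x ⟨v.1, j⟩ → (x ⟨v.1, j⟩ : ℂ) = c * x ⟨w.1, k⟩ → f x = 0) :
    lin c v w ^ F.mixExp μ v w ∣ rename (F.row T) P := by
  classical
  have hexp : F.mixExp μ v w = (F.len v - 1) * F.len w := by
    rw [mixExp, minLen, min_eq_right hlen, Nat.sub_mul, one_mul]
  rw [hexp]
  refine F.dvd_of_forall_letters T hc fun l hl => ?_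
  have hne : v ≠ w := fun h => hvw (by rw [h])
  have hrl : F.split T w l = Sum.inr l := F.split_of_eq _ hl
  have hrow : ∀ k ∈ Finset.univ.filter (fun k => F.row T k = v), F.row T k = v := fun k hk =>
    (Finset.mem_filter.1 hk).2
  have hl1 : l.1 = w.1 := congrArg Sigma.fst hl
  have h := lin_pow_dvd_rename hc (m := l) (F.split T w) (Sum.inl v)
    (Finset.univ.filter fun k => F.row T k = v) (by simp [hl, hne.symm])
    (fun k hk => by rw [F.split_of_ne, hrow k hk]; rw [hrow k hk]; exact hne) P ?_
  · rwa [hrl, F.card_row T] at h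
  · intro k hk k' hk' hkk' x hx hx'
    have hk1 : k.1 = v.1 := congrArg Sigma.fst (hrow k hk)
    have hk1' : k'.1 = v.1 := congrArg Sigma.fst (hrow k' hk')
    have hkl : k ≠ l := by rintro rfl; exact hvw (hk1.symm.trans hl1)
    have hkl' : k' ≠ l := by rintro rfl; exact hvw (hk1'.symm.trans hl1)
    have key : subst c k l (subst c k' l P) = 0 := by
      refine poly_eq_zero_of_torus fun z => ?_
      set z' : F.XVar m → ℂˣ := Function.update (Function.update z k (Units.mk0 c hc * z l)) k'
        (Units.mk0 c hc * z l) with hz'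
      have hev : eval (fun v => (z v : ℂ)) (subst c k l (subst c k' l P)) =
          eval (fun v => (z' v : ℂ)) P := by
        rw [eval_subst, eval_subst]
        refine congrArg (fun x => eval x P) ?_
        funext u
        rcases eq_or_ne u k' with rfl | h1
        · simp [hz', hkl.symm]
        rcases eq_or_ne u k with rfl | h2
        · simp [hz', hkk']
        · simp [hz', h1, h2]
      rw [hev, ← hP]
      obtain ⟨a, k⟩ := k
      obtain ⟨a', k'⟩ := k'
      obtain ⟨b, l⟩ := l
      simp only at hk1 hk1' hl1
      subst hk1 hk1' hl1
      rw [h0 k k' (fun h => hkk' (by rw [h])) l z', zero_mul]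
      · simp [hz', hkk']
      · simp [hz', hkl.symm, hkl'.symm]
    have h4 := congrArg (eval x) key
    rw [eval_subst_of_eq hx, eval_subst_of_eq hx', map_zero] at h4
    exact h4

/-- Multiplication of the variables by constants. -/
noncomputable def mulVar {V : Type} (u : V → ℂ) : MvPolynomial V ℂ →ₐ[ℂ] MvPolynomial V ℂ :=
  aeval fun v => C (u v) * X v

theorem eval_mulVar {V : Type} (u y : V → ℂ) (Q : MvPolynomial V ℂ) :
    eval y (mulVar u Q) = eval (fun v => u v * y v) Q := by
  have : (eval y).comp (mulVar u : MvPolynomial V ℂ →+* MvPolynomial V ℂ) =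
      eval fun v => u v * y v := by
    apply MvPolynomial.ringHom_ext <;> simp [mulVar]
  exact congrArg (fun g : MvPolynomial V ℂ →+* ℂ => g Q) this

theorem root_pow_κ {u : F.YVar μ → ℂˣ} (hu : ∀ v, u v ^ F.t v.1 = 1) (v : F.YVar μ) :
    (u v : ℂ) ^ F.κ = 1 := by
  obtain ⟨d, hd⟩ := F.t_dvd_κ v.1
  rw [← Units.val_pow_eq_pow_val, hd, pow_mul, hu, one_pow, Units.val_one]

theorem mulVar_rename (hf : f ∈ F.laurent (F.xlab m))
    (hP : ∀ x : F.XVar m → ℂˣ,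
      f x * (∏ v, (x v : ℂ)) ^ (F.κ * N) = eval (fun v => (x v : ℂ)) P)
    (T : F.Tableaux μ) {u : F.YVar μ → ℂˣ} (hu : ∀ v, u v ^ F.t v.1 = 1) :
    mulVar (fun v => (u v : ℂ)) (rename (F.row T) P) = rename (F.row T) P := by
  refine poly_ext_of_torus fun y => ?_
  have h1 := F.eval_rename_of_eval hP (F.row T) (u * y)
  simp only [Pi.mul_apply, Units.val_mul] at h1
  rw [eval_mulVar, h1, F.eval_rename_of_eval hP]
  have h2 := F.laurent_invariant (F.xlab m) hf (fun v => u (F.row T v)) (fun v => hu (F.row T v))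
    fun v => y (F.row T v)
  have h3 : (∏ v : F.XVar m, (u (F.row T v) : ℂ)) ^ (F.κ * N) = 1 := by
    rw [← Finset.prod_pow]
    exact Finset.prod_eq_one fun v _ => by rw [pow_mul, F.root_pow_κ hu, one_pow]
  rw [Finset.prod_mul_distrib, mul_pow, h3, one_mul]
  exact congrArg (· * _) h2

theorem exists_root_k (hξ : IsPrimitiveRoot ξ F.κ) (a b : Fin F.r) :
    ∃ ζ : ℂ, IsPrimitiveRoot ζ (F.k a b) ∧ ∀ l < F.k a b, ζ ^ l = ξ ^ l := by
  have h : F.k a b = F.κ ∨ F.k a b = 1 := by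
    unfold k
    rcases max_choice (F.t a) (F.t b) with h | h <;> rw [h] <;> exact F.t_eq _
  rcases h with h | h
  · exact ⟨ξ, by rwa [h], fun _ _ => rfl⟩
  · rw [h]
    refine ⟨1, IsPrimitiveRoot.one, fun l hl => ?_⟩
    obtain rfl : l = 0 := by omega
    simp

/-- All the zeros of the evaluated numerator of an element of `Γ_μ`. -/
theorem yFactor_dvd (hκ : 0 < F.κ) (hξ : IsPrimitiveRoot ξ F.κ)
    (hsymm : ∀ a b, F.fold a b < 0 → F.fold b a < 0)
    (T : ∀ μ : F.MultiPartition m, F.Tableaux μ) (hf : f ∈ F.numerators m ξ)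
    (h0 : ∀ ν, F.multiLT μ ν → ∀ y : F.YVar ν → ℂˣ, f (fun v => y (F.row (T ν) v)) = 0)
    (hP : ∀ x : F.XVar m → ℂˣ,
      f x * (∏ v, (x v : ℂ)) ^ (F.κ * N) = eval (fun v => (x v : ℂ)) P) :
    F.yFactor μ X ∣ rename (F.row (T μ)) P := by
  classical
  have hmix : ∀ v w : F.YVar μ, v.1 ≠ w.1 → F.fold v.1 w.1 < 0 → F.len w ≤ F.len v →
      (X v ^ F.k v.1 w.1 - X w ^ F.k v.1 w.1) ^ F.mixExp μ v w ∣ rename (F.row (T μ)) P := by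
    intro v w hvw hfold hlen
    obtain ⟨ζ, hζ, hζξ⟩ := F.exists_root_k hξ v.1 w.1
    refine pow_sub_pow_pow_dvd (F.k_pos hκ _ _) hζ (fun h => hvw (by rw [h])) fun l hl => ?_
    refine F.lin_pow_dvd_of_linked (T μ) hP hvw hlen
      (pow_ne_zero _ (hζ.ne_zero (F.k_pos hκ _ _).ne')) ?_
    rw [hζξ l hl]
    exact F.numerator_vanish hf hfold l hl
  refine pairProd_dvd (fun _ _ => F.pairRel_asymm) (fun _ _ _ => F.k_pos hκ _ _) fun v w hvw => ?_
  rcases hvw with hvw | hvw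
  · rw [pairExp, if_pos hvw.1]
    simp only [ylab]
    rw [← hvw.1, k_self]
    obtain ⟨ζ, hζ⟩ := F.exists_root hκ hξ v.1
    have hne : v ≠ w := F.pairRel_ne (Or.inl hvw)
    refine pow_sub_pow_pow_dvd (F.t_pos hκ _) (IsPrimitiveRoot.coe_units_iff.2 hζ) hne
      fun l _ => ?_
    have h1 := F.lin_one_dvd T hf.1 h0 hP hvw
    set u : F.YVar μ → ℂˣ := Function.update 1 w (ζ ^ l) with hu
    have hu1 : ∀ v', u v' ^ F.t v'.1 = 1 := by
      intro v'
      rcases eq_or_ne v' w with rfl | h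
      · rw [hu, Function.update_self, ← hvw.1, ← pow_mul, mul_comm, pow_mul, hζ.pow_eq_one, one_pow]
      · simp [hu, h]
    have h2 := map_dvd (mulVar fun v => (u v : ℂ)) h1
    rw [F.mulVar_rename hf.1.1 hP (T μ) hu1, map_pow] at h2
    convert h2 using 2
    simp [mulVar, lin, hu, hne]
  · rw [pairExp, if_neg hvw.1.ne]
    simp only [ylab]
    rcases le_total (F.len w) (F.len v) with hlen | hlen
    · exact hmix v w hvw.1.ne hvw.2 hlen
    · have h1 := hmix w v hvw.1.ne' (hsymm _ _ hvw.2) hlen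
      have h2 : F.mixExp μ w v = F.mixExp μ v w := by
        simp only [mixExp, minLen, mul_comm, min_comm]
      rw [h2, k_comm] at h1
      rwa [← neg_sub, (Associated.refl _).neg_left.pow_pow.dvd_iff_dvd_left] at h1

theorem exists_perm_row_comp (T : F.Tableaux μ) (π : Equiv.Perm (F.YVar μ))
    (hπ : ∀ v, ((π v).1, (π v).2.1) = (v.1, v.2.1)) :
    ∃ σ : Equiv.Perm (F.XVar m), (∀ x, (σ x).1 = x.1) ∧ ∀ x, F.row T (σ x) = π (F.row T x) := by
  classical
  have h1 : ∀ v, (π v).1 = v.1 := fun v => congrArg Prod.fst (hπ v)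
  have h2 : ∀ v, (π v).2.1 = v.2.1 := fun v => congrArg Prod.snd (hπ v)
  obtain ⟨σ, hσ⟩ := exists_perm_of_card_fiber_eq (F.row T) (fun x => π (F.row T x)) (by
    intro u
    obtain ⟨u, rfl⟩ := π.surjective u
    simp only [π.injective.eq_iff]
    convert (F.card_row T (π u)).trans ((h2 u).trans (F.card_row T u).symm))
  refine ⟨σ, fun x => ?_, hσ⟩
  exact (congrArg Sigma.fst (hσ x)).trans (h1 _)

/-- The evaluation of a numerator of an element of `Γ_μ` is `yFactor` times a Laurent polynomial
with the symmetry of `μ`. -/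
theorem exists_eq_yFactor_mul (hκ : 0 < F.κ) (hξ : IsPrimitiveRoot ξ F.κ)
    (hsymm : ∀ a b, F.fold a b < 0 → F.fold b a < 0)
    (T : ∀ μ : F.MultiPartition m, F.Tableaux μ) (hf : f ∈ F.numerators m ξ)
    (h0 : ∀ ν, F.multiLT μ ν → ∀ y : F.YVar ν → ℂˣ, f (fun v => y (F.row (T ν) v)) = 0) :
    ∃ h ∈ F.symmLaurent (F.ylab μ) (fun v => (v.1, v.2.1)), ∀ y : F.YVar μ → ℂˣ,
      f (fun v => y (F.row (T μ) v)) = F.yFactor μ (fun v => (y v : ℂ)) * h y := by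
  classical
  obtain ⟨P, N, hP⟩ := F.exists_poly (F.xlab m) hκ hf.1.1
  obtain ⟨Q, hQ⟩ := F.yFactor_dvd hκ hξ hsymm T hf h0 hP
  have hDne := F.yFactor_X_ne_zero (μ := μ) hκ
  have hprod : ∀ y : F.YVar μ → ℂˣ, (∏ v, (y (F.row (T μ) v) : ℂ)) ^ (F.κ * N) =
      ∏ u, (y u : ℂ) ^ (F.len u * (F.κ * N)) := by
    intro y
    rw [F.prod_row (T μ) fun u => (y u : ℂ), ← Finset.prod_pow]
    simp only [pow_mul]
  have hprod0 : ∀ y : F.YVar μ → ℂˣ, ∏ u, (y u : ℂ) ^ (F.len u * (F.κ * N)) ≠ 0 := fun y =>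
    Finset.prod_ne_zero_iff.2 fun u _ => pow_ne_zero _ (y u).ne_zero
  set h : (F.YVar μ → ℂˣ) → ℂ := fun y => eval (fun v => (y v : ℂ)) Q /
    ∏ u, (y u : ℂ) ^ (F.len u * (F.κ * N)) with hh
  have hhQ : ∀ y, h y * ∏ u, (y u : ℂ) ^ (F.len u * (F.κ * N)) = eval (fun v => (y v : ℂ)) Q :=
    fun y => div_mul_cancel₀ _ (hprod0 y)
  have hfh : ∀ y : F.YVar μ → ℂˣ,
      f (fun v => y (F.row (T μ) v)) = F.yFactor μ (fun v => (y v : ℂ)) * h y := by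
    intro y
    have h1 := F.eval_rename_of_eval hP (F.row (T μ)) y
    rw [hQ, map_mul, eval_yFactor, hprod, ← hhQ, ← mul_assoc] at h1
    exact (mul_right_cancel₀ (hprod0 y) h1).symm
  have hlaur : h ∈ F.laurent (F.ylab μ) := by
    refine F.mem_laurent_of_invariant (F.ylab μ) hκ hξ hhQ fun u hu y => ?_
    have hinv : mulVar (fun v => (u v : ℂ)) Q = Q := by
      have h1 := F.mulVar_rename hf.1.1 hP (T μ) hu
      rw [hQ, map_mul] at h1
      have h2 : mulVar (fun v => (u v : ℂ)) (F.yFactor μ X) = F.yFactor μ X := by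
        refine MvPolynomial.funext fun y => ?_
        rw [eval_mulVar, eval_yFactor, eval_yFactor]
        refine F.yFactor_root hκ fun v => ?_
        rw [← Units.val_pow_eq_pow_val, hu, Units.val_one]
      rw [h2] at h1
      exact mul_left_cancel₀ hDne h1
    have h3 := eval_mulVar (fun v => (u v : ℂ)) (fun v => (y v : ℂ)) Q
    rw [hinv] at h3
    simp only [hh, Pi.mul_apply, Units.val_mul]
    rw [h3]
    congr 1
    refine Finset.prod_congr rfl fun v _ => ?_
    have h4 : (u v : ℂ) ^ (F.len v * (F.κ * N)) = 1 := by
      rw [mul_left_comm, pow_mul, F.root_pow_κ hu, one_pow]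
    rw [mul_pow, h4, one_mul]
  refine ⟨h, ⟨hlaur, fun π hπ y => ?_⟩, hfh⟩
  obtain ⟨σ, hσ1, hσ⟩ := F.exists_perm_row_comp (T μ) π hπ
  have h1 : ∀ v, (π v).1 = v.1 := fun v => congrArg Prod.fst (hπ v)
  have hcomp : (fun y : F.YVar μ → ℂˣ => h (y ∘ π)) ∈ F.laurent (F.ylab μ) :=
    F.comp_mem_laurentAlg (F.ylab μ) (F.ylab μ) π h1 hlaur
  have hz := F.laurent_eq_zero_of_dense (F.ylab μ) hκ (sub_mem hcomp hlaur) hDne (by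
    intro y hy
    rw [eval_yFactor] at hy
    have h2 := hfh (y ∘ π)
    have h3 : F.yFactor μ (fun v => ((y ∘ π) v : ℂ)) = F.yFactor μ (fun v => (y v : ℂ)) := by
      rw [yFactor_eq, yFactor_eq, F.yNum_perm μ π hπ]
      congr 1
      exact F.yMix_perm μ π hπ fun v => (y v : ℂ)
    have h4 : f (fun v => (y ∘ π) (F.row (T μ) v)) = f (fun v => y (F.row (T μ) v)) := by
      refine Eq.trans (congrArg f ?_) (hf.1.2 σ hσ1 fun v => y (F.row (T μ) v))
      funext x
      simp [hσ]
    rw [h4, hfh y, h3] at h2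
    exact sub_eq_zero.2 (mul_left_cancel₀ hy h2).symm)
  exact sub_eq_zero.1 (congrFun hz y)

/-- The evaluation map `φ_μ` sends `Γ_μ` to `ℋ̃[μ]`. -/
theorem φ_mem_Htilde (hκ : 0 < F.κ) (hξ : IsPrimitiveRoot ξ F.κ)
    (hsymm : ∀ a b, F.fold a b < 0 → F.fold b a < 0) (hdiag : ∀ a, 0 ≤ F.fold a a)
    (T : ∀ μ : F.MultiPartition m, F.Tableaux μ) {g : F.Reg (F.xlab m) → ℂ}
    (hg : g ∈ F.Γ ξ T μ) : F.φ (T μ) g ∈ F.Htilde μ := by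
  obtain ⟨⟨f, hf, rfl⟩, hker⟩ := hg
  have h0 : ∀ ν, F.multiLT μ ν → ∀ y : F.YVar ν → ℂˣ, f (fun v => y (F.row (T ν) v)) = 0 := by
    intro ν hν y
    have hk : F.φ (T ν) (F.mulRestrict (F.xlab m) (fun x => (F.xDenom m x.1)⁻¹) f) = 0 := by
      have := (Submodule.mem_iInf _).1 ((Submodule.mem_iInf _).1 hker ν) hν
      exact this
    have hlaur : (fun y : F.YVar ν → ℂˣ => f (y ∘ F.row (T ν))) ∈ F.laurent (F.ylab ν) :=
      F.comp_mem_laurentAlg (F.xlab m) (F.ylab ν) (F.row (T ν)) (fun _ => rfl) hf.1.1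
    have := F.laurent_eq_zero_of_reg (F.ylab ν) hκ hdiag hlaur fun y hy => by
      have h1 := congrFun hk ⟨y, hy⟩
      exact (mul_eq_zero.1 h1).resolve_left
        (inv_ne_zero (F.xDenom_ne_zero (F.substitute (T ν) ⟨y, hy⟩)))
    exact congrFun this y
  obtain ⟨h, hh, hfh⟩ := F.exists_eq_yFactor_mul hκ hξ hsymm T hf h0
  refine ⟨h, hh, ?_⟩
  ext y
  change F.yNum μ y.1 / F.yDenom μ y.1 * h y.1 =
    (F.xDenom m fun v => y.1 (F.row (T μ) v))⁻¹ * f fun v => y.1 (F.row (T μ) v)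
  rw [hfh, xDenom_row, yFactor_eq]
  have h1 := F.yMix_ne_zero y
  have h2 := F.yDenom_ne_zero y
  field_simp

end ImageHtilde

/-! ### Construction of numerators with prescribed evaluation -/

section Surjective

variable {m : Fin F.r → ℕ} {μ : F.MultiPartition m}

variable (μ) in
/-- The ways to put the letters into the boxes of `μ`, for each label. -/
abbrev Placement : Type := ∀ a : Fin F.r, Boxes (μ a).parts ≃ Fin (m a)

/-- The letter in the box of the row `v` and the column `c`, where the columns are counted
cyclically from `0`. -/
def cell (e : F.Placement μ) (v : F.YVar μ) (c : ℕ) : F.XVar m :=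
  ⟨v.1, e v.1 ⟨v.2, ⟨c % v.2.1, Nat.mod_lt _ (part_pos v.2)⟩⟩⟩

theorem exists_cell (e : F.Placement μ) (x : F.XVar m) :
    ∃ (v : F.YVar μ) (c : ℕ), v.1 = x.1 ∧ c < F.len v ∧ F.cell e v c = x := by
  obtain ⟨a, k⟩ := x
  set b := (e a).symm k with hb
  refine ⟨⟨a, b.1⟩, b.2.1, rfl, b.2.2, ?_⟩
  have h1 : (⟨b.1, ⟨b.2.1 % b.1.1, Nat.mod_lt _ (part_pos b.1)⟩⟩ : Boxes (μ a).parts) = b := by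
    refine Sigma.ext rfl (heq_of_eq (Fin.ext ?_))
    exact Nat.mod_eq_of_lt b.2.2
  change (⟨a, e a _⟩ : F.XVar m) = _
  rw [h1, hb, Equiv.apply_symm_apply]

open Classical in
/-- The factor that separates the rows with equal labels: a box `(w, c)` is separated from the box
`(v, c)` of the same column in a preceding row `v`, and from the cyclically next box of that
row. -/
noncomputable def rowFactor (e : F.Placement μ) (x : F.XVar m → ℂˣ) : ℂ :=
  ∏ v, ∏ w, if F.rowGT v w then ∏ c ∈ Finset.range (F.len w),
    (((x (F.cell e v c) : ℂ) ^ F.t v.1 - (x (F.cell e w c) : ℂ) ^ F.t v.1) *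
      ((x (F.cell e v (c + 1)) : ℂ) ^ F.t v.1 - (x (F.cell e w c) : ℂ) ^ F.t v.1)) else 1

open Classical in
/-- The factor that separates boxes with linked labels in different columns. -/
noncomputable def mixFactor (e : F.Placement μ) (x : F.XVar m → ℂˣ) : ℂ :=
  ∏ v, ∏ w, if F.linked v.1 w.1 then ∏ c ∈ Finset.range (F.len v), ∏ c' ∈ Finset.range (F.len w),
    (if c = c' then 1 else
      ((x (F.cell e v c) : ℂ) ^ F.k v.1 w.1 - (x (F.cell e w c') : ℂ) ^ F.k v.1 w.1)) else 1

/-- The contribution of a placement to the symmetrized numerator. -/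
noncomputable def term (h : (F.YVar μ → ℂˣ) → ℂ) (e : F.Placement μ) (x : F.XVar m → ℂˣ) : ℂ :=
  h (fun v => x (F.cell e v 0)) * F.rowFactor e x * F.mixFactor e x

open Classical in
/-- The numerator attached to a Laurent polynomial `h` in the variables of `μ`: the sum over all
placements of the letters in the boxes. -/
noncomputable def symNum (h : (F.YVar μ → ℂˣ) → ℂ) (x : F.XVar m → ℂˣ) : ℂ :=
  ∑ e : F.Placement μ, F.term h e x

variable {h : (F.YVar μ → ℂˣ) → ℂ}

theorem term_eq_zero_of_row {e : F.Placement μ} {x : F.XVar m → ℂˣ} {v w : F.YVar μ}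
    (hvw : F.rowGT v w) {c : ℕ} (hc : c < F.len w)
    (hx : x (F.cell e v c) = x (F.cell e w c) ∨ x (F.cell e v (c + 1)) = x (F.cell e w c)) :
    F.term h e x = 0 := by
  have : F.rowFactor e x = 0 := by
    refine Finset.prod_eq_zero (Finset.mem_univ v) (Finset.prod_eq_zero (Finset.mem_univ w) ?_)
    rw [if_pos hvw]
    refine Finset.prod_eq_zero (Finset.mem_range.2 hc) ?_
    rcases hx with hx | hx <;> simp [hx]
  rw [term, this, mul_zero, zero_mul]

theorem term_eq_zero_of_linked {e : F.Placement μ} {x : F.XVar m → ℂˣ} {v w : F.YVar μ}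
    (hvw : F.linked v.1 w.1) {c c' : ℕ} (hc : c < F.len v) (hc' : c' < F.len w) (hcc : c ≠ c')
    (hx : (x (F.cell e v c) : ℂ) ^ F.k v.1 w.1 = (x (F.cell e w c') : ℂ) ^ F.k v.1 w.1) :
    F.term h e x = 0 := by
  have : F.mixFactor e x = 0 := by
    refine Finset.prod_eq_zero (Finset.mem_univ v) (Finset.prod_eq_zero (Finset.mem_univ w) ?_)
    rw [if_pos hvw]
    refine Finset.prod_eq_zero (Finset.mem_range.2 hc)
      (Finset.prod_eq_zero (Finset.mem_range.2 hc') ?_)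
    rw [if_neg hcc, hx, sub_self]
  rw [term, this, mul_zero]

theorem prod_fun_mem {Ω ι : Type*} (A : Subalgebra ℂ (Ω → ℂ)) (s : Finset ι) {f : ι → Ω → ℂ}
    (hf : ∀ i ∈ s, f i ∈ A) : (fun x => ∏ i ∈ s, f i x) ∈ A := by
  have := A.prod_mem hf
  convert this using 1
  ext x
  rw [Finset.prod_apply]

theorem ite_fun_mem {Ω : Type*} (A : Subalgebra ℂ (Ω → ℂ)) (p : Prop) [Decidable p] {f : Ω → ℂ}
    (hf : p → f ∈ A) : (fun x => if p then f x else 1) ∈ A := by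
  by_cases hp : p
  · simpa only [if_pos hp] using hf hp
  · simp only [if_neg hp]; exact A.one_mem

theorem term_mem_laurent (hκ : 0 < F.κ) (hh : h ∈ F.laurent (F.ylab μ)) (e : F.Placement μ) :
    F.term h e ∈ F.laurentAlg (F.xlab m) := by
  classical
  have hpow : ∀ (v : F.YVar μ) (c n : ℕ), F.t v.1 ∣ n →
      (fun x : F.XVar m → ℂˣ => (x (F.cell e v c) : ℂ) ^ n) ∈ F.laurentAlg (F.xlab m) :=
    fun v c n hn => F.pow_mem_laurentAlg (F.xlab m) (F.cell e v c) hn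
  have hsub : ∀ (v w : F.YVar μ) (c c' n : ℕ), F.t v.1 ∣ n → F.t w.1 ∣ n →
      (fun x : F.XVar m → ℂˣ => (x (F.cell e v c) : ℂ) ^ n - (x (F.cell e w c') : ℂ) ^ n) ∈
        F.laurentAlg (F.xlab m) :=
    fun v w c c' n hn hn' => sub_mem (hpow v c n hn) (hpow w c' n hn')
  have h1 : (fun x : F.XVar m → ℂˣ => h (fun v => x (F.cell e v 0))) ∈ F.laurentAlg (F.xlab m) :=
    F.comp_mem_laurentAlg (F.ylab μ) (F.xlab m) (fun v => F.cell e v 0) (fun _ => rfl) hh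
  have h2 : F.rowFactor e ∈ F.laurentAlg (F.xlab m) :=
    prod_fun_mem _ _ fun v _ => prod_fun_mem _ _ fun w _ => ite_fun_mem _ _ fun hvw =>
      prod_fun_mem _ _ fun c _ => by
        have ht : F.t w.1 ∣ F.t v.1 := by rw [hvw.1]
        exact mul_mem (hsub v w c c _ dvd_rfl ht) (hsub v w (c + 1) c _ dvd_rfl ht)
  have h3 : F.mixFactor e ∈ F.laurentAlg (F.xlab m) :=
    prod_fun_mem _ _ fun v _ => prod_fun_mem _ _ fun w _ => ite_fun_mem _ _ fun _ =>
      prod_fun_mem _ _ fun c _ => prod_fun_mem _ _ fun c' _ => by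
        by_cases hcc : c = c'
        · simp only [if_pos hcc]; exact one_mem _
        · simp only [if_neg hcc]
          exact hsub v w c c' _ (F.t_dvd_k hκ _ _) (F.k_comm v.1 w.1 ▸ F.t_dvd_k hκ _ _)
  exact mul_mem (mul_mem h1 h2) h3

/-- A permutation of the letters that preserves the labels is a family of permutations. -/
theorem exists_perm_family (π : Equiv.Perm (F.XVar m)) (hπ : ∀ v, (π v).1 = v.1) :
    ∃ σ : ∀ a, Equiv.Perm (Fin (m a)), ∀ a k, π ⟨a, k⟩ = ⟨a, σ a k⟩ := by
  have h1 : ∀ a (k : Fin (m a)), ∃ k', π ⟨a, k⟩ = ⟨a, k'⟩ := by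
    intro a k
    have h2 : (π ⟨a, k⟩).1 = a := hπ ⟨a, k⟩
    revert h2
    rcases π ⟨a, k⟩ with ⟨b, k'⟩
    rintro rfl
    exact ⟨k', rfl⟩
  choose g hg using h1
  have hinj : ∀ a, Function.Injective (g a) := by
    intro a k k' hk
    have h2 : π ⟨a, k⟩ = π ⟨a, k'⟩ := by rw [hg, hg, hk]
    simpa using π.injective h2
  exact ⟨fun a => Equiv.ofBijective (g a) (Finite.injective_iff_bijective.1 (hinj a)), hg⟩

theorem symNum_perm (π : Equiv.Perm (F.XVar m)) (hπ : ∀ v, (π v).1 = v.1)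
    (x : F.XVar m → ℂˣ) : F.symNum h (x ∘ π) = F.symNum h x := by
  classical
  obtain ⟨σ, hσ⟩ := F.exists_perm_family π hπ
  set τ : F.Placement μ ≃ F.Placement μ :=
    Equiv.piCongrRight fun a => (Equiv.refl _).equivCongr (σ a) with hτ
  symm
  rw [symNum, symNum, ← Equiv.sum_comp τ]
  refine Finset.sum_congr rfl fun e _ => ?_
  have hcell : ∀ v c, F.cell (τ e) v c = π (F.cell e v c) := fun v c => (hσ _ _).symm
  simp only [term, rowFactor, mixFactor, hcell, Function.comp_apply]

/-- The vanishing conditions on numerators hold for each placement: of two boxes with the same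
label, either one lies in a different column from the box with the linked label, and `mixFactor`
vanishes, or all three lie in one column, and `rowFactor` vanishes. -/
theorem term_vanish (hsymm : ∀ a b, F.fold a b < 0 → F.fold b a < 0)
    (hdiag : ∀ a, 0 ≤ F.fold a a) (e : F.Placement μ) {a b : Fin F.r} (hab : F.fold a b < 0)
    {i j : Fin (m a)} (hij : i ≠ j) {k : Fin (m b)} {x : F.XVar m → ℂˣ}
    (h1 : (x ⟨a, i⟩ : ℂ) = x ⟨a, j⟩)
    (h2 : (x ⟨a, j⟩ : ℂ) ^ F.k a b = (x ⟨b, k⟩ : ℂ) ^ F.k a b) : F.term h e x = 0 := by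
  obtain ⟨v, c, hv, hc, hvc⟩ := F.exists_cell e ⟨a, i⟩
  obtain ⟨v', c', hv', hc', hvc'⟩ := F.exists_cell e ⟨a, j⟩
  obtain ⟨w, d, hw, hd, hwd⟩ := F.exists_cell e ⟨b, k⟩
  simp only at hv hv' hw
  have hne : a ≠ b := by rintro rfl; exact absurd hab (not_lt.2 (hdiag a))
  have key : ∀ (u : F.YVar μ) (c : ℕ), u.1 = a → c < F.len u → c ≠ d →
      (x (F.cell e u c) : ℂ) ^ F.k a b = (x (F.cell e w d) : ℂ) ^ F.k a b →
      F.term h e x = 0 := by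
    intro u c hu hc hcd hx
    rcases lt_or_gt_of_ne hne with hlt | hlt
    · refine F.term_eq_zero_of_linked (v := u) (w := w) ?_ hc hd hcd ?_
      · rw [hu, hw]; exact ⟨hlt, hab⟩
      · rw [hu, hw]; exact hx
    · refine F.term_eq_zero_of_linked (v := w) (w := u) ?_ hd hc hcd.symm ?_
      · rw [hu, hw]; exact ⟨hlt, hsymm _ _ hab⟩
      · rw [hu, hw, k_comm]; exact hx.symm
  by_cases hcd : c = d
  · by_cases hcd' : c' = d
    · subst hcd' hcd
      have hvv : v ≠ v' := by
        rintro rfl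
        exact hij (by simpa using hvc.symm.trans hvc')
      have hx : x (F.cell e v c) = x (F.cell e v' c) := by
        rw [hvc, hvc']; exact Units.ext h1
      rcases F.rowGT_or.2 ⟨hv.trans hv'.symm, hvv⟩ with hgt | hgt
      · exact F.term_eq_zero_of_row hgt hc' (Or.inl hx)
      · exact F.term_eq_zero_of_row hgt hc (Or.inl hx.symm)
    · exact key v' c' hv' hc' hcd' (by rw [hvc', hwd, h2])
  · exact key v c hv hc hcd (by rw [hvc, hwd, h1, h2])

theorem symNum_mem_numerators (hκ : 0 < F.κ) {ξ : ℂ} (hξ : IsPrimitiveRoot ξ F.κ)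
    (hsymm : ∀ a b, F.fold a b < 0 → F.fold b a < 0) (hdiag : ∀ a, 0 ≤ F.fold a a)
    (hh : h ∈ F.laurent (F.ylab μ)) : F.symNum h ∈ F.numerators m ξ := by
  classical
  refine ⟨⟨?_, fun π hπ x => F.symNum_perm π hπ x⟩, ?_, ?_⟩
  · have h1 : ∑ e : F.Placement μ, F.term h e ∈ F.laurentAlg (F.xlab m) :=
      sum_mem fun e _ => F.term_mem_laurent hκ hh e
    rw [mem_laurentAlg] at h1
    convert h1 using 1
    ext x
    rw [Finset.sum_apply, symNum]
  · intro a b hab i j hij k x h1 h2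
    exact Finset.sum_eq_zero fun e _ => F.term_vanish hsymm hdiag e hab hij h1 (by rw [h2])
  · intro a b hab hk i j hij k l _ _ x h1 h2
    refine Finset.sum_eq_zero fun e _ => F.term_vanish hsymm hdiag e hab hij (k := k) h1 ?_
    have hk' : F.k a b = F.κ := hk
    rw [h2, mul_pow, hk', ← pow_mul, mul_comm l, pow_mul, hξ.pow_eq_one, one_pow, one_mul]

/-! ### Evaluation of the constructed numerators -/

section Evaluate

variable {ν : F.MultiPartition m} (T : F.Tableaux ν)

/-- The row of a tableau that contains the letter in a given box. -/
def boxRow (e : F.Placement μ) (a : Fin F.r) (b : Boxes (μ a).parts) : (ν a).parts.ToType :=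
  (T a (e a b)).1

theorem card_boxRow (e : F.Placement μ) (a : Fin F.r) (n : (ν a).parts.ToType)
    [DecidablePred fun b => F.boxRow T e a b = n] :
    (Finset.univ.filter fun b => F.boxRow T e a b = n).card = n.1 := by
  classical
  rw [← card_filter_row (T a) n]
  refine Finset.card_equiv (e a) fun b => ?_
  rw [Finset.mem_filter, Finset.mem_filter]
  exact and_congr (by simp) Iff.rfl

theorem row_cell (e : F.Placement μ) {a : Fin F.r} (b : Boxes (μ a).parts) {c : ℕ}
    (hc : b.2.1 = c % b.1.1) :
    F.row T (F.cell e (⟨a, b.1⟩ : F.YVar μ) c) = ⟨a, F.boxRow T e a b⟩ := by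
  have h1 : (⟨b.1, ⟨c % b.1.1, Nat.mod_lt _ (part_pos b.1)⟩⟩ : Boxes (μ a).parts) = b :=
    Sigma.ext rfl (heq_of_eq (Fin.ext hc.symm))
  change (⟨a, (T a (e a ⟨b.1, ⟨c % b.1.1, _⟩⟩)).1⟩ : F.YVar ν) = _
  rw [h1, boxRow]

/-- If a placement contributes to an evaluation, then no two boxes of a column go to one row. -/
theorem boxRow_col {e : F.Placement μ} {y : F.YVar ν → ℂˣ}
    (hne : F.term h e (fun v => y (F.row T v)) ≠ 0) (a : Fin F.r) (b b' : Boxes (μ a).parts)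
    (hbb : b.2.1 = b'.2.1) (hrow : F.boxRow T e a b = F.boxRow T e a b') : b = b' := by
  by_contra hcon
  have hne' : b.1 ≠ b'.1 := by
    intro h1
    refine hcon (Sigma.ext h1 ((Fin.heq_ext_iff (by rw [h1])).2 hbb))
  have key : ∀ b b' : Boxes (μ a).parts, b.2.1 = b'.2.1 →
      F.boxRow T e a b = F.boxRow T e a b' → ¬ partGT b.1 b'.1 := by
    intro b b' hbb hrow hgt
    refine hne (F.term_eq_zero_of_row (F.rowGT_mk.2 hgt) b'.2.2 (Or.inl ?_))
    rw [F.row_cell T e b' (Nat.mod_eq_of_lt b'.2.2).symm, ← hbb,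
      F.row_cell T e b (Nat.mod_eq_of_lt b.2.2).symm, hrow]
  rcases partGT_trichotomy b.1 b'.1 with h1 | h1 | h1
  · exact key b b' hbb hrow h1
  · exact hne' h1
  · exact key b' b hbb.symm hrow.symm h1

theorem boxRow_next {e : F.Placement μ} {y : F.YVar ν → ℂˣ}
    (hne : F.term h e (fun v => y (F.row T v)) ≠ 0) (a : Fin F.r) (b b' : Boxes (μ a).parts)
    (hgt : partGT b.1 b'.1) (hbb : b.2.1 = (b'.2.1 + 1) % b.1.1) :
    F.boxRow T e a b ≠ F.boxRow T e a b' := by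
  intro hrow
  refine hne (F.term_eq_zero_of_row (F.rowGT_mk.2 hgt) b'.2.2 (Or.inr ?_))
  rw [F.row_cell T e b' (Nat.mod_eq_of_lt b'.2.2).symm, F.row_cell T e b hbb, hrow]

/-- The constructed numerators vanish under the evaluations at greater multipartitions. -/
theorem term_eval_eq_zero (hlt : F.multiLT μ ν) (e : F.Placement μ) (y : F.YVar ν → ℂˣ) :
    F.term h e (fun v => y (F.row T v)) = 0 := by
  classical
  by_contra hne
  obtain ⟨a, _, ha⟩ := hlt
  obtain ⟨i, hi, _⟩ := exists_excess_lt_of_partitionLT ha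
  have h1 := excess_le_of_filling (ψ := F.boxRow T e a) (fun n => F.card_boxRow T e a n)
    (F.boxRow_col T hne a) i
  omega

end Evaluate

theorem prod_offdiag (i j : ℕ) (z : ℂ) :
    ∏ c ∈ Finset.range i, ∏ c' ∈ Finset.range j, (if c = c' then 1 else z) =
      z ^ (i * j - min i j) := by
  rw [← Finset.prod_product', Finset.prod_ite, Finset.prod_const_one, one_mul, Finset.prod_const]
  congr 1
  have h1 := Finset.card_filter_add_card_filter_not (s := Finset.range i ×ˢ Finset.range j)
    (fun p => p.1 = p.2)
  rw [Finset.card_product, Finset.card_range, Finset.card_range] at h1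
  have h2 : ((Finset.range i ×ˢ Finset.range j).filter fun p => p.1 = p.2).card = min i j := by
    rw [← Finset.card_range (min i j)]
    refine (Finset.card_nbij' (fun c => (c, c)) Prod.fst ?_ ?_ ?_ ?_).symm
    · intro c hc; simpa using hc
    · intro p hp; simp at hp; simp; omega
    · intro c _; rfl
    · rintro ⟨c, c'⟩ hp; simp at hp; simp [hp.2]
  omega

/-- The value of a contribution in which all rows are constant. -/
theorem term_of_rows {e : F.Placement μ} {x : F.XVar m → ℂˣ} {z : F.YVar μ → ℂˣ}
    (hx : ∀ v c, x (F.cell e v c) = z v) :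
    F.term h e x = h z * F.yNum μ z * F.yMix μ (fun v => (z v : ℂ)) := by
  classical
  have h1 : F.rowFactor e x = F.yNum μ z := by
    rw [yNum_eq]
    refine Finset.prod_congr rfl fun v _ => Finset.prod_congr rfl fun w _ => ?_
    by_cases hvw : F.rowGT v w
    · rw [if_pos hvw, if_pos hvw]
      simp only [hx, Finset.prod_const, Finset.card_range]
      have hk : F.kexp (F.ylab μ) v w = F.t v.1 := by
        simp only [kexp, ylab]; rw [← hvw.1, k_self]
      have hmin : F.minLen v w = F.len w := by
        refine min_eq_right ?_
        rcases hvw.2 with h | h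
        · exact h.le
        · exact h.1.ge
      rw [hk, Pi.mul_apply, Pi.mul_apply, hmin, Pi.ofNat_apply, Pi.ofNat_apply, pow_mul, pow_two]
    · rw [if_neg hvw, if_neg hvw]
  have h2 : F.mixFactor e x = F.yMix μ (fun v => (z v : ℂ)) := by
    refine Finset.prod_congr rfl fun v _ => Finset.prod_congr rfl fun w _ => ?_
    by_cases hvw : F.linked v.1 w.1
    · rw [if_pos hvw, if_pos hvw]
      simp only [hx]
      exact prod_offdiag _ _ _
    · rw [if_neg hvw, if_neg hvw]
  rw [term, h1, h2]
  simp only [hx]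

/-- Each placement contributes to the evaluation at `μ` either nothing, or the prescribed
function. -/
theorem term_eval (T : F.Tableaux μ) (hh : h ∈ F.symmLaurent (F.ylab μ) (fun v => (v.1, v.2.1)))
    (e : F.Placement μ) :
    ∃ ε : ℕ, ((∀ a, e a = (T a).symm) → ε = 1) ∧ ∀ y : F.YVar μ → ℂˣ,
      F.term h e (fun v => y (F.row T v)) =
        ε * (h y * F.yNum μ y * F.yMix μ (fun v => (y v : ℂ))) := by
  classical
  by_cases he : ∀ a, e a = (T a).symm
  · refine ⟨1, fun _ => rfl, fun y => ?_⟩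
    rw [Nat.cast_one, one_mul]
    refine F.term_of_rows fun v c => ?_
    change y ⟨v.1, (T v.1 (e v.1 _)).1⟩ = y v
    rw [he, Equiv.apply_symm_apply]
  by_cases hz : ∀ y : F.YVar μ → ℂˣ, F.term h e (fun v => y (F.row T v)) = 0
  · exact ⟨0, fun h1 => absurd h1 he, fun y => by rw [hz]; simp⟩
  push Not at hz
  obtain ⟨y₀, hy₀⟩ := hz
  have hrigid := fun a => filling_rigid (ψ := F.boxRow T e a) (fun p => part_pos p)
    (fun n => F.card_boxRow T e a n) (F.boxRow_col T hy₀ a) (F.boxRow_next T hy₀ a)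
  choose ρ hρ hψ using hrigid
  set π : Equiv.Perm (F.YVar μ) := Equiv.sigmaCongrRight ρ with hπ
  have hπ' : ∀ v : F.YVar μ, ((π v).1, (π v).2.1) = (v.1, v.2.1) := fun v =>
    Prod.ext rfl (hρ v.1 v.2)
  refine ⟨1, fun _ => rfl, fun y => ?_⟩
  rw [F.term_of_rows (z := y ∘ π), hh.2 π hπ' y, F.yNum_perm μ π hπ', Nat.cast_one, one_mul]
  · congr 1
    exact F.yMix_perm μ π hπ' fun v => (y v : ℂ)
  · rintro ⟨a, p⟩ c
    have h1 := F.row_cell T e (⟨p, ⟨c % p.1, Nat.mod_lt _ (part_pos p)⟩⟩ : Boxes (μ a).parts)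
      (c := c) rfl
    simp only at h1
    rw [h1, hψ]
    rfl

/-- The evaluation map `φ_μ` maps `Γ_μ` onto `ℋ̃[μ]`. -/
theorem exists_φ_eq (hκ : 0 < F.κ) {ξ : ℂ} (hξ : IsPrimitiveRoot ξ F.κ)
    (hsymm : ∀ a b, F.fold a b < 0 → F.fold b a < 0) (hdiag : ∀ a, 0 ≤ F.fold a a)
    (T : ∀ μ : F.MultiPartition m, F.Tableaux μ) {H : F.H μ} (hH : H ∈ F.Htilde μ) :
    ∃ g ∈ F.Γ ξ T μ, F.φ (T μ) g = H := by
  classical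
  obtain ⟨h, hh, rfl⟩ := hH
  choose ε hε1 hε using F.term_eval (T μ) hh
  -- the number of placements that contribute; it is positive because of the tableau itself
  set M : ℕ := ∑ e, ε e with hM
  have hM0 : (M : ℂ) ≠ 0 := by
    have h1 : ε (fun a => (T μ a).symm) ≤ M :=
      Finset.single_le_sum (f := ε) (fun _ _ => Nat.zero_le _) (Finset.mem_univ _)
    rw [hε1 _ fun a => rfl] at h1
    exact Nat.cast_ne_zero.2 (by omega)
  have heval : ∀ y : F.YVar μ → ℂˣ, F.symNum h (fun v => y (F.row (T μ) v)) =
      M * (h y * F.yNum μ y * F.yMix μ (fun v => (y v : ℂ))) := by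
    intro y
    rw [hM, Nat.cast_sum, Finset.sum_mul]
    exact Finset.sum_congr rfl fun e _ => hε e y
  refine ⟨F.mulRestrict (F.xlab m) (fun x => (F.xDenom m x.1)⁻¹) ((M : ℂ)⁻¹ • F.symNum h),
    ⟨⟨_, Submodule.smul_mem _ _ (F.symNum_mem_numerators hκ hξ hsymm hdiag hh.1), rfl⟩, ?_⟩, ?_⟩
  · refine (Submodule.mem_iInf _).2 fun ν => (Submodule.mem_iInf _).2 fun hν => ?_
    rw [LinearMap.mem_ker]
    ext y
    change (F.xDenom m _)⁻¹ * ((M : ℂ)⁻¹ * F.symNum h fun v => y.1 (F.row (T ν) v)) = 0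
    have : F.symNum h (fun v => y.1 (F.row (T ν) v)) = 0 :=
      Finset.sum_eq_zero fun e _ => F.term_eval_eq_zero (T ν) hν e y.1
    rw [this, mul_zero, mul_zero]
  · ext y
    change (F.xDenom m fun v => y.1 (F.row (T μ) v))⁻¹ *
      ((M : ℂ)⁻¹ * F.symNum h fun v => y.1 (F.row (T μ) v)) =
        F.yNum μ y.1 / F.yDenom μ y.1 * h y.1
    rw [heval, xDenom_row]
    have h1 := F.yMix_ne_zero y
    have h2 := F.yDenom_ne_zero y
    field_simp

end Surjective
end Folding

/-! ### The folded Cartan matrices -/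

theorem folding_κ_pos (X : TwistedType) : 0 < X.folding.κ := by
  cases X <;> simp [TwistedType.folding]

/-- The Cartan matrix of type `C_r`; the last root is the long one. -/
theorem fold_A2 (r : ℕ) (hr : 2 ≤ r) (a b : Fin r) :
    Folding.fold (TwistedType.A2 r hr).folding a b =
      if a.1 + 1 = r then (if a = b then 2 else if b.1 + 1 = a.1 then -1 else 0)
      else if a = b then 2 else if a.1 + 1 = b.1 then (if b.1 + 1 = r then -2 else -1)
      else if b.1 + 1 = a.1 then -1 else 0 := by
  have ha := a.2
  have hb := b.2
  have hle : r ≤ 2 * r - 1 := by omega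
  have hv : (Fin.revPerm (Fin.castLE hle a)).1 = 2 * r - 2 - a.1 := by
    rw [Fin.revPerm_apply, Fin.val_rev, Fin.val_castLE]; omega
  change (if Fin.revPerm (Fin.castLE hle a) = Fin.castLE hle a then
      CartanMatrix.A (2 * r - 1) (Fin.castLE hle a) (Fin.castLE hle b)
    else ∑ k ∈ Finset.range 2,
      CartanMatrix.A (2 * r - 1) ((Fin.revPerm ^ k) (Fin.castLE hle a)) (Fin.castLE hle b)) = _
  rw [Finset.sum_range_succ, Finset.sum_range_one, pow_zero, pow_one, Equiv.Perm.one_apply]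
  simp only [CartanMatrix.A, Matrix.of_apply, Fin.ext_iff, hv, Fin.val_castLE]
  split_ifs <;> omega

/-- The Cartan matrix of type `B_r`; the last root is the short one. -/
theorem fold_D2 (r : ℕ) (hr : 2 ≤ r) (a b : Fin r) :
    Folding.fold (TwistedType.D2 r hr).folding a b =
      if a.1 + 1 = r then (if a = b then 2 else if b.1 + 1 = a.1 then -2 else 0)
      else if a = b then 2 else if a.1 + 1 = b.1 ∨ b.1 + 1 = a.1 then -1 else 0 := by
  have ha := a.2
  have hb := b.2
  have h1 : r - 1 < r + 1 := by omega
  have h2 : r < r + 1 := by omega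
  have hv : (Equiv.swap (⟨r - 1, h1⟩ : Fin (r + 1)) ⟨r, h2⟩ a.castSucc).1 =
      if a.1 + 1 = r then r else a.1 := by
    rw [Equiv.swap_apply_def]
    simp only [Fin.ext_iff, Fin.val_castSucc]
    split_ifs <;> simp <;> omega
  change (if Equiv.swap (⟨r - 1, h1⟩ : Fin (r + 1)) ⟨r, h2⟩ a.castSucc = a.castSucc then
      CartanMatrix.D (r + 1) a.castSucc b.castSucc
    else ∑ k ∈ Finset.range 2, CartanMatrix.D (r + 1)
      (((Equiv.swap (⟨r - 1, h1⟩ : Fin (r + 1)) ⟨r, h2⟩) ^ k) a.castSucc) b.castSucc) = _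
  rw [Finset.sum_range_succ, Finset.sum_range_one, pow_zero, pow_one, Equiv.Perm.one_apply]
  by_cases h : a.1 + 1 = r
  · rw [if_pos h] at hv
    simp only [CartanMatrix.D, Matrix.of_apply, Fin.ext_iff, hv, Fin.val_castSucc,
      or_true, and_true]
    split_ifs <;> omega
  · rw [if_neg h] at hv
    simp only [CartanMatrix.D, Matrix.of_apply, Fin.ext_iff, hv, Fin.val_castSucc, if_true]
    split_ifs <;> omega

theorem fold_neg_symm (X : TwistedType) :
    ∀ a b, X.folding.fold a b < 0 → X.folding.fold b a < 0 := by
  cases X with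
  | A2 r hr =>
    intro (a : Fin r) (b : Fin r)
    rw [fold_A2, fold_A2]
    simp only [Fin.ext_iff]
    split_ifs <;> omega
  | D2 r hr =>
    intro (a : Fin r) (b : Fin r)
    rw [fold_D2, fold_D2]
    simp only [Fin.ext_iff]
    split_ifs <;> omega
  | E62 => decide
  | D43 => decide

theorem fold_diag_nonneg (X : TwistedType) : ∀ a, 0 ≤ X.folding.fold a a := by
  cases X with
  | A2 r hr => intro (a : Fin r); rw [fold_A2]; simp
  | D2 r hr => intro (a : Fin r); rw [fold_D2]; simp
  | E62 => decide
  | D43 => decide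

namespace Folding

variable (F : Folding)

/-! ### Rescaling of the function spaces -/

section Rescale

variable {V : Type} [Fintype V] (ℓ : V → Fin F.r)

theorem monomial_scale (n : V → ℤ) (c : ℂˣ) (x : V → ℂˣ) :
    ∏ v, ((c * x v : ℂˣ) : ℂ) ^ ((F.t (ℓ v) : ℤ) * n v) =
      (c : ℂ) ^ (∑ v, (F.t (ℓ v) : ℤ) * n v) * ∏ v, (x v : ℂ) ^ ((F.t (ℓ v) : ℤ) * n v) := by
  rw [zpow_finset_sum c.ne_zero, ← Finset.prod_mul_distrib]
  exact Finset.prod_congr rfl fun v _ => by rw [Units.val_mul, mul_zpow]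

theorem laurent_scale (c : ℂˣ) {f : (V → ℂˣ) → ℂ} (hf : f ∈ F.laurent ℓ) :
    (fun x : V → ℂˣ => f fun v => c * x v) ∈ F.laurent ℓ := by
  have h : F.laurent ℓ ≤ (F.laurent ℓ).comap
      (LinearMap.funLeft ℂ ℂ fun (x : V → ℂˣ) v => c * x v) := by
    refine Submodule.span_le.2 ?_
    rintro _ ⟨n, rfl⟩
    have := Submodule.smul_mem _ ((c : ℂ) ^ (∑ v, (F.t (ℓ v) : ℤ) * n v))
      (F.monomial_mem_laurent ℓ n)
    refine Submodule.mem_comap.2 ?_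
    convert this using 1
    ext x
    exact F.monomial_scale ℓ n c x
  exact h hf

/-- A Laurent polynomial times a homogeneous function is a sum of homogeneous functions. -/
theorem mulRestrict_mem_iSup_homog {p : F.Reg ℓ → ℂ} {d : ℤ} (hp : p ∈ F.homog ℓ d)
    {f : (V → ℂˣ) → ℂ} (hf : f ∈ F.laurent ℓ) :
    F.mulRestrict ℓ p f ∈ ⨆ d, F.homog ℓ d := by
  have h : F.laurent ℓ ≤ (⨆ d, F.homog ℓ d).comap (F.mulRestrict ℓ p) := by
    refine Submodule.span_le.2 ?_
    rintro _ ⟨n, rfl⟩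
    refine Submodule.mem_iSup_of_mem (d + ∑ v, (F.t (ℓ v) : ℤ) * n v) fun c x => ?_
    change p (F.scale ℓ c x) * ∏ v, ((c * x.1 v : ℂˣ) : ℂ) ^ ((F.t (ℓ v) : ℤ) * n v) =
      _ * (p x * ∏ v, (x.1 v : ℂ) ^ ((F.t (ℓ v) : ℤ) * n v))
    rw [monomial_scale, hp c x, zpow_add₀ c.ne_zero]
    ring
  exact h hf

end Rescale

variable {m : Fin F.r → ℕ}

theorem xDenom_inv_homog : ∃ d : ℤ,
    (fun x : F.Reg (F.xlab m) => (F.xDenom m x.1)⁻¹) ∈ F.homog (F.xlab m) d := by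
  obtain ⟨d, hd⟩ := pairProd_scale (R := ℂ) (fun v w : F.XVar m => F.linked v.1 w.1)
    (F.kexp (F.xlab m)) 1
  refine ⟨-d, fun c x => ?_⟩
  simp only [xDenom_eq, scale, Units.val_mul]
  rw [hd, mul_inv, zpow_neg, zpow_natCast]

theorem numerators_scale {ξ : ℂ} (c : ℂˣ) {f : (F.XVar m → ℂˣ) → ℂ} (hf : f ∈ F.numerators m ξ) :
    (fun x : F.XVar m → ℂˣ => f fun v => c * x v) ∈ F.numerators m ξ := by
  refine ⟨⟨F.laurent_scale _ c hf.1.1, fun π hπ x => hf.1.2 π hπ fun v => c * x v⟩, ?_, ?_⟩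
  · intro a b h i j hij k x h1 h2
    refine hf.2.1 a b h i j hij k _ ?_ ?_ <;> simp [h1, h2]
  · intro a b h hm i j hij k l hl hl' x h1 h2
    refine hf.2.2 a b h hm i j hij k l hl hl' _ ?_ ?_
    · simp [h1]
    · rw [Units.val_mul, Units.val_mul, h2, mul_left_comm]

theorem U_scale {ξ : ℂ} (c : ℂˣ) {g : F.Reg (F.xlab m) → ℂ} (hg : g ∈ F.U m ξ) :
    F.scaleOp (F.xlab m) c g ∈ F.U m ξ := by
  obtain ⟨f, hf, rfl⟩ := hg
  obtain ⟨d, hd⟩ := F.xDenom_inv_homog (m := m)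
  refine ⟨(c : ℂ) ^ d • fun x => f fun v => c * x v,
    Submodule.smul_mem _ _ (F.numerators_scale c hf), ?_⟩
  ext x
  have h := hd c x
  change (F.xDenom m x.1)⁻¹ * ((c : ℂ) ^ d * f fun v => c * x.1 v) =
    (F.xDenom m (F.scale (F.xlab m) c x).1)⁻¹ * f fun v => c * x.1 v
  simp only at h
  rw [h]
  ring

theorem U_le_iSup_homog (ξ : ℂ) : F.U m ξ ≤ ⨆ d, F.homog (F.xlab m) d := by
  rintro _ ⟨f, hf, rfl⟩
  obtain ⟨d, hd⟩ := F.xDenom_inv_homog (m := m)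
  exact F.mulRestrict_mem_iSup_homog _ hd hf.1.1

variable {μ : F.MultiPartition m} (ξ : ℂ) (T : ∀ μ : F.MultiPartition m, F.Tableaux μ)

theorem φ_scale (c : ℂˣ) (T : F.Tableaux μ) (g : F.Reg (F.xlab m) → ℂ) :
    F.φ T (F.scaleOp (F.xlab m) c g) = F.scaleOp (F.ylab μ) c (F.φ T g) := rfl

theorem φ_homog (T : F.Tableaux μ) {d : ℤ} {g : F.Reg (F.xlab m) → ℂ}
    (hg : g ∈ F.homog (F.xlab m) d) : F.φ T g ∈ F.homog (F.ylab μ) d :=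
  fun c y => hg c (F.substitute T y)

theorem mem_Γ {g : F.Reg (F.xlab m) → ℂ} :
    g ∈ F.Γ ξ T μ ↔ g ∈ F.U m ξ ∧ ∀ ν, F.multiLT μ ν → F.φ (T ν) g = 0 := by
  simp [Γ, Submodule.mem_iInf]

theorem mem_Γ' {g : F.Reg (F.xlab m) → ℂ} :
    g ∈ F.Γ' ξ T μ ↔ g ∈ F.U m ξ ∧ ∀ ν, F.multiLT μ ν ∨ μ = ν → F.φ (T ν) g = 0 := by
  simp only [Γ', Submodule.mem_inf, Submodule.mem_iInf, LinearMap.mem_ker]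

theorem mem_Γ'_iff {g : F.Reg (F.xlab m) → ℂ} :
    g ∈ F.Γ' ξ T μ ↔ g ∈ F.Γ ξ T μ ∧ F.φ (T μ) g = 0 := by
  rw [mem_Γ', mem_Γ]
  refine ⟨fun h => ⟨⟨h.1, fun ν hν => h.2 ν (Or.inl hν)⟩, h.2 μ (Or.inr rfl)⟩, fun h =>
    ⟨h.1.1, ?_⟩⟩
  rintro ν (hν | rfl)
  exacts [h.1.2 ν hν, h.2]

/-- Each `Γ_μ` is the sum of its homogeneous components. -/
theorem iSup_homog_Γ (μ : F.MultiPartition m) :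
    ⨆ d, (F.homog (F.xlab m) d).submoduleOf (F.Γ ξ T μ) = ⊤ := by
  refine F.graded_of_scale_stable _ _ (fun f hf => ?_)
    (inf_le_left.trans (F.U_le_iSup_homog ξ))
  rw [mem_Γ] at hf ⊢
  exact ⟨F.U_scale _ hf.1, fun ν hν => by rw [φ_scale, hf.2 ν hν, map_zero]⟩

theorem iSup_quotDeg (W : Submodule ℂ (F.Reg (F.xlab m) → ℂ)) (μ : F.MultiPartition m) :
    ⨆ d, F.quotDeg ξ T W μ d = ⊤ := by
  simp only [quotDeg, ← Submodule.map_iSup, iSup_homog_Γ, Submodule.map_top,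
    Submodule.range_mkQ]

theorem iSup_grDeg : ⨆ d, F.grDeg ξ T d = ⊤ := by
  classical
  simp only [grDeg]
  rw [iSup_comm]
  simp only [← Submodule.map_iSup, iSup_quotDeg, Submodule.map_top]
  exact DFinsupp.iSup_range_lsingle

theorem iSupIndep_HtildeDeg (μ : F.MultiPartition m) : iSupIndep (F.HtildeDeg μ) :=
  iSupIndep_of_injective_of_eigen (F.Htilde μ).subtype Subtype.val_injective
    (F.scaleOp (F.ylab μ) (Units.mk0 2 two_ne_zero)) _ fun _ _ hf => F.scaleOp_homog _ hf _

theorem iSupIndep_sumHtildeDeg (m : Fin F.r → ℕ) : iSupIndep (F.sumHtildeDeg m) := by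
  classical
  -- the direct sum embeds into the product of the function spaces, where rescaling acts
  -- componentwise
  let i : (DirectSum (F.MultiPartition m) fun μ => F.Htilde μ) →ₗ[ℂ] ∀ μ : F.MultiPartition m, F.H μ :=
    LinearMap.pi fun μ => (F.Htilde μ).subtype ∘ₗ DirectSum.component ℂ _ _ μ
  have hi : Function.Injective i := fun u v h =>
    DFinsupp.ext fun μ => Subtype.ext (congrFun h μ)
  let S : (∀ μ : F.MultiPartition m, F.H μ) →ₗ[ℂ] ∀ μ : F.MultiPartition m, F.H μ :=
    LinearMap.pi fun μ => F.scaleOp (F.ylab μ) (Units.mk0 2 two_ne_zero) ∘ₗ LinearMap.proj μ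
  refine iSupIndep_of_injective_of_eigen i hi S _ fun d f hf => ?_
  have hle : F.sumHtildeDeg m d ≤ LinearMap.eqLocus (S ∘ₗ i) ((2 : ℂ) ^ d • i) := by
    refine iSup_le fun μ => ?_
    rintro _ ⟨g, hg, rfl⟩
    funext ν
    change F.scaleOp (F.ylab ν) _ (DirectSum.lof ℂ (F.MultiPartition m)
      (fun μ => F.Htilde μ) μ g ν).1 = (2 : ℂ) ^ d • (DirectSum.lof ℂ (F.MultiPartition m)
      (fun μ => F.Htilde μ) μ g ν).1
    by_cases h : μ = ν
    · subst h
      rw [DirectSum.lof_apply]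
      exact F.scaleOp_homog _ hg _
    · have : DirectSum.lof ℂ (F.MultiPartition m) (fun μ => F.Htilde μ) μ g ν = 0 :=
        DFinsupp.single_eq_of_ne (Ne.symm h)
      rw [this]
      simp
  exact hle hf

/-! ### The filtration steps -/

/-- The multipartition into parts equal to `1`. -/
def ones (m : Fin F.r → ℕ) : F.MultiPartition m := fun a =>
  { parts := Multiset.replicate (m a) 1
    parts_pos := fun h => by rw [Multiset.eq_of_mem_replicate h]; exact one_pos
    parts_sum := by simp }

theorem φ_ones_injective (T : F.Tableaux (F.ones m)) : Function.Injective (F.φ T) := by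
  have hone : ∀ (a : Fin F.r) (p : ((F.ones m) a).parts.ToType), p.1 = 1 := fun a p =>
    Multiset.eq_of_mem_replicate (Multiset.coe_mem (x := p))
  have hrow : Function.Bijective (F.row T) := by
    constructor
    · rintro ⟨a, i⟩ ⟨b, j⟩ h
      obtain rfl : a = b := congrArg Sigma.fst h
      have h1 : (T a i).1 = (T a j).1 := eq_of_heq (Sigma.mk.inj_iff.1 h).2
      congr 1
      refine (T a).injective (Sigma.ext h1 ?_)
      have := hone a
      generalize T a i = u at *
      generalize T a j = v at *
      obtain ⟨p, s⟩ := u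
      obtain ⟨q, t⟩ := v
      obtain rfl : p = q := h1
      have hp := this p
      refine heq_of_eq (Fin.ext ?_)
      have hs : s.1 < p.1 := s.2
      have ht : t.1 < p.1 := t.2
      change s.1 = t.1
      omega
    · rintro ⟨a, p⟩
      refine ⟨⟨a, (T a).symm ⟨p, ⟨0, by rw [hone a p]; exact one_pos⟩⟩⟩, ?_⟩
      simp [row]
  let ρ := Equiv.ofBijective _ hrow
  refine LinearMap.funLeft_injective_of_surjective ℂ ℂ _ fun x => ?_
  have hlab : ∀ v, (ρ.symm v).1 = v.1 := fun v => congrArg Sigma.fst (ρ.apply_symm_apply v)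
  refine ⟨⟨fun v => x.1 (ρ.symm v), fun v w h => ?_⟩, ?_⟩
  · have := x.2 (ρ.symm v) (ρ.symm w)
    simp only [xlab, hlab] at this
    exact this h
  · refine Subtype.ext (funext fun v => ?_)
    exact congrArg x.1 (ρ.symm_apply_apply v)

/-- The step of the filtration that precedes `Γ_μ` is `Γ'_μ`.  If `μ` is the smallest
multipartition, this says that `Γ'_μ = 0`, which holds because the evaluation at the
multipartition into ones only renames the variables. -/
theorem Γpred_eq (μ : F.MultiPartition m) : F.Γpred ξ T μ = F.Γ' ξ T μ := by
  refine le_antisymm (iSup₂_le fun ν hν g hg => ?_) fun g hg => ?_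
  · rw [mem_Γ] at hg
    rw [mem_Γ']
    refine ⟨hg.1, ?_⟩
    rintro τ (hτ | rfl)
    exacts [hg.2 τ (F.multiLT_trans hν hτ), hg.2 μ hν]
  · by_cases h : ∃ ν, F.multiLT ν μ
    · obtain ⟨ν, hν⟩ := h
      obtain ⟨ρ, hρ, hsucc⟩ := F.exists_pred hν
      refine Submodule.mem_iSup_of_mem ρ (Submodule.mem_iSup_of_mem hρ ?_)
      rw [mem_Γ'] at hg
      exact (F.mem_Γ ξ T).2 ⟨hg.1, fun τ hτ => hg.2 τ (hsucc τ hτ)⟩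
    · push Not at h
      rw [mem_Γ'] at hg
      have h0 : F.φ (T (F.ones m)) g = 0 := by
        refine hg.2 _ ?_
        rcases F.multiLT_trichotomy μ (F.ones m) with h1 | h1 | h1
        exacts [Or.inl h1, Or.inr h1, absurd h1 (h _)]
      rw [F.φ_ones_injective _ (h0.trans (map_zero _).symm)]
      exact Submodule.zero_mem _

/-! ### The induced isomorphisms -/

section Induced

variable {ξ}
variable (hκ : 0 < F.κ) (hξ : IsPrimitiveRoot ξ F.κ)
  (hsymm : ∀ a b, F.fold a b < 0 → F.fold b a < 0) (hdiag : ∀ a, 0 ≤ F.fold a a)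

/-- The restriction of the evaluation map `φ_μ` to a map from `Γ_μ` to `ℋ̃[μ]`. -/
noncomputable def φΓ (μ : F.MultiPartition m) : F.Γ ξ T μ →ₗ[ℂ] F.Htilde μ :=
  (F.φ (T μ)).restrict fun _ hg => F.φ_mem_Htilde hκ hξ hsymm hdiag T hg

theorem φΓ_surjective (μ : F.MultiPartition m) :
    Function.Surjective (F.φΓ T hκ hξ hsymm hdiag μ) := by
  rintro ⟨H, hH⟩
  obtain ⟨g, hg, rfl⟩ := F.exists_φ_eq hκ hξ hsymm hdiag T hH
  exact ⟨⟨g, hg⟩, rfl⟩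

theorem ker_φΓ (μ : F.MultiPartition m) :
    (F.Γ' ξ T μ).submoduleOf (F.Γ ξ T μ) = LinearMap.ker (F.φΓ T hκ hξ hsymm hdiag μ) := by
  ext ⟨g, hg⟩
  rw [LinearMap.mem_ker, Subtype.ext_iff]
  exact (F.mem_Γ'_iff ξ T).trans (and_iff_right hg)

/-- The isomorphism `Γ_μ / (Γ_μ ∩ W) ≅ ℋ̃[μ]` induced by `φ_μ` when `W = Γ'_μ`. -/
noncomputable def quotEquiv {W : Submodule ℂ (F.Reg (F.xlab m) → ℂ)} {μ : F.MultiPartition m}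
    (hW : W = F.Γ' ξ T μ) : (F.Γ ξ T μ ⧸ W.submoduleOf (F.Γ ξ T μ)) ≃ₗ[ℂ] F.Htilde μ :=
  (Submodule.quotEquivOfEq _ _ (hW ▸ F.ker_φΓ T hκ hξ hsymm hdiag μ)).trans
    ((F.φΓ T hκ hξ hsymm hdiag μ).quotKerEquivOfSurjective (F.φΓ_surjective T hκ hξ hsymm hdiag μ))

theorem quotDeg_map_le {W : Submodule ℂ (F.Reg (F.xlab m) → ℂ)} {μ : F.MultiPartition m}
    (hW : W = F.Γ' ξ T μ) (d : ℤ) :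
    (F.quotDeg ξ T W μ d).map (F.quotEquiv T hκ hξ hsymm hdiag hW).toLinearMap ≤
      F.HtildeDeg μ d := by
  rintro _ ⟨_, ⟨g, hg, rfl⟩, rfl⟩
  exact F.φ_homog (T μ) hg

/-- The isomorphism of the associated graded space with the sum of the spaces `ℋ̃[μ]`. -/
noncomputable def grEquiv :
    F.gr ξ T ≃ₗ[ℂ] DirectSum (F.MultiPartition m) fun μ => F.Htilde μ :=
  DFinsupp.mapRange.linearEquiv fun μ => F.quotEquiv T hκ hξ hsymm hdiag (F.Γpred_eq ξ T μ)

theorem grEquiv_lof (μ : F.MultiPartition m)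
    (x : F.Γ ξ T μ ⧸ (F.Γpred ξ T μ).submoduleOf (F.Γ ξ T μ)) :
    F.grEquiv T hκ hξ hsymm hdiag (DirectSum.lof ℂ (F.MultiPartition m)
        (fun μ => F.Γ ξ T μ ⧸ (F.Γpred ξ T μ).submoduleOf (F.Γ ξ T μ)) μ x) =
      DirectSum.lof ℂ (F.MultiPartition m) (fun μ => F.Htilde μ) μ
        (F.quotEquiv T hκ hξ hsymm hdiag (F.Γpred_eq ξ T μ) x) :=
  DFinsupp.mapRange_single (hf := fun _ => map_zero _)

theorem grDeg_map_le (d : ℤ) :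
    (F.grDeg ξ T d).map (F.grEquiv T hκ hξ hsymm hdiag).toLinearMap ≤ F.sumHtildeDeg m d := by
  rw [grDeg, Submodule.map_iSup]
  refine iSup_mono fun μ => ?_
  rintro _ ⟨_, ⟨x, hx, rfl⟩, rfl⟩
  exact ⟨_, F.quotDeg_map_le T hκ hξ hsymm hdiag (F.Γpred_eq ξ T μ) d
    (Submodule.mem_map_of_mem hx), (F.grEquiv_lof T hκ hξ hsymm hdiag μ x).symm⟩

theorem gradings_gr :
    DirectSum.IsInternal (F.grDeg ξ T) ∧ DirectSum.IsInternal (F.sumHtildeDeg m) ∧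
      ∀ d : ℤ, (F.grDeg ξ T d).map (F.grEquiv T hκ hξ hsymm hdiag).toLinearMap =
        F.sumHtildeDeg m d :=
  gradings_of_map_le (F.grEquiv T hκ hξ hsymm hdiag) _ _ (F.iSup_grDeg ξ T)
    (F.grDeg_map_le T hκ hξ hsymm hdiag) (F.iSupIndep_sumHtildeDeg m)

end Induced

/-- The evaluation maps identify the subquotients of the filtration with the spaces `ℋ̃[μ]`, and
the associated graded space with their direct sum. -/
theorem exists_graded_equiv (hκ : 0 < F.κ) (hξ : IsPrimitiveRoot ξ F.κ)
    (hsymm : ∀ a b, F.fold a b < 0 → F.fold b a < 0) (hdiag : ∀ a, 0 ≤ F.fold a a) :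
    ∃ e : ∀ μ : F.MultiPartition m,
        (F.Γ ξ T μ ⧸ (F.Γ' ξ T μ).submoduleOf (F.Γ ξ T μ)) ≃ₗ[ℂ] F.Htilde μ,
      (∀ μ (g : F.Γ ξ T μ),
        ((e μ (Submodule.Quotient.mk g) : F.Htilde μ) : F.H μ) = F.φ (T μ) g.1) ∧
      (∀ μ, DirectSum.IsInternal (F.quotDeg ξ T (F.Γ' ξ T μ) μ) ∧
        DirectSum.IsInternal (F.HtildeDeg μ) ∧
        ∀ d : ℤ, (F.quotDeg ξ T (F.Γ' ξ T μ) μ d).map (e μ).toLinearMap = F.HtildeDeg μ d) ∧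
      ∃ Φ : F.gr ξ T ≃ₗ[ℂ] DirectSum (F.MultiPartition m) fun μ => F.Htilde μ,
        (∀ μ (g : F.Γ ξ T μ),
          Φ (DirectSum.lof ℂ (F.MultiPartition m)
              (fun μ => F.Γ ξ T μ ⧸ (F.Γpred ξ T μ).submoduleOf (F.Γ ξ T μ))
              μ (Submodule.Quotient.mk g)) =
            DirectSum.lof ℂ (F.MultiPartition m) (fun μ => F.Htilde μ)
              μ (e μ (Submodule.Quotient.mk g))) ∧
        DirectSum.IsInternal (F.grDeg ξ T) ∧ DirectSum.IsInternal (F.sumHtildeDeg m) ∧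
        ∀ d : ℤ, (F.grDeg ξ T d).map Φ.toLinearMap = F.sumHtildeDeg m d := by
  refine ⟨fun μ => F.quotEquiv T hκ hξ hsymm hdiag rfl, fun μ g => rfl,
    fun μ => gradings_of_map_le _ _ _ (F.iSup_quotDeg ξ T _ μ)
      (F.quotDeg_map_le T hκ hξ hsymm hdiag rfl) (F.iSupIndep_HtildeDeg μ), ?_⟩
  exact ⟨F.grEquiv T hκ hξ hsymm hdiag,
    fun μ g => F.grEquiv_lof T hκ hξ hsymm hdiag μ (Submodule.Quotient.mk g),
    F.gradings_gr T hκ hξ hsymm hdiag⟩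

end Folding

end TwistedLoop

theorem theorem3p4 (X : TwistedLoop.TwistedType) (ξ : ℂ) (hξ : IsPrimitiveRoot ξ X.folding.κ)
    (m : Fin X.folding.r → ℕ)
    (T : ∀ μ : X.folding.MultiPartition m, X.folding.Tableaux μ) :
    ∃ e : ∀ μ : X.folding.MultiPartition m,
        (X.folding.Γ ξ T μ ⧸ (X.folding.Γ' ξ T μ).submoduleOf (X.folding.Γ ξ T μ)) ≃ₗ[ℂ]
          X.folding.Htilde μ,
      -- each `e μ` is induced by the evaluation map
      (∀ μ (g : X.folding.Γ ξ T μ),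
        ((e μ (Submodule.Quotient.mk g) : X.folding.Htilde μ) : X.folding.H μ) =
          X.folding.φ (T μ) g.1) ∧
      -- and is an isomorphism of graded spaces
      (∀ μ, DirectSum.IsInternal (X.folding.quotDeg ξ T (X.folding.Γ' ξ T μ) μ) ∧
        DirectSum.IsInternal (X.folding.HtildeDeg μ) ∧
        ∀ d : ℤ, (X.folding.quotDeg ξ T (X.folding.Γ' ξ T μ) μ d).map (e μ).toLinearMap =
          X.folding.HtildeDeg μ d) ∧
      -- so that the associated graded space is the direct sum of the spaces of functions
      ∃ Φ : X.folding.gr ξ T ≃ₗ[ℂ] DirectSum (X.folding.MultiPartition m) fun μ => X.folding.Htilde μ,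
        (∀ μ (g : X.folding.Γ ξ T μ),
          Φ (DirectSum.lof ℂ (X.folding.MultiPartition m)
              (fun μ => X.folding.Γ ξ T μ ⧸
                (X.folding.Γpred ξ T μ).submoduleOf (X.folding.Γ ξ T μ))
              μ (Submodule.Quotient.mk g)) =
            DirectSum.lof ℂ (X.folding.MultiPartition m) (fun μ => X.folding.Htilde μ)
              μ (e μ (Submodule.Quotient.mk g))) ∧
        DirectSum.IsInternal (X.folding.grDeg ξ T) ∧
        DirectSum.IsInternal (X.folding.sumHtildeDeg m) ∧
        ∀ d : ℤ, (X.folding.grDeg ξ T d).map Φ.toLinearMap =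
          X.folding.sumHtildeDeg m d :=
  X.folding.exists_graded_equiv ξ T (TwistedLoop.folding_κ_pos X) hξ (TwistedLoop.fold_neg_symm X)
    (TwistedLoop.fold_diag_nonneg X)
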